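/- **Setting.** Circles are oriented generalized circles (circles and lines) in $\hat{\mathbb C}=\mathbb C\cup\{\infty\}$; an orientation is the choice of one of the two complementary regions as the interior. Two collections $B,\hat B$ of circles form a *base/dual configuration pair* if (1) the circles of $B$ are pairwise disjoint or tangent, with disjoint interiors, and likewise for $\hat B$; (2) the tangency graphs $G_B$, $G_{\hat B}$ (naturally embedded, vertices at interior points of the circles, edges through the points of tangency) are nontrivial, connected and plane duals of each other, away from accumulation points; (3) a circle of $B$ and a circle of $\hat B$ intersect if and only if they form a vertex-face pair of these graphs, in which case they are orthogonal, and otherwise their interiors are disjoint; (4) $B\cup\hat B$ has at most one accumulation point (a point each of whose neighbourhoods contains infinitely many of the circles). The *packing* of $(B,\hat B)$ is the orbit of $B$ under the group generated by the reflections across the circles of $\hat B$, and $\Gamma_2=\mathrm{Sym}(B,\hat B)$ is the group of all holomorphic and antiholomorphic Möbius transformations that preserve both $B$ and $\hat B$. The base configuration of the *square packing* consists of the unit circles centred at the points of $2\mathbb Z+2i\mathbb Z$, that of the *triangular packing* of the circles of radius $\tfrac12$ centred at the points of $\mathbb Z+\tfrac{1+i\sqrt3}{2}\mathbb Z$ (all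 with bounded interior). A *refinement* of such a configuration $B_0$ is a collection $B\supseteq B_0$ in which each additional circle is smaller than the circles of $B_0$; $B=B_0$ is allowed. A *wallpaper group* is a discrete group of isometries of the plane $\mathbb C$ which contains translations in two linearly independent directions. Wallpaper groups are considered up to affine equivalence, i.e. conjugation by an invertible real-affine map of the plane; there are 17 classes. **Theorem.** For every wallpaper group $G$ there is a circle packing, with base and dual configurations $B,\hat B$, such that $B$ is a refinement of the base configuration of the triangular packing or of the square packing, and such that $\Gamma_2=\mathrm{Sym}(B,\hat B)$ fixes $\infty$ and is, as a group of transformations of $\mathbb C$, affinely equivalent to $G$: for some invertible real-affine map $\varphi$ of $\mathbb C$, $\Gamma_2$ consists exactly of the maps $\varphi\circ g\circ\varphi^{-1}$, $g\in G$ (extended by $\infty\mapsto\infty$). In particular $\Gamma_2\cong G$, and each of the 17 wallpaper groups occurs. -/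

import Mathlib

open Set Topology OnePoint
open scoped Pointwise

/-! ### Oriented generalized circles in the extended complex plane `OnePoint ℂ` -/

/-- An oriented generalized circle of `OnePoint ℂ`, in inversive coordinates `(b̃, b, h)`: `b` is the
signed curvature, `b̃` the curvature after inversion in the unit circle, and `h` is the centre times
the curvature (for a line, `b = 0` and `h` is the unit normal pointing into the interior). Each
oriented generalized circle has exactly one such coordinate vector. -/
@[ext]
structure OrientedCircle where
  cocurv : ℝ
  curv : ℝ
  h : ℂ
  normalized : h.re ^ 2 + h.im ^ 2 - curv * cocurv = 1

namespace OrientedCircle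

/-- The quadratic function which vanishes on the circle and is negative inside. -/
def form (c : OrientedCircle) (z : ℂ) : ℝ :=
  c.curv * (z.re ^ 2 + z.im ^ 2) - 2 * (c.h.re * z.re + c.h.im * z.im) + c.cocurv

/-- The interior of an oriented circle: an open disc, an open half-plane, or the exterior of a
closed disc together with `∞`. -/
def interior (c : OrientedCircle) : Set (OnePoint ℂ) :=
  {w | (∃ z : ℂ, w = z ∧ c.form z < 0) ∨ (w = ∞ ∧ c.curv < 0)}

/-- The underlying circle or (extended) line. -/
def circle (c : OrientedCircle) : Set (OnePoint ℂ) :=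
  {w | (∃ z : ℂ, w = z ∧ c.form z = 0) ∨ (w = ∞ ∧ c.curv = 0)}

/-- The Euclidean centre, if the curvature does not vanish. -/
noncomputable def center (c : OrientedCircle) : ℂ := c.h / (c.curv : ℂ)

/-- The inversive product, the bilinear form for which every oriented circle has square `1`. -/
noncomputable def inversive (c d : OrientedCircle) : ℝ :=
  c.h.re * d.h.re + c.h.im * d.h.im - (c.curv * d.cocurv + c.cocurv * d.curv) / 2

/-- Two circles are orthogonal when their inversive product vanishes. For two ordinary circles this
says `|z - z'| ^ 2 = r ^ 2 + r' ^ 2`; for two lines, that the normals are perpendicular; for a line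
and an ordinary circle, that the line passes through the centre. -/
def Orthogonal (c d : OrientedCircle) : Prop := inversive c d = 0

/-- Two distinct circles are tangent at `x` when `x` is their only common point in `OnePoint ℂ`. -/
def TangentAt (c d : OrientedCircle) (x : OnePoint ℂ) : Prop :=
  c ≠ d ∧ c.circle ∩ d.circle = {x}

theorem TangentAt.symm {c d : OrientedCircle} {x : OnePoint ℂ} (h : TangentAt c d x) :
    TangentAt d c x :=
  ⟨h.1.symm, by rw [inter_comm]; exact h.2⟩

/-- The circle with centre `z` and radius `r`, with the bounded component as interior. -/
noncomputable def ofCenter (z : ℂ) (r : ℝ) (hr : 0 < r) : OrientedCircle where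
  cocurv := (z.re ^ 2 + z.im ^ 2 - r ^ 2) / r
  curv := 1 / r
  h := ⟨z.re / r, z.im / r⟩
  normalized := by
    have := hr.ne'
    field_simp
    ring

/-- The image of the circle `c` under the reflection `σ_d` across the circle `d`. -/
noncomputable def reflectFun (d c : OrientedCircle) : OrientedCircle where
  cocurv := c.cocurv - 2 * inversive c d * d.cocurv
  curv := c.curv - 2 * inversive c d * d.curv
  h := ⟨c.h.re - 2 * inversive c d * d.h.re, c.h.im - 2 * inversive c d * d.h.im⟩
  normalized := by
    have hc := c.normalized
    have hd := d.normalized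
    simp only [inversive]
    linear_combination hc + 4 * (c.h.re * d.h.re + c.h.im * d.h.im
      - (c.curv * d.cocurv + c.cocurv * d.curv) / 2) ^ 2 * hd

theorem inversive_reflectFun (d c : OrientedCircle) :
    inversive (reflectFun d c) d = - inversive c d := by
  have hd := d.normalized
  simp only [reflectFun]
  simp only [inversive]
  linear_combination (-2) * (c.h.re * d.h.re + c.h.im * d.h.im
    - (c.curv * d.cocurv + c.cocurv * d.curv) / 2) * hd

theorem reflectFun_involutive (d : OrientedCircle) : Function.Involutive (reflectFun d) := by
  intro c
  have h := inversive_reflectFun d c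
  ext
  · change (reflectFun d c).cocurv - 2 * inversive (reflectFun d c) d * d.cocurv = _
    rw [h]; simp only [reflectFun]; ring
  · change (reflectFun d c).curv - 2 * inversive (reflectFun d c) d * d.curv = _
    rw [h]; simp only [reflectFun]; ring
  · apply Complex.ext
    · change (reflectFun d c).h.re - 2 * inversive (reflectFun d c) d * d.h.re = _
      rw [h]; simp only [reflectFun]; ring
    · change (reflectFun d c).h.im - 2 * inversive (reflectFun d c) d * d.h.im = _
      rw [h]; simp only [reflectFun]; ring

/-- The reflection `σ_d` as a permutation of the set of oriented circles. -/
noncomputable def reflection (d : OrientedCircle) : Equiv.Perm OrientedCircle :=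
  (reflectFun_involutive d).toPerm

end OrientedCircle

/-! ### Tangency graphs, their planar embeddings, and duality -/

/-- The tangency graph of a collection of circles. -/
def tangencyGraph (B : Set OrientedCircle) : SimpleGraph B where
  Adj c d := ∃ x, OrientedCircle.TangentAt (c : OrientedCircle) d x
  symm := ⟨fun _ _ ⟨x, hx⟩ => ⟨x, hx.symm⟩⟩
  loopless := ⟨fun _ ⟨_, hx⟩ => hx.1 rfl⟩

/-- A collection of circles accumulates at `x` if every neighbourhood of `x` contains infinitely
many circles of the collection. -/
def accumulationPoints (S : Set OrientedCircle) : Set (OnePoint ℂ) :=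
  {x | ∀ U ∈ 𝓝 x, {c | c ∈ S ∧ c.circle ⊆ U}.Infinite}

/-- The points at which the circle `c` is tangent to some circle of `B`. -/
def tangencyPoints (B : Set OrientedCircle) (c : OrientedCircle) : Set (OnePoint ℂ) :=
  {x | ∃ d ∈ B, OrientedCircle.TangentAt c d x}

/-- `S` is a simple arc with end points `p` and `q`. -/
def IsSimpleArc (p q : OnePoint ℂ) (S : Set (OnePoint ℂ)) : Prop :=
  ∃ γ : Path p q, Function.Injective γ ∧ range γ = S

/-- A natural embedding of the tangency graph of `B` in `OnePoint ℂ` minus a set `A` (the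
accumulation points): each vertex is placed at the centre of its circle (at some interior point, if
the interior is a half-plane or contains `∞`), and the edge of two circles `c`, `d` that
are tangent at a point `x ∉ A` consists of an arc `spoke c x` from the vertex of `c` to `x` inside
`c` and an arc `spoke d x` from the vertex of `d` to `x` inside `d`. For circles with a centre these
arcs are the straight radii. -/
structure NaturalEmbedding (B : Set OrientedCircle) (A : Set (OnePoint ℂ)) where
  vertex : OrientedCircle → OnePoint ℂ
  spoke : OrientedCircle → OnePoint ℂ → Set (OnePoint ℂ)
  vertex_mem : ∀ c ∈ B, vertex c ∈ c.interior
  vertex_eq : ∀ c ∈ B, 0 < c.curv → vertex c = (c.center : OnePoint ℂ)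
  spoke_arc : ∀ c ∈ B, ∀ x ∈ tangencyPoints B c \ A, IsSimpleArc (vertex c) x (spoke c x)
  spoke_subset : ∀ c ∈ B, ∀ x ∈ tangencyPoints B c \ A, spoke c x ⊆ c.interior ∪ {x}
  spoke_inter : ∀ c ∈ B, ∀ x ∈ tangencyPoints B c \ A, ∀ y ∈ tangencyPoints B c \ A, x ≠ y →
    spoke c x ∩ spoke c y = {vertex c}
  spoke_eq : ∀ c ∈ B, 0 < c.curv → ∀ z : ℂ, (z : OnePoint ℂ) ∈ tangencyPoints B c \ A →
    spoke c z = ((↑) : ℂ → OnePoint ℂ) '' segment ℝ c.center z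

namespace NaturalEmbedding

variable {B : Set OrientedCircle} {A : Set (OnePoint ℂ)}

/-- The edges are labelled by the tangency points outside `A`. -/
def edgeLabels (_D : NaturalEmbedding B A) : Set (OnePoint ℂ) :=
  (⋃ c ∈ B, tangencyPoints B c) \ A

/-- The edge through the tangency point `x`. -/
def edge (D : NaturalEmbedding B A) (x : OnePoint ℂ) : Set (OnePoint ℂ) :=
  ⋃ c ∈ {c | c ∈ B ∧ x ∈ tangencyPoints B c}, D.spoke c x

/-- The embedded graph: all vertices and all edges. -/
def support (D : NaturalEmbedding B A) : Set (OnePoint ℂ) :=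
  D.vertex '' B ∪ ⋃ x ∈ D.edgeLabels, D.edge x

/-- The complement, in `OnePoint ℂ` minus `A`, of the embedded graph. (The graph is closed there
when every vertex has finite degree. The spokes of a vertex of infinite degree accumulate at arcs
leading to an accumulation point, which are not counted as faces.) -/
def faceRegion (D : NaturalEmbedding B A) : Set (OnePoint ℂ) :=
  (A ∪ closure D.support)ᶜ

/-- The face which contains the point `p` of `faceRegion`. -/
def face (D : NaturalEmbedding B A) (p : OnePoint ℂ) : Set (OnePoint ℂ) :=
  connectedComponentIn D.faceRegion p

/-- The faces of the embedded graph. -/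
def faces (D : NaturalEmbedding B A) : Set (Set (OnePoint ℂ)) :=
  {F | ∃ p ∈ D.faceRegion, F = D.face p}

end NaturalEmbedding

/-- Plane duality of two embedded tangency graphs. Every vertex of either graph lies in a face of
the other and every face contains exactly one vertex of the other graph, and the edges correspond
bijectively so that each edge meets only its partner among the edges of the other graph, in exactly
one point. -/
structure ArePlaneDuals {B B' : Set OrientedCircle} {A : Set (OnePoint ℂ)}
    (D : NaturalEmbedding B A) (D' : NaturalEmbedding B' A) : Prop where
  vertex_mem : ∀ c ∈ B, D.vertex c ∈ D'.faceRegion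
  vertex_mem' : ∀ d ∈ B', D'.vertex d ∈ D.faceRegion
  face_vertex : ∀ F ∈ D.faces, ∃! d, d ∈ B' ∧ D'.vertex d ∈ F
  face_vertex' : ∀ F ∈ D'.faces, ∃! c, c ∈ B ∧ D.vertex c ∈ F
  edge_edge : ∀ x ∈ D.edgeLabels, ∃! x', x' ∈ D'.edgeLabels ∧ (D.edge x ∩ D'.edge x').Nonempty
  edge_edge' : ∀ x' ∈ D'.edgeLabels, ∃! x, x ∈ D.edgeLabels ∧ (D.edge x ∩ D'.edge x').Nonempty
  edge_inter : ∀ x ∈ D.edgeLabels, ∀ x' ∈ D'.edgeLabels, (D.edge x ∩ D'.edge x').Subsingleton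

/-! ### Base and dual configurations, packings -/

/-- The circles in `B` are pairwise disjoint or tangent, with disjoint interiors. -/
def HasDisjointInteriors (B : Set OrientedCircle) : Prop :=
  ∀ c ∈ B, ∀ d ∈ B, c ≠ d →
    Disjoint c.interior d.interior ∧
      (Disjoint c.circle d.circle ∨ ∃ x, OrientedCircle.TangentAt c d x)

/-- `B` is a base configuration with dual configuration `B'`. -/
structure IsBaseDualPair (B B' : Set OrientedCircle) : Prop where
  disjoint_base : HasDisjointInteriors B
  disjoint_dual : HasDisjointInteriors B'
  nontrivial_base : B.Nontrivial
  nontrivial_dual : B'.Nontrivial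
  connected_base : (tangencyGraph B).Connected
  connected_dual : (tangencyGraph B').Connected
  /-- The tangency graphs are plane duals of each other. A circle `c` of `B` and a circle `d` of
  `B'` intersect exactly when they form a face-vertex pair, i.e. the vertex `c` lies on the boundary
  of the face of `d`. In this case they are orthogonal, otherwise their interiors are disjoint. -/
  dual : ∃ (D : NaturalEmbedding B (accumulationPoints (B ∪ B')))
      (D' : NaturalEmbedding B' (accumulationPoints (B ∪ B'))),
    ArePlaneDuals D D' ∧
    ∀ c ∈ B, ∀ d ∈ B',
      ((c.circle ∩ d.circle).Nonempty ↔ D.vertex c ∈ closure (D.face (D'.vertex d))) ∧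
      ((c.circle ∩ d.circle).Nonempty → OrientedCircle.Orthogonal c d) ∧
      (Disjoint c.circle d.circle → Disjoint c.interior d.interior)
  accumulation : (accumulationPoints (B ∪ B')).Subsingleton

/-- The orbit of `B` under the group generated by the reflections across the circles in `B'`. -/
def reflectionOrbit (B B' : Set OrientedCircle) : Set OrientedCircle :=
  {c | ∃ g ∈ Subgroup.closure (OrientedCircle.reflection '' B'), ∃ b ∈ B, c = g b}

/-- `P` is the circle packing with base configuration `B` and dual configuration `B'`. -/
def IsPackingOf (P B B' : Set OrientedCircle) : Prop :=
  IsBaseDualPair B B' ∧ P = reflectionOrbit B B'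

/-! ### Moebius transformations and the symmetry group of a base/dual pair -/

/-- The group of holomorphic and antiholomorphic Moebius transformations of `OnePoint ℂ`. -/
noncomputable def moebiusGroup : Subgroup (Equiv.Perm (OnePoint ℂ)) where
  carrier := {f | ∃ g : GL (Fin 2) ℂ,
    (∀ w, f w = g • w) ∨ (∀ w, f w = g • OnePoint.map (starRingEnd ℂ) w)}
  one_mem' := ⟨1, Or.inl fun w => by simp⟩
  mul_mem' := by
    rintro a b ⟨g, hg⟩ ⟨k, hk⟩
    rcases hg with hg | hg <;> rcases hk with hk | hk
    · exact ⟨g * k, Or.inl fun w => by rw [Equiv.Perm.mul_apply, hg, hk, mul_smul]⟩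
    · exact ⟨g * k, Or.inr fun w => by rw [Equiv.Perm.mul_apply, hg, hk, mul_smul]⟩
    · exact ⟨g * k.map (starRingEnd ℂ), Or.inr fun w => by
        rw [Equiv.Perm.mul_apply, hg, hk, OnePoint.map_smul, mul_smul]⟩
    · exact ⟨g * k.map (starRingEnd ℂ), Or.inl fun w => by
        rw [Equiv.Perm.mul_apply, hg, hk, OnePoint.map_smul, mul_smul]
        cases w <;> simp⟩
  inv_mem' := by
    rintro a ⟨g, hg | hg⟩
    · exact ⟨g⁻¹, Or.inl fun w => by
        rw [Equiv.Perm.inv_eq_iff_eq, hg, smul_inv_smul]⟩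
    · refine ⟨g⁻¹.map (starRingEnd ℂ), Or.inr fun w => ?_⟩
      rw [Equiv.Perm.inv_eq_iff_eq, hg, ← OnePoint.map_smul]
      have : ∀ v : OnePoint ℂ,
          OnePoint.map (starRingEnd ℂ) (OnePoint.map (starRingEnd ℂ) v) = v := by
        intro v; cases v <;> simp
      rw [this, smul_inv_smul]

/-- The group of Moebius transformations that map the collection of oriented circles `B` onto
itself. An oriented circle is sent to the oriented circle whose interior is the image of its
interior. -/
noncomputable def moebiusStabilizer (B : Set OrientedCircle) :
    Subgroup (Equiv.Perm (OnePoint ℂ)) :=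
  moebiusGroup ⊓
    MulAction.stabilizer (Equiv.Perm (OnePoint ℂ)) (OrientedCircle.interior '' B)

/-- The group `Γ₂ = Sym(B, B')` of all Moebius transformations that preserve both `B` and `B'`. -/
noncomputable def symmetryGroup (B B' : Set OrientedCircle) :
    Subgroup (Equiv.Perm (OnePoint ℂ)) :=
  moebiusStabilizer B ⊓ moebiusStabilizer B'

/-! ### Refinements of the triangular and the square configuration -/

/-- The base configuration of the square packing: unit circles centred at `2m + 2ni`. -/
def squareBase : Set OrientedCircle :=
  {c | ∃ m n : ℤ,
    c = OrientedCircle.ofCenter (2 * (m : ℂ) + 2 * (n : ℂ) * Complex.I) 1 one_pos}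

/-- The base configuration of the triangular packing: circles of radius `1/2` centred at the points
of the triangular lattice `ℤ + ℤ (1 + i√3) / 2`. -/
noncomputable def triangularBase : Set OrientedCircle :=
  {c | ∃ m n : ℤ,
    c = OrientedCircle.ofCenter
      ((m : ℂ) + (n : ℂ) * ((1 + Complex.I * (Real.sqrt 3 : ℂ)) / 2)) (1 / 2) one_half_pos}

/-- `B` arises from `B₀` by adding (possibly no) circles that are smaller, i.e. have larger
curvature, than those of `B₀`. -/
def IsRefinementOf (B B₀ : Set OrientedCircle) : Prop :=
  B₀ ⊆ B ∧ ∀ c ∈ B, c ∉ B₀ → ∀ c₀ ∈ B₀, c₀.curv < c.curv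

/-! ### Wallpaper groups -/

/-- A wallpaper group: a discrete group of isometries of the plane which contains translations in
two linearly independent directions. Discreteness says that the identity is isolated for uniform
convergence on compact sets. -/
def IsWallpaperGroup (G : Subgroup (ℂ ≃ᵢ ℂ)) : Prop :=
  (∃ K : Set ℂ, IsCompact K ∧ ∃ ε > 0, ∀ g ∈ G, (∀ z ∈ K, dist (g z) z < ε) → g = 1) ∧
  ∃ v w : ℂ, LinearIndependent ℝ ![v, w] ∧
    IsometryEquiv.addRight v ∈ G ∧ IsometryEquiv.addRight w ∈ G

/-- The group `Γ` of transformations of `OnePoint ℂ` is the wallpaper group `G`, up to a real-affine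
change of coordinates `φ` of the plane: `Γ` consists precisely of the maps `φ ∘ g ∘ φ⁻¹`, `g ∈ G`,
extended by `∞ ↦ ∞`. -/
def IsAffinelyEquivalent (Γ : Subgroup (Equiv.Perm (OnePoint ℂ))) (G : Subgroup (ℂ ≃ᵢ ℂ)) : Prop :=
  ∃ φ : ℂ ≃ᵃ[ℝ] ℂ, ∀ f : Equiv.Perm (OnePoint ℂ),
    f ∈ Γ ↔ ∃ g ∈ G, f ∞ = ∞ ∧ ∀ z : ℂ, f z = (φ (g (φ.symm z)) : OnePoint ℂ)

/-! ### Inversive product, power and points of contact -/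

namespace OrientedCircle

/-! The symmetry group is first enlarged and then cut down. In a suitable affine coordinate every
wallpaper group is a group of isometries that preserve the triangular or the square lattice
(`IsWallpaperGroup.exists_latticeChart`), hence a subgroup of the stabilizer of one of the two
standard configurations. If there is a rotation of order at least three, the crystallographic
restriction forces the translation lattice to be square or triangular up to a similarity. Otherwise
two independent translations are preserved up to sign, and an affine map makes them orthogonal and
of equal length. Averaging over the finite point group supplies an origin which the group moves by
fractions of translations with bounded denominator. After a rescaling by the denominators the whole
group acts on the lattice.

It remains to refine a highly symmetric configuration so that exactly a given subgroup `G` of its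
stabilizer survives (`Config.exists_refinement`). To stack a face is to insert the circle that
touches all circles of the face (its apex), which replaces the face by triangles (its children).
Stacking all faces twice preserves all symmetries and produces a triangular face whose three
vertices belong to three different generations. An isometry that respects the generations and fixes
this face fixes its three vertices and the dual circle. These four circles span the space of
inversive coordinates, so the isometry is the identity. Now only the faces in the `G`-orbit of this
rigid face are stacked once more. An isometry that preserves the original configuration and the
result sends the apex of the rigid face to the apex of a translate under some `g` in `G`, so it
agrees with `g` on the rigid face and equals `g`.

A Moebius transformation that preserves the refinement is such an isometry
(`FlagTiling.symmetryGroup_eq`): it fixes `∞` because the circles accumulate only there, so it is a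
similarity; its ratio is one because the circles have a largest radius; and it preserves the
original circles because they are exactly the largest ones.

That the refined circles form a base/dual pair has an algebraic and a topological side.
Algebraically, apex and children are linear combinations of vectors in inversive coordinates, and
tangency, orthogonality and disjointness are conditions on inversive products, so `Config.stack` is
linear algebra with inequalities. Topologically, the faces of the straight tangency graph of `B` are
the open power cells (Laguerre cells) of the dual circles, and conversely. This uses that the right
triangles spanned by a base centre, a contact point and a dual centre cover the plane, a property
that passes to subdivisions. Plane duality and connectedness (`FlagTiling.isBaseDualPair`) then
follow from comparisons of powers. -/

theorem inversive_comm (c d : OrientedCircle) : inversive c d = inversive d c := by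
  simp only [inversive]; ring

theorem inversive_self (c : OrientedCircle) : inversive c c = 1 := by
  have := c.normalized
  simp only [inversive]; linear_combination this

/-- The power of the point `z` with respect to the circle `c`, in the case `c.curv ≠ 0`. -/
noncomputable def power (c : OrientedCircle) (z : ℂ) : ℝ :=
  z.re ^ 2 + z.im ^ 2 - 2 * (c.h.re / c.curv * z.re + c.h.im / c.curv * z.im) + c.cocurv / c.curv

theorem form_eq_mul_power {c : OrientedCircle} (hc : 0 < c.curv) (z : ℂ) :
    c.form z = c.curv * c.power z := by
  have := hc.ne'
  simp only [form, power]; field_simp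

theorem center_re (c : OrientedCircle) : c.center.re = c.h.re / c.curv := by
  simp [center, Complex.div_ofReal_re]

theorem center_im (c : OrientedCircle) : c.center.im = c.h.im / c.curv := by
  simp [center, Complex.div_ofReal_im]

theorem normSq_center {c : OrientedCircle} (hc : 0 < c.curv) :
    (c.h.re / c.curv) ^ 2 + (c.h.im / c.curv) ^ 2 = c.cocurv / c.curv + 1 / c.curv ^ 2 := by
  have h := c.normalized
  have := hc.ne'
  field_simp
  linear_combination h

theorem norm_sub_sq (z w : ℂ) : ‖z - w‖ ^ 2 = (z.re - w.re) ^ 2 + (z.im - w.im) ^ 2 := by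
  rw [← Complex.normSq_eq_norm_sq, Complex.normSq_apply]
  simp; ring

theorem power_eq_dist {c : OrientedCircle} (hc : 0 < c.curv) (z : ℂ) :
    c.power z = ‖z - c.center‖ ^ 2 - 1 / c.curv ^ 2 := by
  have h := normSq_center hc
  rw [norm_sub_sq, center_re, center_im, power]
  linear_combination -h

/-- This formula turns the sign conditions on inversive products into comparisons of powers, and so
links the algebra of configurations with the geometry of power cells. -/
theorem power_center {c d : OrientedCircle} (hc : 0 < c.curv) (hd : 0 < d.curv) :
    d.power c.center = 1 / c.curv ^ 2 - 2 * inversive c d / (c.curv * d.curv) := by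
  have h := normSq_center hc
  have h1 : 2 * inversive c d / (c.curv * d.curv) =
    2 * (c.h.re / c.curv * (d.h.re / d.curv) + c.h.im / c.curv * (d.h.im / d.curv))
      - d.cocurv / d.curv - c.cocurv / c.curv := by
    have := hc.ne'; have := hd.ne'
    simp only [inversive]; field_simp; ring
  rw [h1, power, center_re, center_im]
  linear_combination h

theorem dist_center_sq {c d : OrientedCircle} (hc : 0 < c.curv) (hd : 0 < d.curv) :
    ‖c.center - d.center‖ ^ 2 =
      1 / c.curv ^ 2 + 1 / d.curv ^ 2 - 2 * inversive c d / (c.curv * d.curv) := by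
  have h1 := power_center hc hd
  rw [power_eq_dist hd] at h1
  linarith

/-- The difference of the powers with respect to two circles is an affine function. -/
theorem power_sub_power_comb (c d : OrientedCircle) {x y z : ℂ} {α β γ : ℝ} (h : α + β + γ = 1) :
    d.power (α * x + β * y + γ * z) - c.power (α * x + β * y + γ * z) =
      α * (d.power x - c.power x) + β * (d.power y - c.power y) +
        γ * (d.power z - c.power z) := by
  simp only [power, Complex.add_re, Complex.add_im, Complex.re_ofReal_mul, Complex.im_ofReal_mul]
  linear_combination (c.cocurv / c.curv - d.cocurv / d.curv) * h

/-- The common point of two tangent circles. -/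
noncomputable def contact (c d : OrientedCircle) : ℂ := (c.h + d.h) / ((c.curv + d.curv : ℝ) : ℂ)

theorem contact_comm (c d : OrientedCircle) : contact c d = contact d c := by
  simp only [contact, add_comm]

theorem contact_re (c d : OrientedCircle) :
    (contact c d).re = (c.h.re + d.h.re) / (c.curv + d.curv) := by
  rw [contact, Complex.div_ofReal_re, Complex.add_re]

theorem contact_im (c d : OrientedCircle) :
    (contact c d).im = (c.h.im + d.h.im) / (c.curv + d.curv) := by
  rw [contact, Complex.div_ofReal_im, Complex.add_im]

/-- Completing the square in the sum of the two quadratic forms leaves a constant that depends on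
the inversive product only. It decides disjointness (product below `-1`) and yields the unique
common point when the product is `-1`. -/
theorem form_add_form {c d : OrientedCircle} (hc : 0 < c.curv) (hd : 0 < d.curv) (z : ℂ) :
    (c.curv + d.curv) * (c.form z + d.form z) =
      (c.curv + d.curv) ^ 2 * ‖z - contact c d‖ ^ 2 - 2 - 2 * inversive c d := by
  have h1 := c.normalized
  have h2 := d.normalized
  have h3 : c.curv + d.curv ≠ 0 := by positivity
  rw [norm_sub_sq, contact_re, contact_im]
  simp only [form, inversive]
  field_simp
  linear_combination -h1 - h2

/-- For tangent circles the sum of the two coordinate vectors is isotropic and represents the point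
of contact. Evaluating the form of `e` there is pairing with this vector. -/
theorem form_contact {c d : OrientedCircle} (hc : 0 < c.curv) (hd : 0 < d.curv)
    (h : inversive c d = -1) (e : OrientedCircle) :
    (c.curv + d.curv) * e.form (contact c d) = -2 * (inversive c e + inversive d e) := by
  have h1 := c.normalized
  have h2 := d.normalized
  have h3 : c.curv + d.curv ≠ 0 := by positivity
  have h4 : (c.h.re + d.h.re) ^ 2 + (c.h.im + d.h.im) ^ 2 =
      (c.curv + d.curv) * (c.cocurv + d.cocurv) := by
    simp only [inversive] at h
    linear_combination h1 + h2 + 2 * h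
  have h5 : ((c.h.re + d.h.re) / (c.curv + d.curv)) ^ 2 +
      ((c.h.im + d.h.im) / (c.curv + d.curv)) ^ 2 =
      (c.cocurv + d.cocurv) / (c.curv + d.curv) := by
    field_simp; linear_combination h4
  simp only [form, contact_re, contact_im, h5, inversive]
  field_simp
  ring

theorem form_contact_left {c d : OrientedCircle} (hc : 0 < c.curv) (hd : 0 < d.curv)
    (h : inversive c d = -1) : c.form (contact c d) = 0 := by
  have h1 := form_contact hc hd h c
  rw [inversive_self, inversive_comm d c, h] at h1
  have h3 : c.curv + d.curv ≠ 0 := by positivity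
  simpa [h3] using h1

theorem form_contact_right {c d : OrientedCircle} (hc : 0 < c.curv) (hd : 0 < d.curv)
    (h : inversive c d = -1) : d.form (contact c d) = 0 := by
  rw [contact_comm]; exact form_contact_left hd hc (by rw [inversive_comm, h])

theorem form_contact_orthogonal {c d e : OrientedCircle} (hc : 0 < c.curv) (hd : 0 < d.curv)
    (h : inversive c d = -1) (h1 : inversive c e = 0) (h2 : inversive d e = 0) :
    e.form (contact c d) = 0 := by
  have h1 := form_contact hc hd h e
  have h3 : c.curv + d.curv ≠ 0 := by positivity
  simp_all

theorem eq_contact {c d : OrientedCircle} (hc : 0 < c.curv) (hd : 0 < d.curv)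
    (h : inversive c d = -1) {z : ℂ} (h1 : c.form z = 0) (h2 : d.form z = 0) :
    z = contact c d := by
  have h4 := form_add_form hc hd z
  rw [h, h1, h2] at h4
  have h3 : c.curv + d.curv ≠ 0 := by positivity
  have : ‖z - contact c d‖ = 0 := by
    have : (c.curv + d.curv) ^ 2 * ‖z - contact c d‖ ^ 2 = 0 := by linarith
    simpa [h3] using this
  rwa [norm_eq_zero, sub_eq_zero] at this

/-- In a base/dual quadruple, both pairs of tangent circles touch at the same point. -/
theorem contact_eq_contact {c c' d d' : OrientedCircle} (hc : 0 < c.curv) (hc' : 0 < c'.curv)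
    (hd : 0 < d.curv) (hd' : 0 < d'.curv) (h : inversive c c' = -1) (h' : inversive d d' = -1)
    (h1 : inversive c d = 0) (h2 : inversive c d' = 0) (h3 : inversive c' d = 0)
    (h4 : inversive c' d' = 0) : contact c c' = contact d d' :=
  eq_contact hd hd' h' (form_contact_orthogonal hc hc' h h1 h3)
    (form_contact_orthogonal hc hc' h h2 h4)

theorem mem_interior_coe {c : OrientedCircle} {z : ℂ} :
    (z : OnePoint ℂ) ∈ c.interior ↔ c.form z < 0 := by
  simp [interior]

theorem mem_circle_coe {c : OrientedCircle} {z : ℂ} :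
    (z : OnePoint ℂ) ∈ c.circle ↔ c.form z = 0 := by
  simp [circle]

theorem infty_notMem_interior {c : OrientedCircle} (hc : 0 < c.curv) : ∞ ∉ c.interior := by
  simp [interior, hc.le]

theorem infty_notMem_circle {c : OrientedCircle} (hc : 0 < c.curv) : ∞ ∉ c.circle := by
  simp [circle, hc.ne']

theorem disjoint_interior {c d : OrientedCircle} (hc : 0 < c.curv) (hd : 0 < d.curv)
    (h : inversive c d ≤ -1) : Disjoint c.interior d.interior := by
  rw [Set.disjoint_left]
  intro w h1 h2
  cases w with
  | infty => exact infty_notMem_interior hc h1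
  | coe z =>
    rw [mem_interior_coe] at h1 h2
    have h4 := form_add_form hc hd z
    have : 0 ≤ (c.curv + d.curv) ^ 2 * ‖z - contact c d‖ ^ 2 := by positivity
    have : (c.curv + d.curv) * (c.form z + d.form z) < 0 :=
      mul_neg_of_pos_of_neg (by linarith) (by linarith)
    linarith

theorem disjoint_circle {c d : OrientedCircle} (hc : 0 < c.curv) (hd : 0 < d.curv)
    (h : inversive c d < -1) : Disjoint c.circle d.circle := by
  rw [Set.disjoint_left]
  intro w h1 h2
  cases w with
  | infty => exact infty_notMem_circle hc h1
  | coe z =>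
    rw [mem_circle_coe] at h1 h2
    have h4 := form_add_form hc hd z
    have : 0 ≤ (c.curv + d.curv) ^ 2 * ‖z - contact c d‖ ^ 2 := by positivity
    rw [h1, h2] at h4
    linarith

theorem tangentAt_contact {c d : OrientedCircle} (hc : 0 < c.curv) (hd : 0 < d.curv)
    (h : inversive c d = -1) : TangentAt c d (contact c d) := by
  refine ⟨?_, ?_⟩
  · rintro rfl
    rw [inversive_self] at h; norm_num at h
  · ext w
    cases w with
    | infty => simp [infty_notMem_circle hc]
    | coe z =>
      simp only [mem_inter_iff, mem_circle_coe, mem_singleton_iff, OnePoint.coe_eq_coe]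
      exact ⟨fun h1 => eq_contact hc hd h h1.1 h1.2, fun h1 => by
        rw [h1]; exact ⟨form_contact_left hc hd h, form_contact_right hc hd h⟩⟩

theorem TangentAt.eq_contact {c d : OrientedCircle} (hc : 0 < c.curv) (hd : 0 < d.curv)
    (h : inversive c d ≤ -1) {x : OnePoint ℂ} (hx : TangentAt c d x) :
    inversive c d = -1 ∧ x = contact c d := by
  have h1 : inversive c d = -1 := by
    refine le_antisymm h (not_lt.1 fun h2 => ?_)
    have := disjoint_circle hc hd h2
    rw [Set.disjoint_iff_inter_eq_empty, hx.2] at this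
    exact absurd this (by simp)
  refine ⟨h1, ?_⟩
  have h2 := (tangentAt_contact hc hd h1).2
  rw [hx.2] at h2
  simpa using h2

/-- Two orthogonal circles intersect. -/
theorem circle_inter_nonempty {c d : OrientedCircle} (hc : 0 < c.curv) (hd : 0 < d.curv)
    (h : inversive c d = 0) : (c.circle ∩ d.circle).Nonempty := by
  have hD := dist_center_sq hc hd
  rw [h] at hD
  set r := 1 / c.curv with hr
  set s := 1 / d.curv with hs
  have hr0 : 0 < r := by positivity
  have hs0 : 0 < s := by positivity
  have hD' : ‖c.center - d.center‖ ^ 2 = r ^ 2 + s ^ 2 := by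
    rw [hD, hr, hs]; field_simp; ring
  set p := c.center
  set q := d.center
  have hne : p - q ≠ 0 := by
    intro h0
    rw [h0, norm_zero] at hD'
    nlinarith
  rw [← Complex.normSq_eq_norm_sq] at hD'
  have key : ∀ t : ℝ, Complex.normSq ((r : ℂ) + t * Complex.I) = r ^ 2 + t ^ 2 := by
    intro t; rw [Complex.normSq_add_mul_I]
  have key' : (p - q) * (starRingEnd ℂ) (p - q) = ((r ^ 2 + s ^ 2 : ℝ) : ℂ) := by
    rw [Complex.mul_conj, hD']
  have hconj : (starRingEnd ℂ) (p - q) ≠ 0 := (map_ne_zero _).2 hne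
  -- the point `z` with `z - p = r (r + i s) / conj (q - p)`
  refine ⟨((p - (r * (r + s * Complex.I) / (starRingEnd ℂ) (p - q)) : ℂ) : OnePoint ℂ), ?_, ?_⟩
  · rw [mem_circle_coe, form_eq_mul_power hc, power_eq_dist hc]
    have : ‖p - (r * (r + s * Complex.I) / (starRingEnd ℂ) (p - q)) - p‖ ^ 2 = r ^ 2 := by
      rw [sub_sub_cancel_left, ← Complex.normSq_eq_norm_sq, Complex.normSq_neg, map_div₀, map_mul,
        Complex.normSq_conj, hD', key, Complex.normSq_ofReal]
      field_simp
    rw [this, hr]; field_simp; simp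
  · rw [mem_circle_coe, form_eq_mul_power hd, power_eq_dist hd]
    have : p - (r * (r + s * Complex.I) / (starRingEnd ℂ) (p - q)) - q =
        (s * (s - r * Complex.I)) / (starRingEnd ℂ) (p - q) := by
      rw [eq_div_iff hconj, sub_right_comm, sub_mul, div_mul_cancel₀ _ hconj, key']
      push_cast
      ring
    have h2 : Complex.normSq ((s : ℂ) - r * Complex.I) = s ^ 2 + r ^ 2 := by
      have := Complex.normSq_add_mul_I s (-r)
      push_cast at this
      rw [neg_mul, ← sub_eq_add_neg] at this
      rw [this]; ring
    rw [this, ← Complex.normSq_eq_norm_sq, map_div₀, map_mul, Complex.normSq_conj, hD', h2,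
      Complex.normSq_ofReal, hs]
    have : r ^ 2 + s ^ 2 ≠ 0 := by positivity
    field_simp
    ring

end OrientedCircle

/-! ### Flag tilings and power cells -/

open OrientedCircle

/-- Two locally finite collections `B`, `B'` of circles, such that circles of the same collection
have disjoint interiors, circles of different collections are orthogonal or disjoint, tangent
pairs of either collection are orthogonal to a tangent pair of the other, and the right
triangles spanned by the centres of two orthogonal circles and one of their points of intersection
cover the plane. -/
structure FlagTiling (B B' : Set OrientedCircle) : Prop where
  one_le_curv : ∀ c ∈ B, 1 ≤ c.curv
  one_le_curv' : ∀ d ∈ B', 1 ≤ d.curv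
  inv_le : ∀ c ∈ B, ∀ c' ∈ B, c ≠ c' → inversive c c' ≤ -1
  inv_le' : ∀ d ∈ B', ∀ d' ∈ B', d ≠ d' → inversive d d' ≤ -1
  inv_dual : ∀ c ∈ B, ∀ d ∈ B', inversive c d = 0 ∨ inversive c d < -1
  infinite : B.Infinite
  infinite' : B'.Infinite
  finite : ∀ R, {c ∈ B | ‖c.center‖ ≤ R}.Finite
  finite' : ∀ R, {d ∈ B' | ‖d.center‖ ≤ R}.Finite
  edge : ∀ c ∈ B, ∀ c' ∈ B, inversive c c' = -1 → ∃ d ∈ B', ∃ d' ∈ B', inversive d d' = -1 ∧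
    inversive c d = 0 ∧ inversive c d' = 0 ∧ inversive c' d = 0 ∧ inversive c' d' = 0
  edge' : ∀ d ∈ B', ∀ d' ∈ B', inversive d d' = -1 → ∃ c ∈ B, ∃ c' ∈ B, inversive c c' = -1 ∧
    inversive c d = 0 ∧ inversive c d' = 0 ∧ inversive c' d = 0 ∧ inversive c' d' = 0
  cover : ∀ z : ℂ, ∃ c ∈ B, ∃ c' ∈ B, ∃ d ∈ B', ∃ d' ∈ B', inversive c c' = -1 ∧
    inversive d d' = -1 ∧ (inversive c d = 0 ∧ inversive c d' = 0 ∧ inversive c' d = 0 ∧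
      inversive c' d' = 0) ∧ ∃ α β γ : ℝ, 0 ≤ α ∧ 0 ≤ β ∧ 0 ≤ γ ∧ α + β + γ = 1 ∧
      z = α * c.center + β * contact c c' + γ * d.center

/-- The points whose power is minimal with respect to the circle `c` of `B`. -/
def powerCell (B : Set OrientedCircle) (c : OrientedCircle) : Set ℂ :=
  {z | ∀ c' ∈ B, c.power z ≤ c'.power z}

/-- The points whose power is strictly minimal with respect to the circle `c` of `B`. -/
def openCell (B : Set OrientedCircle) (c : OrientedCircle) : Set ℂ :=
  {z | ∀ c' ∈ B, c' ≠ c → c.power z < c'.power z}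

theorem isClosed_powerCell (B : Set OrientedCircle) (c : OrientedCircle) :
    IsClosed (powerCell B c) := by
  have h : ∀ c : OrientedCircle, Continuous c.power := fun c => by
    unfold power; fun_prop
  simp only [powerCell, ofPred_forall]
  exact isClosed_biInter fun c' _ => isClosed_le (h c) (h c')

theorem convex_openCell (B : Set OrientedCircle) (c : OrientedCircle) :
    Convex ℝ (openCell B c) := by
  intro x hx y hy a b ha hb hab c' hc' hne
  have h := power_sub_power_comb c c' (x := x) (y := y) (z := 0) (α := a) (β := b) (γ := 0)
    (by linarith)
  have h1 := hx c' hc' hne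
  have h2 := hy c' hc' hne
  simp only [Complex.ofReal_zero, zero_mul, add_zero] at h
  rw [Complex.real_smul, Complex.real_smul]
  rcases ha.eq_or_lt with rfl | ha
  · nlinarith
  · nlinarith [mul_pos ha (sub_pos.2 h1), mul_nonneg hb (sub_pos.2 h2).le]

namespace FlagTiling

variable {B B' : Set OrientedCircle}

/-- The flag triangles are the same from both sides, because the two tangent pairs share their
contact point; only the weights of the two centres change places. Every later lemma is thereby
available for both collections. -/
theorem symm (T : FlagTiling B B') : FlagTiling B' B where
  one_le_curv := T.one_le_curv'
  one_le_curv' := T.one_le_curv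
  inv_le := T.inv_le'
  inv_le' := T.inv_le
  inv_dual d hd c hc := by rw [inversive_comm]; exact T.inv_dual c hc d hd
  infinite := T.infinite'
  infinite' := T.infinite
  finite := T.finite'
  finite' := T.finite
  edge d hd d' hd' h := by
    obtain ⟨c, hc, c', hc', h0, h1, h2, h3, h4⟩ := T.edge' d hd d' hd' h
    exact ⟨c, hc, c', hc', h0, by rwa [inversive_comm], by rwa [inversive_comm],
      by rwa [inversive_comm], by rwa [inversive_comm]⟩
  edge' d hd d' hd' h := by
    obtain ⟨c, hc, c', hc', h0, h1, h2, h3, h4⟩ := T.edge d hd d' hd' h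
    exact ⟨c, hc, c', hc', h0, by rwa [inversive_comm], by rwa [inversive_comm],
      by rwa [inversive_comm], by rwa [inversive_comm]⟩
  cover z := by
    obtain ⟨c, hc, c', hc', d, hd, d', hd', h0, h0', ⟨h1, h2, h3, h4⟩, α, β, γ, ha, hb, hg, hs,
      hz⟩ := T.cover z
    refine ⟨d, hd, d', hd', c, hc, c', hc', h0', h0, ⟨by rwa [inversive_comm],
      by rwa [inversive_comm], by rwa [inversive_comm], by rwa [inversive_comm]⟩, γ, β, α,
      hg, hb, ha, by linarith, ?_⟩
    have p : ∀ c ∈ B, 0 < c.curv := fun c hc => one_pos.trans_le (T.one_le_curv c hc)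
    have p' : ∀ c ∈ B', 0 < c.curv := fun c hc => one_pos.trans_le (T.one_le_curv' c hc)
    rw [← contact_eq_contact (p c hc) (p c' hc') (p' d hd) (p' d' hd') h0 h0' h1 h2 h3 h4, hz]
    ring

theorem pos (T : FlagTiling B B') {c : OrientedCircle} (hc : c ∈ B) : 0 < c.curv :=
  one_pos.trans_le (T.one_le_curv c hc)

theorem power_center_lt (T : FlagTiling B B') {c c' : OrientedCircle} (hc : c ∈ B) (hc' : c' ∈ B)
    (h : c' ≠ c) : c.power c.center < c'.power c.center := by
  have h1 := T.pos hc
  have h2 := T.pos hc'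
  rw [power_center h1 h1, power_center h1 h2, inversive_self]
  have h3 := T.inv_le c hc c' hc' h.symm
  have h4 : 0 < 2 * 1 / (c.curv * c.curv) := by positivity
  have h5 : 2 * inversive c c' / (c.curv * c'.curv) ≤ 0 :=
    div_nonpos_of_nonpos_of_nonneg (by linarith) (by positivity)
  linarith

theorem center_mem_openCell (T : FlagTiling B B') {c : OrientedCircle} (hc : c ∈ B) :
    c.center ∈ openCell B c := fun _ hc' hne => T.power_center_lt hc hc' hne

theorem inversive_nonpos (T : FlagTiling B B') {c d : OrientedCircle} (hc : c ∈ B) (hd : d ∈ B') :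
    inversive c d ≤ 0 := by
  rcases T.inv_dual c hc d hd with h | h <;> linarith

/-- The centre of a dual circle lies in the cell of each circle that is orthogonal to it. -/
theorem dual_center_mem (T : FlagTiling B B') {c d : OrientedCircle} (hc : c ∈ B) (hd : d ∈ B')
    (h : inversive c d = 0) : d.center ∈ powerCell B c := by
  intro c' hc'
  have h1 := T.pos hc
  have h2 := T.pos hc'
  have h3 := T.symm.pos hd
  rw [power_center h3 h1, power_center h3 h2, inversive_comm d c, h]
  have h5 : 2 * inversive d c' / (d.curv * c'.curv) ≤ 0 :=
    div_nonpos_of_nonpos_of_nonneg (by linarith [T.symm.inversive_nonpos hd hc']) (by positivity)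
  simpa using h5

theorem power_contact_nonneg (T : FlagTiling B B') {c c' e : OrientedCircle} (hc : c ∈ B)
    (hc' : c' ∈ B) (he : e ∈ B) (h : inversive c c' = -1) : 0 ≤ e.power (contact c c') := by
  have h1 := T.pos hc
  have h2 := T.pos hc'
  have h3 := T.pos he
  have h4 := form_contact h1 h2 h e
  rw [form_eq_mul_power h3] at h4
  by_cases h5 : c = e
  · subst h5; rw [inversive_self, inversive_comm, h] at h4
    have : c.power (contact c c') = 0 := by
      have h6 : (c.curv + c'.curv) ≠ 0 := by positivity
      have := h1.ne'
      simp_all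
    exact this.ge
  by_cases h6 : c' = e
  · subst h6; rw [inversive_self, h] at h4
    have : c'.power (contact c c') = 0 := by
      have h6 : (c.curv + c'.curv) ≠ 0 := by positivity
      have := h2.ne'
      simp_all
    exact this.ge
  have h7 := T.inv_le c hc e he h5
  have h8 := T.inv_le c' hc' e he h6
  by_contra h9
  have : (c.curv + c'.curv) * (e.curv * e.power (contact c c')) < 0 :=
    mul_neg_of_pos_of_neg (by positivity) (mul_neg_of_pos_of_neg h3 (not_le.1 h9))
  linarith

theorem power_contact_left (T : FlagTiling B B') {c c' : OrientedCircle} (hc : c ∈ B)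
    (hc' : c' ∈ B) (h : inversive c c' = -1) : c.power (contact c c') = 0 := by
  have h1 := form_contact_left (T.pos hc) (T.pos hc') h
  rw [form_eq_mul_power (T.pos hc)] at h1
  simpa [(T.pos hc).ne'] using h1

theorem contact_mem (T : FlagTiling B B') {c c' : OrientedCircle} (hc : c ∈ B)
    (hc' : c' ∈ B) (h : inversive c c' = -1) : contact c c' ∈ powerCell B c := by
  intro e he
  rw [T.power_contact_left hc hc' h]
  exact T.power_contact_nonneg hc hc' he h

theorem center_mem (T : FlagTiling B B') {c : OrientedCircle} (hc : c ∈ B) :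
    c.center ∈ powerCell B c := by
  intro e he
  by_cases h : e = c
  · rw [h]
  · exact (T.power_center_lt hc he h).le

/-- A segment that joins the centre of a circle to a point of its cell runs in the open cell, except
possibly for its end point. -/
theorem segment_mem_openCell (T : FlagTiling B B') {c : OrientedCircle} (hc : c ∈ B) {x : ℂ}
    (hx : x ∈ powerCell B c) {α β : ℝ} (ha : 0 < α) (hb : 0 ≤ β) (hs : α + β = 1) :
    α * c.center + β * x ∈ openCell B c := by
  intro c' hc' hne
  have h := power_sub_power_comb c c' (x := c.center) (y := x) (z := 0) (α := α) (β := β) (γ := 0)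
    (by linarith)
  simp only [Complex.ofReal_zero, zero_mul, add_zero] at h
  have h1 := T.power_center_lt hc hc' hne
  have h2 := hx c' hc'
  nlinarith [mul_pos ha (sub_pos.2 h1), mul_nonneg hb (sub_nonneg.2 h2)]

/-- Each point of the plane lies in the right triangle of a flag. This triangle is contained in the
cells of the two circles; another cell meets it at most in the side opposite to the first centre. -/
theorem exists_flag (T : FlagTiling B B') (z : ℂ) : ∃ c ∈ B, ∃ d ∈ B', ∃ x : ℂ,
    (∃ c' ∈ B, inversive c c' = -1 ∧ x = contact c c') ∧
    (∃ d' ∈ B', inversive d d' = -1 ∧ x = contact d d') ∧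
    inversive c d = 0 ∧ ∃ α β γ : ℝ, 0 ≤ α ∧ 0 ≤ β ∧ 0 ≤ γ ∧ α + β + γ = 1 ∧
      z = α * c.center + β * x + γ * d.center := by
  obtain ⟨c, hc, c', hc', d, hd, d', hd', h0, h0', ⟨h1, h2, h3, h4⟩, h5⟩ := T.cover z
  exact ⟨c, hc, d, hd, contact c c', ⟨c', hc', h0, rfl⟩, ⟨d', hd', h0',
    contact_eq_contact (T.pos hc) (T.pos hc') (T.symm.pos hd) (T.symm.pos hd') h0 h0' h1 h2 h3 h4⟩,
    h1, h5⟩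

theorem flag_mem (T : FlagTiling B B') {c c' d : OrientedCircle} (hc : c ∈ B) (hc' : c' ∈ B)
    (hd : d ∈ B') (h : inversive c c' = -1) (h' : inversive c d = 0) {α β γ : ℝ} (ha : 0 ≤ α)
    (hb : 0 ≤ β) (hg : 0 ≤ γ) (hs : α + β + γ = 1) :
    α * c.center + β * contact c c' + γ * d.center ∈ powerCell B c := by
  intro e he
  have h1 := power_sub_power_comb c e (x := c.center) (y := contact c c') (z := d.center) hs
  have h2 := T.center_mem hc e he
  have h3 := T.contact_mem hc hc' h e he
  have h4 := T.dual_center_mem hc hd h' e he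
  nlinarith [mul_nonneg ha (sub_nonneg.2 h2), mul_nonneg hb (sub_nonneg.2 h3),
    mul_nonneg hg (sub_nonneg.2 h4)]

/-- The difference of the powers with respect to `e` and `c` is affine, so at a point of the flag
triangle it is a weighted mean of its values at the corners. These are nonnegative, and positive at
the centre of `c`. Membership in the cell of `e` makes the mean nonpositive, so every weighted term
vanishes. -/
theorem flag_mem_other (T : FlagTiling B B') {c c' d e : OrientedCircle} (hc : c ∈ B) (hc' : c' ∈ B)
    (hd : d ∈ B') (h : inversive c c' = -1) (h' : inversive c d = 0) {α β γ : ℝ} (ha : 0 ≤ α)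
    (hb : 0 ≤ β) (hg : 0 ≤ γ) (hs : α + β + γ = 1) (he : e ∈ B)
    (hz : α * c.center + β * contact c c' + γ * d.center ∈ powerCell B e) (hne : e ≠ c) :
    α = 0 ∧ (0 < β → e.power (contact c c') = 0) := by
  have h1 := power_sub_power_comb c e (x := c.center) (y := contact c c') (z := d.center) hs
  have h2 := T.power_center_lt hc he hne
  have h3 := T.contact_mem hc hc' h e he
  have h4 := T.dual_center_mem hc hd h' e he
  have h5 := hz c hc
  have h6 := mul_nonneg ha (sub_nonneg.2 h2.le)
  have h7 := mul_nonneg hb (sub_nonneg.2 h3)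
  have h8 := mul_nonneg hg (sub_nonneg.2 h4)
  constructor
  · have : α * (e.power c.center - c.power c.center) = 0 := by linarith
    simpa [(sub_pos.2 h2).ne'] using this
  · intro hb'
    have : β * (e.power (contact c c') - c.power (contact c c')) = 0 := by linarith
    rw [T.power_contact_left hc hc' h] at this
    simpa [hb'.ne'] using this

/-- The cells cover the plane. -/
theorem exists_mem_cell (T : FlagTiling B B') (z : ℂ) :
    ∃ c ∈ B, z ∈ powerCell B c := by
  obtain ⟨c, hc, d, hd, x, ⟨c', hc', h, rfl⟩, -, h', α, β, γ, ha, hb, hg, hs, rfl⟩ :=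
    T.exists_flag z
  exact ⟨c, hc, T.flag_mem hc hc' hd h h' ha hb hg hs⟩

/-- The cells are bounded. -/
theorem dist_le_of_mem_cell (T : FlagTiling B B') {c : OrientedCircle} (hc : c ∈ B) {z : ℂ}
    (hz : z ∈ powerCell B c) : ‖z - c.center‖ ≤ 3 := by
  obtain ⟨c₀, hc₀, d, hd, x, ⟨c', hc', h, rfl⟩, -, h', α, β, γ, ha, hb, hg, hs, rfl⟩ :=
    T.exists_flag z
  have h1 := hz c₀ hc₀
  set z := α * c₀.center + β * contact c₀ c' + γ * d.center with hzd
  have hr : ∀ {r : ℝ}, 1 ≤ r → 0 ≤ 1 / r ^ 2 ∧ 1 / r ^ 2 ≤ 1 := fun {r} hr =>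
    ⟨by positivity, by rw [div_le_one (by positivity)]; nlinarith⟩
  have h2 : ‖contact c₀ c' - c₀.center‖ ≤ 2 := by
    have := T.power_contact_left hc₀ hc' h
    rw [power_eq_dist (T.pos hc₀)] at this
    refine abs_le_of_sq_le_sq' ?_ (by norm_num) |>.2
    linarith [(hr (T.one_le_curv c₀ hc₀)).2]
  have h3 : ‖d.center - c₀.center‖ ≤ 2 := by
    have := dist_center_sq (T.symm.pos hd) (T.pos hc₀)
    rw [inversive_comm, h'] at this
    refine abs_le_of_sq_le_sq' ?_ (by norm_num) |>.2
    simp only [mul_zero, zero_div, sub_zero] at this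
    linarith [(hr (T.one_le_curv c₀ hc₀)).2, (hr (T.one_le_curv' d hd)).2]
  have h4 : ‖z - c₀.center‖ ≤ 2 := by
    have : z - c₀.center = β * (contact c₀ c' - c₀.center) + γ * (d.center - c₀.center) := by
      have : (α : ℂ) = 1 - β - γ := by
        rw [← Complex.ofReal_one, ← hs]; push_cast; ring
      rw [hzd, this]; ring
    rw [this]
    refine (norm_add_le _ _).trans ?_
    rw [norm_mul, norm_mul, Complex.norm_real, Complex.norm_real, Real.norm_of_nonneg hb,
      Real.norm_of_nonneg hg]
    nlinarith
  -- Both radii are at most one, hence the squared distance to the centre of `c` is at most `2 ^ 2 +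
  -- 1`, which is below `3 ^ 2`.
  rw [power_eq_dist (T.pos hc), power_eq_dist (T.pos hc₀)] at h1
  refine abs_le_of_sq_le_sq' ?_ (by norm_num) |>.2
  have h5 : ‖z - c₀.center‖ ^ 2 ≤ 2 ^ 2 := pow_le_pow_left₀ (norm_nonneg _) h4 2
  linarith [(hr (T.one_le_curv c₀ hc₀)).1, (hr (T.one_le_curv c hc)).2]

/-- The cells are uniformly bounded around locally finite centres, so they form a locally finite
family of closed sets. -/
theorem isClosed_biUnion_cell (T : FlagTiling B B') {K : Set OrientedCircle} (hK : K ⊆ B) :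
    IsClosed (⋃ c ∈ K, powerCell B c) := by
  rw [biUnion_eq_iUnion]
  refine LocallyFinite.isClosed_iUnion (fun z => ⟨Metric.ball z 1, Metric.ball_mem_nhds z one_pos,
    ?_⟩) fun c => isClosed_powerCell B c
  refine ((T.finite (‖z‖ + 4)).preimage
    (f := ((↑) : K → OrientedCircle)) Subtype.val_injective.injOn).subset ?_
  rintro ⟨c, hc⟩ ⟨w, hw, hwz⟩
  refine ⟨hK hc, ?_⟩
  have h1 := T.dist_le_of_mem_cell (hK hc) hw
  rw [Metric.mem_ball, dist_eq_norm] at hwz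
  have h2 : c.center = z + (w - z) - (w - c.center) := by ring
  change ‖c.center‖ ≤ ‖z‖ + 4
  rw [h2]
  refine (norm_sub_le _ _).trans ?_
  linarith [norm_add_le z (w - z)]

/-- Since the cells cover the plane, a point outside all other cells lies in the cell of `c`, and a
tie with another circle would put it into that circle's cell. This is how a set given by infinitely
many strict inequalities is seen to be open. -/
theorem openCell_eq (T : FlagTiling B B') {c : OrientedCircle} (hc : c ∈ B) :
    openCell B c = (⋃ c' ∈ B \ {c}, powerCell B c')ᶜ := by
  ext z
  simp only [mem_compl_iff, mem_iUnion, not_exists]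
  constructor
  · intro hz c' hc' hz'
    exact absurd (hz' c hc) (not_le.2 (hz c' hc'.1 hc'.2))
  · intro hz c' hc' hne
    obtain ⟨e, he, hze⟩ := T.exists_mem_cell z
    have : e = c := by
      by_contra h
      exact hz e ⟨he, h⟩ hze
    subst this
    refine lt_of_not_ge fun h => hz c' ⟨hc', hne⟩ fun e' he' => h.trans (hze e' he')

theorem isOpen_openCell (T : FlagTiling B B') {c : OrientedCircle} (hc : c ∈ B) :
    IsOpen (openCell B c) := by
  rw [T.openCell_eq hc]
  exact (T.isClosed_biUnion_cell sdiff_subset).isOpen_compl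

theorem openCell_subset_powerCell (c : OrientedCircle) : openCell B c ⊆ powerCell B c := by
  intro z hz c' hc'
  by_cases h : c' = c
  · rw [h]
  · exact (hz c' hc' h).le

theorem openCell_disjoint {c c' : OrientedCircle} (hc : c ∈ B) (hc' : c' ∈ B) {z : ℂ}
    (h : z ∈ openCell B c) (h' : z ∈ powerCell B c') : c' = c := by
  by_contra hne
  exact absurd (h' c hc) (not_le.2 (h c' hc' hne))

/-! ### The straight-line embedding and the accumulation point -/

theorem mem_tangencyPoints (T : FlagTiling B B') {c : OrientedCircle} (hc : c ∈ B)
    {x : OnePoint ℂ} : x ∈ tangencyPoints B c ↔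
      ∃ c' ∈ B, inversive c c' = -1 ∧ x = contact c c' := by
  constructor
  · rintro ⟨c', hc', h⟩
    exact ⟨c', hc', h.eq_contact (T.pos hc) (T.pos hc') (T.inv_le c hc c' hc' h.1)⟩
  · rintro ⟨c', hc', h, rfl⟩
    exact ⟨c', hc', tangentAt_contact (T.pos hc) (T.pos hc') h⟩

theorem form_tangencyPoint (T : FlagTiling B B') {c : OrientedCircle} (hc : c ∈ B) {x : ℂ}
    (hx : (x : OnePoint ℂ) ∈ tangencyPoints B c) : c.form x = 0 := by
  obtain ⟨c', hc', h, h'⟩ := (T.mem_tangencyPoints hc).1 hx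
  rw [OnePoint.coe_eq_coe] at h'
  rw [h']
  exact form_contact_left (T.pos hc) (T.pos hc') h

/-- The radius of `c` that leads to the point `x`. -/
def radius (c : OrientedCircle) (x : OnePoint ℂ) : Set (OnePoint ℂ) :=
  {w | ∃ z : ℂ, x = z ∧ w ∈ ((↑) : ℂ → OnePoint ℂ) '' segment ℝ c.center z}

theorem radius_coe (c : OrientedCircle) (z : ℂ) :
    radius c z = ((↑) : ℂ → OnePoint ℂ) '' segment ℝ c.center z := by
  ext w
  simp [radius]

theorem isSimpleArc_segment {p q : ℂ} (h : p ≠ q) :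
    IsSimpleArc p q (((↑) : ℂ → OnePoint ℂ) '' segment ℝ p q) := by
  refine ⟨⟨⟨fun t => ((AffineMap.lineMap p q (t : ℝ) : ℂ) : OnePoint ℂ), ?_⟩, by simp, by simp⟩,
    ?_, ?_⟩
  · exact OnePoint.continuous_coe.comp ((AffineMap.lineMap_continuous).comp continuous_subtype_val)
  · intro s t hst
    have : (AffineMap.lineMap p q (s : ℝ) : ℂ) = AffineMap.lineMap p q (t : ℝ) :=
      OnePoint.coe_injective hst
    exact Subtype.ext (AffineMap.lineMap_injective ℝ h this)
  · rw [segment_eq_image_lineMap, image_image]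
    ext w
    simp only [mem_range, mem_image]
    constructor
    · rintro ⟨t, rfl⟩
      exact ⟨t, t.2, rfl⟩
    · rintro ⟨t, ht, rfl⟩
      exact ⟨⟨t, ht⟩, rfl⟩

theorem mem_segment_iff {p x z : ℂ} :
    z ∈ segment ℝ p x ↔ ∃ α β : ℝ, 0 ≤ α ∧ 0 ≤ β ∧ α + β = 1 ∧ z = α * p + β * x := by
  constructor
  · rintro ⟨a, b, ha, hb, hab, rfl⟩
    exact ⟨a, b, ha, hb, hab, by rw [Complex.real_smul, Complex.real_smul]⟩
  · rintro ⟨a, b, ha, hb, hab, rfl⟩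
    exact ⟨a, b, ha, hb, hab, by rw [Complex.real_smul, Complex.real_smul]⟩

theorem form_on_radius {c : OrientedCircle} (hc : 0 < c.curv) {x : ℂ} (hx : c.form x = 0)
    {α β : ℝ} (ha : 0 < α) (hs : α + β = 1) (hb : 0 ≤ β) :
    c.form (α * c.center + β * x) < 0 := by
  rw [form_eq_mul_power hc] at hx ⊢
  have hx : c.power x = 0 := by simpa [hc.ne'] using hx
  rw [power_eq_dist hc] at hx ⊢
  have h : (α : ℂ) * c.center + β * x - c.center = β * (x - c.center) := by
    have : (α : ℂ) = 1 - β := by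
      rw [← Complex.ofReal_one, ← hs]; push_cast; ring
    rw [this]; ring
  rw [h, norm_mul, mul_pow, Complex.norm_real, Real.norm_eq_abs, sq_abs]
  have : 0 < 1 / c.curv ^ 2 := by positivity
  refine mul_neg_of_pos_of_neg hc ?_
  have h2 : β ^ 2 < 1 := by nlinarith
  nlinarith

theorem center_ne_of_form_eq_zero {c : OrientedCircle} (hc : 0 < c.curv) {x : ℂ}
    (hx : c.form x = 0) : c.center ≠ x := by
  rintro rfl
  have := form_on_radius hc hx (α := 1) (β := 0) one_pos (by norm_num) le_rfl
  simp only [Complex.ofReal_one, one_mul, Complex.ofReal_zero, zero_mul, add_zero] at this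
  exact this.ne hx

/-- The straight-line embedding of the tangency graph. -/
noncomputable def radialEmbedding (T : FlagTiling B B') : NaturalEmbedding B {∞} where
  vertex c := c.center
  spoke := radius
  vertex_mem c hc := by
    rw [mem_interior_coe, form_eq_mul_power (T.pos hc), power_eq_dist (T.pos hc)]
    have := T.pos hc
    refine mul_neg_of_pos_of_neg this ?_
    have : 0 < 1 / c.curv ^ 2 := by positivity
    simpa using this
  vertex_eq _ _ _ := rfl
  spoke_arc c hc x hx := by
    cases x with
    | infty => exact absurd rfl hx.2
    | coe x =>
      rw [radius_coe]
      exact isSimpleArc_segment (center_ne_of_form_eq_zero (T.pos hc) (T.form_tangencyPoint hc hx.1))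
  spoke_subset c hc x hx := by
    cases x with
    | infty => exact absurd rfl hx.2
    | coe x =>
      rw [radius_coe]
      rintro _ ⟨z, hz, rfl⟩
      obtain ⟨α, β, ha, hb, hs, rfl⟩ := mem_segment_iff.1 hz
      rcases ha.eq_or_lt with rfl | ha
      · right
        simp at hs
        simp [hs]
      · left
        rw [mem_interior_coe]
        exact form_on_radius (T.pos hc) (T.form_tangencyPoint hc hx.1) ha hs hb
  spoke_inter c hc x hx y hy hxy := by
    cases x with
    | infty => exact absurd rfl hx.2
    | coe x =>
    cases y with
    | infty => exact absurd rfl hy.2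
    | coe y =>
      rw [radius_coe, radius_coe, ← image_inter OnePoint.coe_injective, ← image_singleton]
      congr 1
      refine Subset.antisymm ?_ (singleton_subset_iff.2
        ⟨left_mem_segment ℝ _ _, left_mem_segment ℝ _ _⟩)
      rintro z ⟨hz, hz'⟩
      obtain ⟨α, β, ha, hb, hs, rfl⟩ := mem_segment_iff.1 hz
      obtain ⟨α', β', ha', hb', hs', he⟩ := mem_segment_iff.1 hz'
      have h1 := T.form_tangencyPoint hc hx.1
      have h2 := T.form_tangencyPoint hc hy.1
      have hp := T.pos hc
      rw [form_eq_mul_power hp] at h1 h2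
      have h1 : c.power x = 0 := by simpa [hp.ne'] using h1
      have h2 : c.power y = 0 := by simpa [hp.ne'] using h2
      rw [power_eq_dist hp] at h1 h2
      have h3 : ‖x - c.center‖ = ‖y - c.center‖ := by
        rw [← sq_eq_sq₀ (norm_nonneg _) (norm_nonneg _)]; linarith
      have h4 : (β : ℂ) * (x - c.center) = β' * (y - c.center) := by
        have e1 : (α : ℂ) = 1 - β := by
          rw [← Complex.ofReal_one, ← hs]; push_cast; ring
        have e2 : (α' : ℂ) = 1 - β' := by
          rw [← Complex.ofReal_one, ← hs']; push_cast; ring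
        rw [e1, e2] at he
        linear_combination he
      -- Both end points lie on the circle `c`, at the same distance from its centre, so comparing
      -- norms equates the parameters.
      have h5 : β = β' := by
        have := congrArg norm h4
        rw [norm_mul, norm_mul, Complex.norm_real, Complex.norm_real, Real.norm_of_nonneg hb,
          Real.norm_of_nonneg hb', h3] at this
        refine mul_right_cancel₀ ?_ this
        intro h0
        rw [h0] at h2
        have : 0 < 1 / c.curv ^ 2 := by positivity
        linarith
      rw [← h5] at h4
      by_cases h6 : β = 0
      · subst h6
        simp at hs
        simp [hs]
      · exfalso
        have := mul_left_cancel₀ (Complex.ofReal_ne_zero.2 h6) h4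
        exact hxy (congrArg _ (sub_left_injective this))
  spoke_eq c hc _ z hz := radius_coe c z

theorem infinite_setOf_le (T : FlagTiling B B') (R : ℝ) : {c ∈ B | R < ‖c.center‖}.Infinite := by
  intro h
  refine T.infinite ((h.union (T.finite R)).subset fun c hc => ?_)
  rcases lt_or_ge R ‖c.center‖ with h | h
  · exact Or.inl ⟨hc, h⟩
  · exact Or.inr ⟨hc, h⟩

theorem dist_center_le_of_mem_circle (T : FlagTiling B B') {c : OrientedCircle} (hc : c ∈ B) {z : ℂ}
    (hz : (z : OnePoint ℂ) ∈ c.circle) : ‖z - c.center‖ ≤ 1 := by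
  rw [mem_circle_coe, form_eq_mul_power (T.pos hc)] at hz
  have h1 : c.power z = 0 := by simpa [(T.pos hc).ne'] using hz
  rw [power_eq_dist (T.pos hc)] at h1
  have := T.one_le_curv c hc
  have h2 : 1 / c.curv ^ 2 ≤ 1 := by rw [div_le_one (by positivity)]; nlinarith
  nlinarith [norm_nonneg (z - c.center)]

theorem circle_nonempty {c : OrientedCircle} (hc : 0 < c.curv) :
    ∃ z : ℂ, (z : OnePoint ℂ) ∈ c.circle := by
  refine ⟨c.center + (1 / c.curv : ℝ), ?_⟩
  rw [mem_circle_coe, form_eq_mul_power hc, power_eq_dist hc]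
  rw [add_sub_cancel_left, Complex.norm_real, Real.norm_eq_abs, sq_abs]
  simp

/-- Radii are at most one and centres are locally finite: a bounded set meets finitely many circles,
while infinitely many of them lie near infinity. -/
theorem accumulationPoints_eq (T : FlagTiling B B') : accumulationPoints (B ∪ B') = {∞} := by
  ext x
  cases x with
  | infty =>
    simp only [mem_singleton_iff, iff_true]
    intro U hU
    obtain ⟨K, ⟨hK1, hK2⟩, hKU⟩ := (OnePoint.hasBasis_nhds_infty (X := ℂ)).mem_iff.1 hU
    obtain ⟨R, hR⟩ := hK2.isBounded.subset_closedBall 0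
    refine (T.infinite_setOf_le (R + 1)).mono fun c hc => ⟨Or.inl hc.1, fun w hw => hKU ?_⟩
    cases w with
    | infty => exact absurd hw (infty_notMem_circle (T.pos hc.1))
    | coe z =>
      left
      refine ⟨z, fun hz => ?_, rfl⟩
      have h1 := hR hz
      rw [mem_closedBall_zero_iff] at h1
      have h2 := T.dist_center_le_of_mem_circle hc.1 hw
      have h3 : ‖c.center‖ ≤ ‖z‖ + ‖z - c.center‖ := by
        have : c.center = z - (z - c.center) := by ring
        rw [this]; exact (norm_sub_le _ _).trans (by rw [← this])
      linarith [hc.2]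
  | coe x =>
    simp only [mem_singleton_iff, OnePoint.coe_ne_infty, iff_false]
    intro h
    refine h (((↑) : ℂ → OnePoint ℂ) '' Metric.ball x 1) ?_ ?_
    · exact (OnePoint.isOpen_image_coe.2 Metric.isOpen_ball).mem_nhds
        ⟨x, Metric.mem_ball_self one_pos, rfl⟩
    · refine ((T.finite (‖x‖ + 2)).union (T.finite' (‖x‖ + 2))).subset ?_
      have key : ∀ {B B' : Set OrientedCircle}, FlagTiling B B' → ∀ c ∈ B,
          c.circle ⊆ ((↑) : ℂ → OnePoint ℂ) '' Metric.ball x 1 → ‖c.center‖ ≤ ‖x‖ + 2 := by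
        intro B B' T c hc hsub
        obtain ⟨z, hz⟩ := circle_nonempty (T.pos hc)
        obtain ⟨z', hz', he⟩ := hsub hz
        rw [OnePoint.coe_eq_coe] at he
        subst he
        have h1 := T.dist_center_le_of_mem_circle hc hz
        rw [Metric.mem_ball, dist_eq_norm] at hz'
        have : c.center = x + (z' - x) - (z' - c.center) := by ring
        rw [this]
        refine (norm_sub_le _ _).trans ?_
        linarith [norm_add_le x (z' - x)]
      rintro c ⟨hc | hc, hsub⟩
      · exact Or.inl ⟨hc, key T c hc hsub⟩
      · exact Or.inr ⟨hc, key T.symm c hc hsub⟩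

end FlagTiling

/-! ### Faces are power cells; plane duality and connectedness -/

open OrientedCircle

namespace FlagTiling

variable {B B' : Set OrientedCircle}

/-- The centre of `c` lies in some flag triangle, which is contained in the cell of its own base
circle. As the centre belongs to the open cell of `c`, this circle is `c`. -/
theorem exists_neighbor (T : FlagTiling B B') {c : OrientedCircle} (hc : c ∈ B) :
    ∃ c' ∈ B, inversive c c' = -1 := by
  obtain ⟨c₀, hc₀, d, hd, x, ⟨c', hc', h, rfl⟩, -, h', α, β, γ, ha, hb, hg, hs, he⟩ :=
    T.exists_flag c.center
  have h1 := T.flag_mem hc₀ hc' hd h h' ha hb hg hs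
  rw [← he] at h1
  rw [← openCell_disjoint hc hc₀ (T.center_mem_openCell hc) h1]
  exact ⟨c', hc', h⟩

theorem ne_of_inversive {c c' : OrientedCircle} (h : inversive c c' = -1) : c ≠ c' := by
  rintro rfl
  rw [inversive_self] at h
  norm_num at h

/-- A spoke of the graph of `B` lies in the boundary of two cells of `B'`. -/
theorem spoke_mem_cells (T : FlagTiling B B') {c c' : OrientedCircle} (hc : c ∈ B) (hc' : c' ∈ B)
    (h : inversive c c' = -1) : ∃ d ∈ B', ∃ d' ∈ B', d ≠ d' ∧
      ∀ z ∈ segment ℝ c.center (contact c c'), z ∈ powerCell B' d ∧ z ∈ powerCell B' d' := by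
  obtain ⟨d, hd, d', hd', h0, h1, h2, h3, h4⟩ := T.edge c hc c' hc' h
  refine ⟨d, hd, d', hd', ne_of_inversive h0, fun z hz => ?_⟩
  obtain ⟨α, β, ha, hb, hs, rfl⟩ := mem_segment_iff.1 hz
  rw [contact_eq_contact (T.pos hc) (T.pos hc') (T.symm.pos hd) (T.symm.pos hd') h h0 h1 h2 h3 h4]
  constructor
  · have := T.symm.flag_mem hd hd' hc h0 (by rwa [inversive_comm]) le_rfl hb ha (by linarith)
    convert this using 1
    push_cast; ring
  · rw [contact_comm]
    have := T.symm.flag_mem hd' hd hc (by rwa [inversive_comm]) (by rwa [inversive_comm])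
      le_rfl hb ha (by linarith)
    convert this using 1
    push_cast; ring

theorem mem_support_iff (T : FlagTiling B B') (w : OnePoint ℂ) :
    w ∈ T.radialEmbedding.support ↔
      ∃ c ∈ B, ∃ c' ∈ B, inversive c c' = -1 ∧
        w ∈ ((↑) : ℂ → OnePoint ℂ) '' segment ℝ c.center (contact c c') := by
  simp only [NaturalEmbedding.support, mem_union, mem_iUnion]
  constructor
  · rintro (⟨c, hc, rfl⟩ | ⟨x, hx, h⟩)
    · obtain ⟨c', hc', h⟩ := T.exists_neighbor hc
      exact ⟨c, hc, c', hc', h, c.center, left_mem_segment ℝ _ _, rfl⟩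
    · simp only [NaturalEmbedding.edge, mem_iUnion] at h
      obtain ⟨c, ⟨hc, hxc⟩, h⟩ := h
      obtain ⟨c', hc', h1, rfl⟩ := (T.mem_tangencyPoints hc).1 hxc
      refine ⟨c, hc, c', hc', h1, ?_⟩
      rw [← radius_coe]
      exact h
  · rintro ⟨c, hc, c', hc', h, hw⟩
    right
    have h1 : (contact c c' : OnePoint ℂ) ∈ tangencyPoints B c :=
      (T.mem_tangencyPoints hc).2 ⟨c', hc', h, rfl⟩
    refine ⟨contact c c', ⟨mem_biUnion hc h1, by simp⟩, ?_⟩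
    simp only [NaturalEmbedding.edge, mem_iUnion]
    refine ⟨c, ⟨hc, h1⟩, ?_⟩
    rw [← radius_coe] at hw
    exact hw

/-- The key to duality: the embedded graph of `B` is precisely the locus where the minimal power
with respect to `B'` is attained more than once. -/
theorem coe_mem_support_iff (T : FlagTiling B B') (z : ℂ) :
    (z : OnePoint ℂ) ∈ T.radialEmbedding.support ↔ ∀ d ∈ B', z ∉ openCell B' d := by
  rw [T.mem_support_iff]
  constructor
  · rintro ⟨c, hc, c', hc', h, w, hw, hwz⟩ e he hz
    rw [OnePoint.coe_eq_coe] at hwz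
    subst hwz
    obtain ⟨d, hd, d', hd', hne, hdd⟩ := T.spoke_mem_cells hc hc' h
    refine hne ?_
    rw [openCell_disjoint he hd hz (hdd w hw).1, openCell_disjoint he hd' hz (hdd w hw).2]
  · intro h
    obtain ⟨c, hc, d, hd, x, ⟨c', hc', h1, h2⟩, ⟨d', hd', h3, h4⟩, h', α, β, γ, ha, hb, hg, hs,
      rfl⟩ := T.exists_flag z
    have h0 : inversive d c = 0 := by rwa [inversive_comm]
    have e1 : (α : ℂ) * c.center + β * x + γ * d.center =
      γ * d.center + β * contact d d' + α * c.center := by rw [h4]; ring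
    have h5 := T.symm.flag_mem hd hd' hc h3 h0 hg hb ha (by linarith)
    have h6 := h d hd
    simp only [openCell, mem_ofPred_eq, not_forall, not_lt] at h6
    obtain ⟨e, he, hne, h6⟩ := h6
    rw [e1] at h6
    -- The point lies in the cell of a second dual circle, so the weight of the dual centre is zero
    -- and the point is on the spoke from `c` to the contact point.
    have h7 := (T.symm.flag_mem_other hd hd' hc h3 h0 hg hb ha (by linarith) he
      (fun e' he' => h6.trans (h5 e' he')) hne).1
    refine ⟨c, hc, c', hc', h1, _, ?_, rfl⟩
    rw [mem_segment_iff]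
    exact ⟨α, β, ha, hb, by linarith, by rw [h7, h2]; simp⟩

theorem faceRegion_eq (T : FlagTiling B B') :
    T.radialEmbedding.faceRegion = ((↑) : ℂ → OnePoint ℂ) '' ⋃ d ∈ B', openCell B' d := by
  have hopen : IsOpen (((↑) : ℂ → OnePoint ℂ) '' ⋃ d ∈ B', openCell B' d) :=
    OnePoint.isOpen_image_coe.2 (isOpen_biUnion fun d hd => T.symm.isOpen_openCell hd)
  ext w
  simp only [NaturalEmbedding.faceRegion, mem_compl_iff, mem_union, mem_singleton_iff, not_or]
  constructor
  · rintro ⟨h1, h2⟩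
    cases w with
    | infty => exact absurd rfl h1
    | coe z =>
      have h3 : (z : OnePoint ℂ) ∉ T.radialEmbedding.support := fun h => h2 (subset_closure h)
      rw [T.coe_mem_support_iff] at h3
      push Not at h3
      obtain ⟨d, hd, hz⟩ := h3
      exact ⟨z, mem_biUnion hd hz, rfl⟩
  · intro hw
    refine ⟨?_, fun hcl => ?_⟩
    · rintro rfl
      obtain ⟨z, -, hz⟩ := hw
      exact OnePoint.coe_ne_infty z hz
    · obtain ⟨v, hv, hvs⟩ := mem_closure_iff.1 hcl _ hopen hw
      obtain ⟨z, hz, rfl⟩ := hv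
      obtain ⟨d, hd, hz⟩ := mem_iUnion₂.1 hz
      exact (T.coe_mem_support_iff z).1 hvs d hd hz

/-- The open cells of `B'` are convex, open and pairwise disjoint, so they are the components of
their union. -/
theorem face_eq (T : FlagTiling B B') {d : OrientedCircle} (hd : d ∈ B') {z : ℂ}
    (hz : z ∈ openCell B' d) :
    T.radialEmbedding.face z = ((↑) : ℂ → OnePoint ℂ) '' openCell B' d := by
  have hsub : ((↑) : ℂ → OnePoint ℂ) '' openCell B' d ⊆ T.radialEmbedding.faceRegion := by
    rw [T.faceRegion_eq]
    exact image_mono (subset_biUnion_of_mem (u := fun d => openCell B' d) hd)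
  have hz' : (z : OnePoint ℂ) ∈ ((↑) : ℂ → OnePoint ℂ) '' openCell B' d := ⟨z, hz, rfl⟩
  refine Subset.antisymm ?_ ?_
  · have hpre : IsPreconnected (T.radialEmbedding.face z) := isPreconnected_connectedComponentIn
    refine hpre.subset_left_of_subset_union (OnePoint.isOpen_image_coe.2 (T.symm.isOpen_openCell hd))
      (v := ((↑) : ℂ → OnePoint ℂ) '' ⋃ e ∈ B' \ {d}, openCell B' e)
      (OnePoint.isOpen_image_coe.2 (isOpen_biUnion fun e he => T.symm.isOpen_openCell he.1)) ?_ ?_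
      ⟨z, mem_connectedComponentIn (hsub hz'), hz'⟩
    · rw [disjoint_image_iff OnePoint.coe_injective, Set.disjoint_left]
      intro x hx hx'
      obtain ⟨e, he, hxe⟩ := mem_iUnion₂.1 hx'
      exact he.2 (openCell_disjoint hd he.1 hx (openCell_subset_powerCell e hxe))
    · refine (connectedComponentIn_subset _ _).trans ?_
      rw [T.faceRegion_eq, ← image_union]
      refine image_mono fun x hx => ?_
      obtain ⟨e, he, hxe⟩ := mem_iUnion₂.1 hx
      by_cases h : e = d
      · left; rwa [← h]
      · right; exact mem_biUnion (⟨he, h⟩ : e ∈ B' \ {d}) hxe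
  · refine IsPreconnected.subset_connectedComponentIn ?_ hz' hsub
    exact (convex_openCell B' d).isPreconnected.image _ OnePoint.continuous_coe.continuousOn

theorem mem_faces_iff (T : FlagTiling B B') {F : Set (OnePoint ℂ)} :
    F ∈ T.radialEmbedding.faces ↔ ∃ d ∈ B', F = ((↑) : ℂ → OnePoint ℂ) '' openCell B' d := by
  constructor
  · rintro ⟨p, hp, rfl⟩
    rw [T.faceRegion_eq] at hp
    obtain ⟨z, hz, rfl⟩ := hp
    obtain ⟨d, hd, hz⟩ := mem_iUnion₂.1 hz
    exact ⟨d, hd, T.face_eq hd hz⟩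
  · rintro ⟨d, hd, rfl⟩
    have h := T.symm.center_mem_openCell hd
    refine ⟨d.center, ?_, (T.face_eq hd h).symm⟩
    rw [T.faceRegion_eq]
    exact ⟨_, mem_biUnion hd h, rfl⟩

/-- An edge of the graph of `B` and an edge of the graph of `B'` meet at most in the point of
tangency. -/
theorem spoke_inter_spoke (T : FlagTiling B B') {c c' d d' : OrientedCircle} (hc : c ∈ B)
    (hc' : c' ∈ B) (h : inversive c c' = -1) (hd : d ∈ B') (hd' : d' ∈ B')
    (h' : inversive d d' = -1) {z : ℂ} (hz : z ∈ segment ℝ c.center (contact c c'))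
    (hz' : z ∈ segment ℝ d.center (contact d d')) : z = contact c c' := by
  obtain ⟨α, β, ha, hb, hs, rfl⟩ := mem_segment_iff.1 hz
  rcases ha.eq_or_lt with rfl | ha
  · simp at hs
    simp [hs]
  · exfalso
    -- Before its end the spoke of `c` runs in the open cell of `c`, whereas each spoke of the dual
    -- graph lies in two different cells of `B`.
    have h1 := T.segment_mem_openCell hc (T.contact_mem hc hc' h) ha hb hs
    obtain ⟨e, he, e', he', hne, hee⟩ := T.symm.spoke_mem_cells hd hd' h'
    have h2 := hee _ hz'
    exact hne (by rw [openCell_disjoint hc he h1 h2.1, openCell_disjoint hc he' h1 h2.2])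

theorem mem_edgeLabels_iff (T : FlagTiling B B') {x : OnePoint ℂ} :
    x ∈ T.radialEmbedding.edgeLabels ↔
      ∃ c ∈ B, ∃ c' ∈ B, inversive c c' = -1 ∧ x = contact c c' := by
  simp only [NaturalEmbedding.edgeLabels, mem_sdiff, mem_iUnion]
  constructor
  · rintro ⟨⟨c, hc, h⟩, -⟩
    exact ⟨c, hc, (T.mem_tangencyPoints hc).1 h⟩
  · rintro ⟨c, hc, h⟩
    refine ⟨⟨c, hc, (T.mem_tangencyPoints hc).2 h⟩, ?_⟩
    obtain ⟨c', -, -, rfl⟩ := h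
    simp

theorem mem_edge_iff (T : FlagTiling B B') {x w : OnePoint ℂ} :
    w ∈ T.radialEmbedding.edge x ↔
      ∃ c ∈ B, ∃ c' ∈ B, inversive c c' = -1 ∧ x = contact c c' ∧
        ∃ z ∈ segment ℝ c.center (contact c c'), w = z := by
  simp only [NaturalEmbedding.edge, mem_iUnion]
  constructor
  · rintro ⟨c, ⟨hc, hx⟩, h⟩
    obtain ⟨c', hc', h1, rfl⟩ := (T.mem_tangencyPoints hc).1 hx
    change w ∈ radius c _ at h
    rw [radius_coe] at h
    obtain ⟨z, hz, rfl⟩ := h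
    exact ⟨c, hc, c', hc', h1, rfl, z, hz, rfl⟩
  · rintro ⟨c, hc, c', hc', h1, rfl, z, hz, rfl⟩
    refine ⟨c, ⟨hc, (T.mem_tangencyPoints hc).2 ⟨c', hc', h1, rfl⟩⟩, ?_⟩
    change _ ∈ radius c _
    rw [radius_coe]
    exact ⟨z, hz, rfl⟩

theorem eq_of_mem_edge (T : FlagTiling B B') {x y w : OnePoint ℂ}
    (h : w ∈ T.radialEmbedding.edge x) (h' : w ∈ T.symm.radialEmbedding.edge y) :
    w = x ∧ w = y := by
  obtain ⟨c, hc, c', hc', h1, rfl, z, hz, rfl⟩ := T.mem_edge_iff.1 h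
  obtain ⟨d, hd, d', hd', h2, rfl, z', hz', he⟩ := T.symm.mem_edge_iff.1 h'
  rw [OnePoint.coe_eq_coe] at he
  subst he
  rw [OnePoint.coe_eq_coe, OnePoint.coe_eq_coe]
  exact ⟨T.spoke_inter_spoke hc hc' h1 hd hd' h2 hz hz',
    T.symm.spoke_inter_spoke hd hd' h2 hc hc' h1 hz' hz⟩

/-- Dual edges carry the same label: the tangent pairs of a base/dual quadruple touch at one point,
and this is the only possible intersection of their edges. -/
theorem existsUnique_dual_edge (T : FlagTiling B B') {x : OnePoint ℂ}
    (hx : x ∈ T.radialEmbedding.edgeLabels) :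
    ∃! x', x' ∈ T.symm.radialEmbedding.edgeLabels ∧
      (T.radialEmbedding.edge x ∩ T.symm.radialEmbedding.edge x').Nonempty := by
  refine ⟨x, ?_, ?_⟩
  · obtain ⟨c, hc, c', hc', h, rfl⟩ := T.mem_edgeLabels_iff.1 hx
    obtain ⟨d, hd, d', hd', h0, h1, h2, h3, h4⟩ := T.edge c hc c' hc' h
    have he := contact_eq_contact (T.pos hc) (T.pos hc') (T.symm.pos hd) (T.symm.pos hd') h h0 h1
      h2 h3 h4
    refine ⟨T.symm.mem_edgeLabels_iff.2 ⟨d, hd, d', hd', h0, by rw [he]⟩, contact c c', ?_, ?_⟩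
    · exact T.mem_edge_iff.2 ⟨c, hc, c', hc', h, rfl, _, right_mem_segment ℝ _ _, rfl⟩
    · exact T.symm.mem_edge_iff.2 ⟨d, hd, d', hd', h0, by rw [he], _, right_mem_segment ℝ _ _,
        by rw [he]⟩
  · rintro y ⟨-, w, hw, hw'⟩
    obtain ⟨h1, h2⟩ := T.eq_of_mem_edge hw hw'
    rw [← h1, ← h2]

theorem existsUnique_vertex_mem (T : FlagTiling B B') {F : Set (OnePoint ℂ)}
    (hF : F ∈ T.radialEmbedding.faces) :
    ∃! d, d ∈ B' ∧ T.symm.radialEmbedding.vertex d ∈ F := by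
  obtain ⟨d, hd, rfl⟩ := T.mem_faces_iff.1 hF
  refine ⟨d, ⟨hd, d.center, T.symm.center_mem_openCell hd, rfl⟩, ?_⟩
  rintro e ⟨he, z, hz, hez⟩
  have : z = e.center := OnePoint.coe_injective hez
  rw [this] at hz
  exact openCell_disjoint hd he hz (T.symm.center_mem he)

theorem vertex_mem_faceRegion (T : FlagTiling B B') {d : OrientedCircle} (hd : d ∈ B') :
    T.symm.radialEmbedding.vertex d ∈ T.radialEmbedding.faceRegion := by
  rw [T.faceRegion_eq]
  exact ⟨d.center, mem_biUnion hd (T.symm.center_mem_openCell hd), rfl⟩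

theorem arePlaneDuals (T : FlagTiling B B') :
    ArePlaneDuals T.radialEmbedding T.symm.radialEmbedding where
  vertex_mem _ hc := T.symm.vertex_mem_faceRegion hc
  vertex_mem' _ hd := T.vertex_mem_faceRegion hd
  face_vertex _ hF := T.existsUnique_vertex_mem hF
  face_vertex' _ hF := T.symm.existsUnique_vertex_mem hF
  edge_edge _ hx := T.existsUnique_dual_edge hx
  edge_edge' x hx := by
    have := T.symm.existsUnique_dual_edge hx
    simpa only [inter_comm] using this
  edge_inter x _ y _ := by
    rintro w ⟨hw, hw'⟩ v ⟨hv, hv'⟩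
    rw [(T.eq_of_mem_edge hw hw').1, (T.eq_of_mem_edge hv hv').1]

theorem exists_dual (T : FlagTiling B B') {c : OrientedCircle} (hc : c ∈ B) :
    ∃ d ∈ B', inversive c d = 0 := by
  obtain ⟨c', hc', h⟩ := T.exists_neighbor hc
  obtain ⟨d, hd, d', hd', h0, h1, h2, h3, h4⟩ := T.edge c hc c' hc' h
  exact ⟨d, hd, h1⟩

theorem circle_inter_nonempty_iff (T : FlagTiling B B') {c d : OrientedCircle} (hc : c ∈ B)
    (hd : d ∈ B') : (c.circle ∩ d.circle).Nonempty ↔ inversive c d = 0 := by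
  constructor
  · intro h
    refine (T.inv_dual c hc d hd).resolve_right fun h' => ?_
    exact not_disjoint_iff_nonempty_inter.2 h (disjoint_circle (T.pos hc) (T.symm.pos hd) h')
  · exact circle_inter_nonempty (T.pos hc) (T.symm.pos hd)

/-- At the centre of `c` the powers of the dual circles differ only by a nonnegative term, which
vanishes exactly in the orthogonal case, and some dual circle is orthogonal to `c`. So the centre
lies in the closed cell of `d` only if `d` is orthogonal; conversely it is then the end of a segment
inside the open cell. -/
theorem center_mem_closure_face_iff (T : FlagTiling B B') {c d : OrientedCircle} (hc : c ∈ B)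
    (hd : d ∈ B') : (c.center : OnePoint ℂ) ∈ closure (T.radialEmbedding.face d.center) ↔
      inversive c d = 0 := by
  rw [T.face_eq hd (T.symm.center_mem_openCell hd)]
  have hind : (c.center : OnePoint ℂ) ∈ closure (((↑) : ℂ → OnePoint ℂ) '' openCell B' d) ↔
      c.center ∈ closure (openCell B' d) := by
    rw [OnePoint.isOpenEmbedding_coe.isInducing.closure_eq_preimage_closure_image (openCell B' d)]
    rfl
  rw [hind]
  constructor
  · intro h
    have h1 : c.center ∈ powerCell B' d :=
      closure_minimal (openCell_subset_powerCell d) (isClosed_powerCell B' d) h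
    obtain ⟨e, he, hce⟩ := T.exists_dual hc
    have h2 := h1 e he
    rw [power_center (T.pos hc) (T.symm.pos he), power_center (T.pos hc) (T.symm.pos hd), hce] at h2
    refine le_antisymm (T.inversive_nonpos hc hd) ?_
    by_contra h3
    have : 2 * inversive c d / (c.curv * d.curv) < 0 :=
      div_neg_of_neg_of_pos (by linarith) (mul_pos (T.pos hc) (T.symm.pos hd))
    simp only [mul_zero, zero_div, sub_zero] at h2
    linarith
  · intro h
    have h1 := T.symm.dual_center_mem hd hc (by rwa [inversive_comm])
    have h2 : openSegment ℝ d.center c.center ⊆ openCell B' d := by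
      rintro _ ⟨a, b, ha, hb, hab, rfl⟩
      rw [Complex.real_smul, Complex.real_smul]
      exact T.symm.segment_mem_openCell hd h1 ha hb.le hab
    refine closure_mono h2 ?_
    rw [closure_openSegment]
    exact right_mem_segment ℝ _ _

/-- A set of circles that is closed under tangency is empty or everything. -/
theorem eq_of_closed_under_tangency (T : FlagTiling B B') {K : Set OrientedCircle} (hK : K ⊆ B)
    (hadj : ∀ c ∈ K, ∀ c' ∈ B, inversive c c' = -1 → c' ∈ K) (hne : K.Nonempty) : K = B := by
  by_contra hKB
  obtain ⟨k, hk⟩ := hne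
  obtain ⟨m, hmB, hmK⟩ := exists_of_ssubset (hK.ssubset_of_ne hKB)
  have hcount : (center '' B').Countable := by
    refine Countable.image ?_ _
    have : B' ⊆ ⋃ n : ℕ, {d ∈ B' | ‖d.center‖ ≤ n} := by
      intro d hd
      obtain ⟨n, hn⟩ := exists_nat_ge ‖d.center‖
      exact mem_iUnion.2 ⟨n, hd, hn⟩
    exact (countable_iUnion fun n : ℕ => (T.finite' n).countable).mono this
  -- At a dual centre the cells of circles that are not tangent may meet, for instance those of
  -- opposite circles of a square face. The dual centres are countable, and deleting a countable set
  -- leaves the plane connected.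
  have hconn : IsPreconnected (center '' B')ᶜ :=
    (hcount.isConnected_compl_of_one_lt_rank (E := ℂ)
      (by rw [Complex.rank_real_complex]; norm_num)).isPreconnected
  have hnot : ∀ c ∈ B, c.center ∈ (center '' B')ᶜ := by
    rintro c hc ⟨d, hd, h⟩
    have h1 := dist_center_sq (T.pos hc) (T.symm.pos hd)
    rw [h, sub_self, norm_zero] at h1
    have h2 := T.pos hc
    have h3 := T.symm.pos hd
    have : 2 * inversive c d / (c.curv * d.curv) ≤ 0 :=
      div_nonpos_of_nonpos_of_nonneg (by linarith [T.inversive_nonpos hc hd]) (by positivity)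
    have : 0 < 1 / c.curv ^ 2 := by positivity
    have : 0 < 1 / d.curv ^ 2 := by positivity
    linarith
  obtain ⟨z, hz, hz1, hz2⟩ := isPreconnected_closed_iff.1 hconn _ _ (T.isClosed_biUnion_cell hK)
    (T.isClosed_biUnion_cell (K := B \ K) sdiff_subset)
    (by
      intro z _
      obtain ⟨c, hc, hz⟩ := T.exists_mem_cell z
      by_cases h : c ∈ K
      · exact Or.inl (mem_biUnion h hz)
      · exact Or.inr (mem_biUnion (⟨hc, h⟩ : c ∈ B \ K) hz))
    ⟨k.center, hnot k (hK hk), mem_biUnion hk (T.center_mem (hK hk))⟩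
    ⟨m.center, hnot m hmB, mem_biUnion (⟨hmB, hmK⟩ : m ∈ B \ K) (T.center_mem hmB)⟩
  obtain ⟨a, ha, haz⟩ := mem_iUnion₂.1 hz1
  obtain ⟨b, hb, hbz⟩ := mem_iUnion₂.1 hz2
  obtain ⟨c, hc, d, hd, x, ⟨c', hc', h1, rfl⟩, -, h', α, β, γ, hα, hβ, hγ, hs, rfl⟩ :=
    T.exists_flag z
  -- Away from the dual centres, a second cell through the point forces a positive weight at the
  -- contact point, so its circle passes through that point. The two circles found on the two sides
  -- therefore meet, that is, they are tangent.
  have key : ∀ e ∈ B, e ≠ c →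
      (α : ℂ) * c.center + β * contact c c' + γ * d.center ∈ powerCell B e →
      e.form (contact c c') = 0 := by
    intro e he hne hze
    obtain ⟨h2, h3⟩ := T.flag_mem_other hc hc' hd h1 h' hα hβ hγ hs he hze hne
    rw [form_eq_mul_power (T.pos he), h3, mul_zero]
    refine hβ.lt_of_ne fun h0 => hz ⟨d, hd, ?_⟩
    subst h2 h0
    have : γ = 1 := by linarith
    simp [this]
  have key2 : ∀ e ∈ B, (α : ℂ) * c.center + β * contact c c' + γ * d.center ∈ powerCell B e →
      e.form (contact c c') = 0 := by
    intro e he hze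
    by_cases hec : e = c
    · rw [hec]; exact form_contact_left (T.pos hc) (T.pos hc') h1
    · exact key e he hec hze
  have hfa := key2 a (hK ha) haz
  have hfb := key2 b hb.1 hbz
  have hab : a ≠ b := by rintro rfl; exact hb.2 ha
  refine hb.2 (hadj a ha b hb.1 (le_antisymm (T.inv_le a (hK ha) b hb.1 hab) (not_lt.1 fun h => ?_)))
  exact Set.disjoint_left.1 (disjoint_circle (T.pos (hK ha)) (T.pos hb.1) h)
    (mem_circle_coe.2 hfa) (mem_circle_coe.2 hfb)

theorem connected (T : FlagTiling B B') : (tangencyGraph B).Connected := by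
  obtain ⟨c₀, hc₀⟩ := T.infinite.nonempty
  have : Nonempty B := ⟨⟨c₀, hc₀⟩⟩
  refine ⟨fun a b => ?_⟩
  have h := T.eq_of_closed_under_tangency
    (K := ((↑) : B → OrientedCircle) '' {c | (tangencyGraph B).Reachable a c})
    (by rintro _ ⟨c, -, rfl⟩; exact c.2)
    (by
      rintro _ ⟨c, hc, rfl⟩ c' hc' hcc
      refine ⟨⟨c', hc'⟩, ?_, rfl⟩
      exact SimpleGraph.Reachable.trans hc (SimpleGraph.Adj.reachable
        ⟨_, tangentAt_contact (T.pos c.2) (T.pos hc') hcc⟩))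
    ⟨a, a, SimpleGraph.Reachable.refl _, rfl⟩
  have hb : (b : OrientedCircle) ∈ ((↑) : B → OrientedCircle) ''
      {c | (tangencyGraph B).Reachable a c} := h.superset b.2
  obtain ⟨b', hb', he⟩ := hb
  rwa [← Subtype.ext he]

theorem hasDisjointInteriors (T : FlagTiling B B') : HasDisjointInteriors B := by
  intro c hc d hd hne
  have h := T.inv_le c hc d hd hne
  refine ⟨disjoint_interior (T.pos hc) (T.pos hd) h, ?_⟩
  rcases h.lt_or_eq with h | h
  · exact Or.inl (disjoint_circle (T.pos hc) (T.pos hd) h)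
  · exact Or.inr ⟨_, tangentAt_contact (T.pos hc) (T.pos hd) h⟩

theorem isBaseDualPair (T : FlagTiling B B') : IsBaseDualPair B B' where
  disjoint_base := T.hasDisjointInteriors
  disjoint_dual := T.symm.hasDisjointInteriors
  nontrivial_base := T.infinite.nontrivial
  nontrivial_dual := T.infinite'.nontrivial
  connected_base := T.connected
  connected_dual := T.symm.connected
  dual := by
    rw [T.accumulationPoints_eq]
    refine ⟨T.radialEmbedding, T.symm.radialEmbedding, T.arePlaneDuals, fun c hc d hd =>
      ⟨?_, ?_, ?_⟩⟩
    · rw [T.circle_inter_nonempty_iff hc hd, ← T.center_mem_closure_face_iff hc hd]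
      rfl
    · exact (T.circle_inter_nonempty_iff hc hd).1
    · intro h
      refine disjoint_interior (T.pos hc) (T.symm.pos hd) ?_
      rcases T.inv_dual c hc d hd with h' | h'
      · exact absurd ((T.circle_inter_nonempty_iff hc hd).2 h')
          (not_nonempty_iff_eq_empty.2 (Set.disjoint_iff_inter_eq_empty.1 h))
      · exact h'.le
  accumulation := by
    rw [T.accumulationPoints_eq]
    exact subsingleton_singleton

end FlagTiling

/-! ### Inversive coordinates as vectors; apex and children of a face -/

namespace OrientedCircle

/-- The inversive coordinates of a circle as a vector. -/
def vec (c : OrientedCircle) : ℝ × ℝ × ℂ := (c.cocurv, c.curv, c.h)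

theorem vec_injective : Function.Injective vec := by
  intro c d h
  simp only [vec, Prod.mk.injEq] at h
  exact OrientedCircle.ext h.1 h.2.1 h.2.2

/-- The bilinear form of signature `(3, 1)` behind the inversive product. -/
noncomputable def ip : (ℝ × ℝ × ℂ) →ₗ[ℝ] (ℝ × ℝ × ℂ) →ₗ[ℝ] ℝ :=
  LinearMap.mk₂ ℝ (fun v w => v.2.2.re * w.2.2.re + v.2.2.im * w.2.2.im -
    (v.2.1 * w.1 + v.1 * w.2.1) / 2)
    (fun _ _ _ => by simp; ring) (fun _ _ _ => by simp; ring) (fun _ _ _ => by simp; ring)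
    (fun _ _ _ => by simp; ring)

theorem ip_apply (v w : ℝ × ℝ × ℂ) : ip v w = v.2.2.re * w.2.2.re + v.2.2.im * w.2.2.im -
    (v.2.1 * w.1 + v.1 * w.2.1) / 2 := rfl

theorem ip_vec (c d : OrientedCircle) : ip c.vec d.vec = inversive c d := rfl

/-- A vector of square `1` as a circle. -/
def ofVec (v : ℝ × ℝ × ℂ) (h : ip v v = 1) : OrientedCircle where
  cocurv := v.1
  curv := v.2.1
  h := v.2.2
  normalized := by rw [ip_apply] at h; linear_combination h

theorem vec_ofVec (v : ℝ × ℝ × ℂ) (h : ip v v = 1) : (ofVec v h).vec = v := rfl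

theorem ip_infty (c : OrientedCircle) : ip c.vec (1, 0, 0) = -c.curv / 2 := by
  simp [ip_apply, vec]; ring

/-- Three circles orthogonal to a fourth one whose inversive products are `-1`, `-1` and at most
`-1` form with it a basis of the space of coordinate vectors. -/
theorem exists_comb {a b c d : OrientedCircle} (hab : inversive a b = -1) (hbc : inversive b c = -1)
    (hac : inversive a c ≤ -1) (ha : inversive a d = 0) (hb : inversive b d = 0)
    (hc : inversive c d = 0) (v : ℝ × ℝ × ℂ) :
    ∃ x y z w : ℝ, v = x • a.vec + y • b.vec + z • c.vec + w • d.vec := by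
  have hli : LinearIndependent ℝ ![a.vec, b.vec, c.vec, d.vec] := by
    rw [Fintype.linearIndependent_iff]
    intro g hg
    simp only [Fin.sum_univ_four, Matrix.cons_val] at hg
    -- Pairing the relation with the four circles gives the Gram system. It is nonsingular because
    -- the product of `a` and `c` differs from `1`.
    have key : ∀ e : OrientedCircle, g 0 * inversive e a + g 1 * inversive e b +
        g 2 * inversive e c + g 3 * inversive e d = 0 := by
      intro e
      have := congrArg (ip e.vec) hg
      simpa only [map_add, _root_.map_smul, ip_vec, smul_eq_mul, map_zero] using this
    have h1 := key a
    have h2 := key b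
    have h3 := key c
    have h4 := key d
    rw [inversive_comm c a, inversive_comm c b] at h3
    rw [inversive_comm b a] at h2
    rw [inversive_comm d a, inversive_comm d b, inversive_comm d c] at h4
    simp only [inversive_self, hab, hbc, ha, hb, hc] at h1 h2 h3 h4
    have e2 : g 2 = 0 := by
      have : (inversive a c - 1) * g 2 = 0 := by linear_combination h1 + h2
      have h5 : inversive a c - 1 ≠ 0 := by linarith
      simpa [h5] using this
    have e0 : g 0 = 0 := by
      have : (inversive a c - 1) * g 0 = 0 := by linear_combination h3 + h2
      have h5 : inversive a c - 1 ≠ 0 := by linarith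
      simpa [h5] using this
    have e1 : g 1 = 0 := by rw [e0, e2] at h2; linarith
    have e3 : g 3 = 0 := by linarith
    intro i
    fin_cases i <;> assumption
  have hspan := hli.span_eq_top_of_card_eq_finrank (by
    simp [Module.finrank_prod, Complex.finrank_real_complex])
  have hv : v ∈ Submodule.span ℝ (range ![a.vec, b.vec, c.vec, d.vec]) := by
    rw [hspan]; trivial
  obtain ⟨g, hg⟩ := (Submodule.mem_span_range_iff_exists_fun ℝ).1 hv
  refine ⟨g 0, g 1, g 2, g 3, ?_⟩
  rw [← hg]
  simp [Fin.sum_univ_four]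

/-- Nondegeneracy of the form: linear identities between circles can be checked by four inversive
products, without Euclidean computation. -/
theorem eq_of_ip_eq {a b c d : OrientedCircle} (hab : inversive a b = -1)
    (hbc : inversive b c = -1) (hac : inversive a c ≤ -1) (ha : inversive a d = 0)
    (hb : inversive b d = 0) (hc : inversive c d = 0) {v v' : ℝ × ℝ × ℂ}
    (h1 : ip a.vec v = ip a.vec v') (h2 : ip b.vec v = ip b.vec v')
    (h3 : ip c.vec v = ip c.vec v') (h4 : ip d.vec v = ip d.vec v') : v = v' := by
  have key : ∀ w, ip w (v - v') = 0 := by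
    intro w
    obtain ⟨x, y, z, t, rfl⟩ := exists_comb hab hbc hac ha hb hc w
    simp only [map_add, _root_.map_smul, LinearMap.add_apply, LinearMap.smul_apply, map_sub, h1, h2, h3,
      h4, sub_self, smul_zero, add_zero]
  have e1 := key (0, -2, 0)
  have e2 := key (-2, 0, 0)
  have e3 := key (0, 0, 1)
  have e4 := key (0, 0, Complex.I)
  simp [ip_apply] at e1 e2 e3 e4
  refine Prod.ext ?_ (Prod.ext ?_ (Complex.ext ?_ ?_)) <;> linarith

/-- The circles of `B` which are orthogonal to `d`. -/
def face (B : Set OrientedCircle) (d : OrientedCircle) : Set OrientedCircle :=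
  {c ∈ B | inversive c d = 0}

/-- The circle `n` touches all circles of the face `d` and has inversive product `2 γ` with `d`. -/
def IsApex (B : Set OrientedCircle) (γ : ℝ) (d n : OrientedCircle) : Prop :=
  (∀ c ∈ face B d, inversive n c = -1) ∧ inversive n d = 2 * γ

/-- The circle `e` is orthogonal to the adjacent circles `c` and `c'` of the face `d`, and to the
apex of the face. -/
def IsChild (B : Set OrientedCircle) (γ : ℝ) (d c c' e : OrientedCircle) : Prop :=
  c ∈ face B d ∧ c' ∈ face B d ∧ inversive c c' = -1 ∧ e.vec = d.vec + γ • (c.vec + c'.vec)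

/-- A regular face into which a circle can be inserted that touches all circles of the face. -/
structure PolyFace (B : Set OrientedCircle) (γ : ℝ) (d : OrientedCircle) : Prop where
  neighbors : ∀ c ∈ face B d, ∃ c' ∈ face B d, ∃ c'' ∈ face B d, c' ≠ c'' ∧
    inversive c c' = -1 ∧ inversive c c'' = -1
  -- This is the condition under which the two children at a common vertex are tangent. It fixes
  -- `γ`: for a triangle `γ = 1`, for a square `γ ^ 2 = 1 / 2`.
  fan : ∀ c ∈ face B d, ∀ c' ∈ face B d, ∀ c'' ∈ face B d, inversive c c' = -1 →
    inversive c c'' = -1 → c' ≠ c'' → γ ^ 2 * (inversive c' c'' - 1) = -2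
  apex : ∃ n, IsApex B γ d n ∧ (∀ n', IsApex B γ d n' → n' = n)
  -- The apex is a positive combination of circles of the face and of `d`; this consequence is all
  -- that is needed to transfer upper bounds for inversive products from the face to the apex.
  bound : ∀ n, IsApex B γ d n → ∀ w : ℝ × ℝ × ℂ, ∀ m ≤ (0 : ℝ),
    (∀ c ∈ face B d, ip c.vec w ≤ m) → ip d.vec w ≤ 0 → ip n.vec w ≤ m + 2 * γ * ip d.vec w

/-- The collection `B` with an additional circle in each face of `F`. -/
def stackBase (B : Set OrientedCircle) (γ : ℝ) (F : Set OrientedCircle) : Set OrientedCircle :=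
  B ∪ {n | ∃ d ∈ F, IsApex B γ d n}

/-- The dual collection of `stackBase B γ F`. -/
def stackDual (B B' : Set OrientedCircle) (γ : ℝ) (F : Set OrientedCircle) :
    Set OrientedCircle :=
  (B' \ F) ∪ {e | ∃ d ∈ F, ∃ c c', IsChild B γ d c c' e}

end OrientedCircle

/-! ### Inversive products after stacking -/

open OrientedCircle

/-- The combinatorial and metric properties of a base/dual pair, except for the covering
property. -/
structure Config (B B' : Set OrientedCircle) : Prop where
  one_le_curv : ∀ c ∈ B, 1 ≤ c.curv
  one_le_curv' : ∀ d ∈ B', 1 ≤ d.curv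
  inv_le : ∀ c ∈ B, ∀ c' ∈ B, c ≠ c' → inversive c c' ≤ -1
  inv_le' : ∀ d ∈ B', ∀ d' ∈ B', d ≠ d' → inversive d d' ≤ -1
  inv_dual : ∀ c ∈ B, ∀ d ∈ B', inversive c d = 0 ∨ inversive c d < -1
  infinite : B.Infinite
  finite : ∀ R, {c ∈ B | ‖c.center‖ ≤ R}.Finite
  finite' : ∀ R, {d ∈ B' | ‖d.center‖ ≤ R}.Finite
  edge_face : ∀ c ∈ B, ∀ c' ∈ B, inversive c c' = -1 →
    ∃ d ∈ B', inversive c d = 0 ∧ inversive c' d = 0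
  face_adj : ∀ d ∈ B', ∀ c ∈ face B d, ∀ c' ∈ face B d, inversive c c' = -1 →
    ∃ d' ∈ B', inversive d d' = -1 ∧ inversive c d' = 0 ∧ inversive c' d' = 0
  edge' : ∀ d ∈ B', ∀ d' ∈ B', inversive d d' = -1 → ∃ c ∈ B, ∃ c' ∈ B, inversive c c' = -1 ∧
    inversive c d = 0 ∧ inversive c d' = 0 ∧ inversive c' d = 0 ∧ inversive c' d' = 0

namespace OrientedCircle

variable {B : Set OrientedCircle} {γ : ℝ} {d c c' e : OrientedCircle}

theorem IsChild.symm (h : IsChild B γ d c c' e) : IsChild B γ d c' c e :=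
  ⟨h.2.1, h.1, by rw [inversive_comm]; exact h.2.2.1, by rw [add_comm c'.vec]; exact h.2.2.2⟩

theorem IsChild.inv (h : IsChild B γ d c c' e) (f : OrientedCircle) :
    inversive f e = inversive f d + γ * (inversive f c + inversive f c') := by
  simp only [← ip_vec, h.2.2.2, map_add, _root_.map_smul, smul_eq_mul]

theorem exists_isChild (hc : c ∈ face B d) (hc' : c' ∈ face B d) (h : inversive c c' = -1) :
    ∃ e, IsChild B γ d c c' e := by
  refine ⟨ofVec (d.vec + γ • (c.vec + c'.vec)) ?_, hc, hc', h, rfl⟩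
  simp only [map_add, _root_.map_smul, LinearMap.add_apply, LinearMap.smul_apply, smul_eq_mul, ip_vec,
    inversive_self, inversive_comm d, inversive_comm c' c, hc.2, hc'.2, h]
  ring

theorem IsChild.unique {e' : OrientedCircle} (h : IsChild B γ d c c' e)
    (h' : IsChild B γ d c c' e') : e = e' :=
  vec_injective (h.2.2.2.trans h'.2.2.2.symm)

theorem IsChild.inv_parent (h : IsChild B γ d c c' e) : inversive e d = 1 := by
  rw [inversive_comm, h.inv, inversive_self, inversive_comm d, h.1.2, inversive_comm d, h.2.1.2]
  simp

theorem IsChild.inv_left (h : IsChild B γ d c c' e) : inversive c e = 0 := by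
  rw [h.inv, h.1.2, inversive_self, h.2.2.1]
  simp

theorem IsChild.inv_right (h : IsChild B γ d c c' e) : inversive c' e = 0 := h.symm.inv_left

theorem IsChild.inv_apex {n : OrientedCircle} (h : IsChild B γ d c c' e) (hn : IsApex B γ d n) :
    inversive n e = 0 := by
  rw [h.inv, hn.2, hn.1 c h.1, hn.1 c' h.2.1]; ring

/-- The admissible values of the parameter of a regular face. -/
def Admissible (γ : ℝ) : Prop := 0 < γ ∧ (γ ^ 2 = 1 ∨ γ ^ 2 = 1 / 2)

theorem Admissible.one_lt (h : Admissible γ) : 1 < 2 * γ := by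
  obtain ⟨h0, h | h⟩ := h <;> nlinarith

theorem dist_center_le (hc : 1 ≤ c.curv) (hd : 1 ≤ d.curv) (h : 0 ≤ inversive c d) :
    ‖c.center - d.center‖ ≤ 2 := by
  have h1 := dist_center_sq (one_pos.trans_le hc) (one_pos.trans_le hd)
  have hr : ∀ {r : ℝ}, 1 ≤ r → 1 / r ^ 2 ≤ 1 := fun {r} hr => by
    rw [div_le_one (by positivity)]; nlinarith
  have h2 : 0 ≤ 2 * inversive c d / (c.curv * d.curv) := by positivity
  refine abs_le_of_sq_le_sq' ?_ (by norm_num) |>.2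
  linarith [hr hc, hr hd]

end OrientedCircle

namespace Config

variable {B B' F : Set OrientedCircle} {γ : ℝ}

/-- Two children of the same face which share a vertex are tangent. -/
theorem sibling_tangent {d c c' a e f : OrientedCircle} (hd : PolyFace B γ d) (he : IsChild B γ d c c' e)
    (hf : IsChild B γ d c a f) (hne : c' ≠ a) : inversive e f = -1 := by
  have h1 := hd.fan c he.1 c' he.2.1 a hf.2.1 he.2.2.1 hf.2.2.1 hne
  rw [hf.inv, he.inv_parent, inversive_comm e c, he.inv_left, inversive_comm e a, he.inv,
    hf.2.1.2, inversive_comm a c, hf.2.2.1, inversive_comm a c']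
  linear_combination h1

section products

variable (H : Config B B') (hF : F ⊆ B') (hP : ∀ d ∈ F, PolyFace B γ d) (hγ : Admissible γ)
  {d d' n n' c c' a a' e f : OrientedCircle}

include H

theorem inversive_nonpos (hc : c ∈ B) (hd : d ∈ B') : inversive c d ≤ 0 := by
  rcases H.inv_dual c hc d hd with h | h <;> linarith

/-- The product equals that of `a` with `d`, which is nonpositive, plus `γ` times two products that
are at most `-1`; hence it is at most `-2 * γ`, and `2 * γ` exceeds one. -/
theorem child_base_lt (hγ : Admissible γ) (hd : d ∈ B') (he : IsChild B γ d c c' e) (ha : a ∈ B)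
    (h1 : a ≠ c) (h2 : a ≠ c') : inversive a e < -1 := by
  rw [he.inv]
  have := H.inversive_nonpos ha hd
  have h3 := H.inv_le a ha c he.1.1 h1
  have h4 := H.inv_le a ha c' he.2.1.1 h2
  nlinarith [hγ.one_lt, hγ.1]

theorem child_base_nonpos (hγ : Admissible γ) (hd : d ∈ B') (he : IsChild B γ d c c' e)
    (ha : a ∈ B) : inversive a e ≤ 0 := by
  by_cases h1 : a = c
  · rw [h1, he.inv_left]
  by_cases h2 : a = c'
  · rw [h2, he.inv_right]
  linarith [H.child_base_lt hγ hd he ha h1 h2]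

theorem child_base_eq (hγ : Admissible γ) (hd : d ∈ B') (he : IsChild B γ d c c' e)
    (ha : a ∈ B) (h : inversive a e = 0) : a = c ∨ a = c' := by
  by_contra! h1
  linarith [H.child_base_lt hγ hd he ha h1.1 h1.2]

/-- Passing from the parent to the child adds nonpositive terms to a product that is already at most
`-1`. Equality therefore says that `d'` is the face on the other side of the edge `c c'`. -/
theorem child_dual_le (hγ : Admissible γ) (hd : d ∈ B') (he : IsChild B γ d c c' e) (hd' : d' ∈ B')
    (hne : d' ≠ d) : inversive d' e ≤ -1 ∧ (inversive d' e = -1 →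
      inversive d d' = -1 ∧ inversive c d' = 0 ∧ inversive c' d' = 0) := by
  rw [he.inv, inversive_comm d' c, inversive_comm d' c', inversive_comm d' d]
  have h1 := H.inv_le' d hd d' hd' hne.symm
  have h2 := H.inversive_nonpos he.1.1 hd'
  have h3 := H.inversive_nonpos he.2.1.1 hd'
  have h4 := mul_nonpos_of_nonneg_of_nonpos hγ.1.le h2
  have h5 := mul_nonpos_of_nonneg_of_nonpos hγ.1.le h3
  refine ⟨by linarith, fun h => ⟨by linarith, ?_, ?_⟩⟩
  · exact le_antisymm h2 (by by_contra h6; nlinarith [hγ.1])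
  · exact le_antisymm h3 (by by_contra h6; nlinarith [hγ.1])

/-- The previous argument is applied to the second child as well. In the case of equality both of
its old vertices are orthogonal to `e`, so the two children sit on the same edge. -/
theorem child_child_le (hγ : Admissible γ) (hd : d ∈ B') (he : IsChild B γ d c c' e) (hd' : d' ∈ B')
    (hf : IsChild B γ d' a a' f) (hne : d' ≠ d) : inversive e f ≤ -1 ∧ (inversive e f = -1 →
      inversive d d' = -1 ∧ inversive c f = 0 ∧ inversive c' f = 0) := by
  have h1 := H.child_dual_le hγ hd he hd' hne
  have h2 := H.child_base_nonpos hγ hd he hf.1.1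
  have h3 := H.child_base_nonpos hγ hd he hf.2.1.1
  have h4 := mul_nonpos_of_nonneg_of_nonpos hγ.1.le h2
  have h5 := mul_nonpos_of_nonneg_of_nonpos hγ.1.le h3
  rw [hf.inv, inversive_comm e a, inversive_comm e a', inversive_comm e d']
  refine ⟨by linarith [h1.1], fun h => ?_⟩
  obtain ⟨h6, h7, h8⟩ := h1.2 (by linarith [h1.1])
  have h9 : inversive a e = 0 := le_antisymm h2 (by by_contra h6; nlinarith [hγ.1, h1.1])
  have h10 : inversive a' e = 0 := le_antisymm h3 (by by_contra h6; nlinarith [hγ.1, h1.1])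
  have haa : a ≠ a' := FlagTiling.ne_of_inversive hf.2.2.1
  refine ⟨h6, ?_⟩
  rcases H.child_base_eq hγ hd he hf.1.1 h9 with rfl | rfl <;>
  rcases H.child_base_eq hγ hd he hf.2.1.1 h10 with rfl | rfl
  · exact absurd rfl haa
  · exact ⟨hf.inv_left, hf.inv_right⟩
  · exact ⟨hf.inv_right, hf.inv_left⟩
  · exact absurd rfl haa

/-- Children at a common vertex are tangent by `sibling_tangent`. For children on edges without a
common vertex, expanding the product gives `1 + γ ^ 2` times a sum of four products that are at most
`-1`. -/
theorem sibling_le (hγ : Admissible γ) (hd : PolyFace B γ d) (he : IsChild B γ d c c' e)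
    (hf : IsChild B γ d a a' f) (hne : e ≠ f) :
    inversive e f ≤ -1 ∧ (inversive e f = -1 → ∃ b ∈ face B d, inversive b e = 0 ∧
      inversive b f = 0) := by
  by_cases h1 : c = a
  · subst h1
    rw [sibling_tangent hd he hf (by rintro rfl; exact hne (he.unique hf))]
    exact ⟨le_rfl, fun _ => ⟨c, he.1, he.inv_left, hf.inv_left⟩⟩
  by_cases h2 : c = a'
  · subst h2
    rw [sibling_tangent hd he hf.symm (by rintro rfl; exact hne (he.unique hf.symm))]
    exact ⟨le_rfl, fun _ => ⟨c, he.1, he.inv_left, hf.inv_right⟩⟩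
  by_cases h3 : c' = a
  · subst h3
    rw [sibling_tangent hd he.symm hf (by rintro rfl; exact hne (he.symm.unique hf))]
    exact ⟨le_rfl, fun _ => ⟨c', he.2.1, he.inv_right, hf.inv_left⟩⟩
  by_cases h4 : c' = a'
  · subst h4
    rw [sibling_tangent hd he.symm hf.symm (by rintro rfl; exact hne (he.symm.unique hf.symm))]
    exact ⟨le_rfl, fun _ => ⟨c', he.2.1, he.inv_right, hf.inv_right⟩⟩
  have h5 := H.inv_le a hf.1.1 c he.1.1 (Ne.symm h1)
  have h6 := H.inv_le a' hf.2.1.1 c he.1.1 (Ne.symm h2)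
  have h7 := H.inv_le a hf.1.1 c' he.2.1.1 (Ne.symm h3)
  have h8 := H.inv_le a' hf.2.1.1 c' he.2.1.1 (Ne.symm h4)
  have h9 : inversive e f = 1 + γ ^ 2 * (inversive a c + inversive a c' + (inversive a' c +
      inversive a' c')) := by
    rw [hf.inv, he.inv_parent, inversive_comm e a, he.inv, hf.1.2, inversive_comm e a', he.inv,
      hf.2.1.2]
    ring
  have h10 : inversive e f < -1 := by
    rw [h9]
    obtain ⟨-, h | h⟩ := hγ
    · rw [h]; linarith
    -- For `γ ^ 2 = 1 / 2` equality would make all four products `-1`. Then `c` and `c'` are tangent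
    -- to each other and both tangent to `a`, and the fan condition at `a` would read `-1 = -2`.
    · by_contra h11
      rw [h] at h11
      have h12 : inversive a c = -1 := by linarith
      have h13 : inversive a c' = -1 := by linarith
      have := hd.fan a hf.1 c he.1 c' he.2.1 h12 h13 (FlagTiling.ne_of_inversive he.2.2.1)
      rw [h, he.2.2.1] at this
      norm_num at this
  exact ⟨h10.le, fun h => absurd h h10.ne⟩

include hF hP hγ

/-- The bound with `m = -1`, improved by the strictly negative product of `c` with the dual circle
`d`. -/
theorem apex_base_lt (hd : d ∈ F) (hn : IsApex B γ d n) (hc : c ∈ B) (h : c ∉ face B d) :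
    inversive n c < -1 := by
  have h1 : inversive c d < -1 :=
    (H.inv_dual c hc d (hF hd)).resolve_left fun h0 => h ⟨hc, h0⟩
  have := (hP d hd).bound n hn c.vec (-1) (by norm_num)
    (fun a ha => by
      rw [ip_vec]
      exact H.inv_le a ha.1 c hc (by rintro rfl; exact h ha))
    (by rw [ip_vec, inversive_comm]; linarith)
  rw [ip_vec, ip_vec, inversive_comm d] at this
  nlinarith [hγ.1]

theorem apex_base_le (hd : d ∈ F) (hn : IsApex B γ d n) (hc : c ∈ B) : inversive n c ≤ -1 := by
  by_cases h : c ∈ face B d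
  · exact (hn.1 c h).le
  · exact (H.apex_base_lt hF hP hγ hd hn hc h).le

/-- The bound with `m = 0` yields at most `-2 * γ`; strictness comes from `2 * γ > 1`. -/
theorem apex_dual_lt (hd : d ∈ F) (hn : IsApex B γ d n) (hd' : d' ∈ B') (h : d' ≠ d) :
    inversive n d' < -1 := by
  have h1 := H.inv_le' d (hF hd) d' hd' h.symm
  have := (hP d hd).bound n hn d'.vec 0 le_rfl
    (fun a ha => by rw [ip_vec]; exact H.inversive_nonpos ha.1 hd')
    (by rw [ip_vec]; linarith)
  rw [ip_vec, ip_vec] at this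
  nlinarith [hγ.one_lt]

theorem apex_apex_lt (hd : d ∈ F) (hn : IsApex B γ d n) (hd' : d' ∈ F) (hn' : IsApex B γ d' n')
    (h : d' ≠ d) : inversive n n' < -1 := by
  have h1 := H.apex_dual_lt hF hP hγ hd' hn' (hF hd) h.symm
  have := (hP d hd).bound n hn n'.vec (-1) (by norm_num)
    (fun a ha => by
      rw [ip_vec, inversive_comm]; exact H.apex_base_le hF hP hγ hd' hn' ha.1)
    (by rw [ip_vec, inversive_comm]; linarith)
  rw [ip_vec, ip_vec, inversive_comm d] at this
  nlinarith [hγ.1]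

theorem apex_child_lt (hd : d ∈ F) (hn : IsApex B γ d n) (hd' : d' ∈ F)
    (he : IsChild B γ d' c c' e) (h : d' ≠ d) : inversive n e < -1 := by
  rw [he.inv]
  have h1 := H.apex_dual_lt hF hP hγ hd hn (hF hd') h
  have h2 := H.apex_base_le hF hP hγ hd hn he.1.1
  have h3 := H.apex_base_le hF hP hγ hd hn he.2.1.1
  nlinarith [hγ.1]

/-- Curvature is itself a pairing, namely with the isotropic vector `(1, 0, 0)` that represents `∞`.
The bound with `m = -κ / 2` then makes the apex smaller than every circle considered so far. -/
theorem lt_curv_apex (hd : d ∈ F) (hn : IsApex B γ d n) {κ : ℝ} (hκ : 0 ≤ κ)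
    (hB : ∀ c ∈ B, κ ≤ c.curv) : κ < n.curv := by
  have h1 := one_pos.trans_le (H.one_le_curv' d (hF hd))
  have := (hP d hd).bound n hn (1, 0, 0) (-κ / 2) (by linarith)
    (fun a ha => by rw [ip_infty]; linarith [hB a ha.1])
    (by rw [ip_infty]; linarith)
  rw [ip_infty, ip_infty] at this
  nlinarith [hγ.1]

end products

theorem curv_child (H : Config B B') (hγ : Admissible γ) {d c c' e : OrientedCircle} (hd : d ∈ B')
    (he : IsChild B γ d c c' e) : 1 ≤ e.curv := by
  have h1 : e.curv = d.curv + γ * (c.curv + c'.curv) := by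
    have := congrArg (fun v => v.2.1) he.2.2.2
    simpa [vec] using this
  have h2 := H.one_le_curv' d hd
  have h3 := H.one_le_curv c he.1.1
  have h4 := H.one_le_curv c' he.2.1.1
  rw [h1]
  nlinarith [hγ.1]

end Config

/-! ### Stacking preserves configurations -/

open OrientedCircle

namespace Config

variable {B B' F : Set OrientedCircle} {γ : ℝ}

section stack

variable (H : Config B B') (hF : F ⊆ B') (hP : ∀ d ∈ F, PolyFace B γ d) (hγ : Admissible γ)

include H hF hP hγ

-- Along each edge of an old face lies a successor of that face: the face itself if it is not
-- subdivided, otherwise its child on this edge. The last clause says that neighbours across the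
-- edge remain tangent to the successor.
omit H hF hP hγ in
theorem exists_stackDual {d c c' : OrientedCircle} (hd : d ∈ B') (hc : c ∈ face B d)
    (hc' : c' ∈ face B d) (h : inversive c c' = -1) :
    ∃ e ∈ stackDual B B' γ F, inversive c e = 0 ∧ inversive c' e = 0 ∧
      ∀ f, inversive f d = -1 → inversive f c = 0 → inversive f c' = 0 → inversive f e = -1 := by
  by_cases hdF : d ∈ F
  · obtain ⟨e, he⟩ := exists_isChild (γ := γ) hc hc' h
    refine ⟨e, Or.inr ⟨d, hdF, c, c', he⟩, he.inv_left, he.inv_right, fun f h1 h2 h3 => ?_⟩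
    rw [he.inv, h1, h2, h3]; ring
  · exact ⟨d, Or.inl ⟨hd, hdF⟩, hc.2, hc'.2, fun f h1 _ _ => h1⟩

theorem stack_inv_le : ∀ c ∈ stackBase B γ F, ∀ c' ∈ stackBase B γ F, c ≠ c' →
    inversive c c' ≤ -1 := by
  rintro c (hc | ⟨d, hd, hc⟩) c' (hc' | ⟨d', hd', hc'⟩) hne
  · exact H.inv_le c hc c' hc' hne
  · rw [inversive_comm]; exact H.apex_base_le hF hP hγ hd' hc' hc
  · exact H.apex_base_le hF hP hγ hd hc hc'
  · refine (H.apex_apex_lt hF hP hγ hd hc hd' hc' ?_).le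
    rintro rfl
    obtain ⟨n, -, hn⟩ := (hP _ hd).apex
    exact hne ((hn c hc).trans (hn c' hc').symm)

theorem stack_inv_dual : ∀ c ∈ stackBase B γ F, ∀ d ∈ stackDual B B' γ F,
    inversive c d = 0 ∨ inversive c d < -1 := by
  rintro c (hc | ⟨d, hd, hc⟩) e (⟨he, heF⟩ | ⟨d', hd', a, a', he⟩)
  · exact H.inv_dual c hc e he
  · by_cases h1 : c = a
    · left; rw [h1, he.inv_left]
    by_cases h2 : c = a'
    · left; rw [h2, he.inv_right]
    right; exact H.child_base_lt hγ (hF hd') he hc h1 h2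
  · right; exact H.apex_dual_lt hF hP hγ hd hc he (by rintro rfl; exact heF hd)
  · by_cases h : d' = d
    · subst h; left; exact he.inv_apex hc
    · right; exact H.apex_child_lt hF hP hγ hd hc hd' he h

theorem stack_dual_le : ∀ d ∈ stackDual B B' γ F, ∀ d' ∈ stackDual B B' γ F, d ≠ d' →
    inversive d d' ≤ -1 ∧ (inversive d d' = -1 → ∃ c ∈ stackBase B γ F, ∃ c' ∈ stackBase B γ F,
      inversive c c' = -1 ∧ inversive c d = 0 ∧ inversive c d' = 0 ∧ inversive c' d = 0 ∧
      inversive c' d' = 0) := by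
  rintro e (⟨he, heF⟩ | ⟨d, hd, c, c', he⟩) f (⟨hf, hfF⟩ | ⟨d', hd', a, a', hf⟩) hne
  · refine ⟨H.inv_le' e he f hf hne, fun h => ?_⟩
    obtain ⟨c, hc, c', hc', h'⟩ := H.edge' e he f hf h
    exact ⟨c, Or.inl hc, c', Or.inl hc', h'⟩
  · obtain ⟨h1, h2⟩ := H.child_dual_le hγ (hF hd') hf he (by rintro rfl; exact heF hd')
    refine ⟨h1, fun h => ⟨a, Or.inl hf.1.1, a', Or.inl hf.2.1.1, hf.2.2.1, (h2 h).2.1, hf.inv_left,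
      (h2 h).2.2, hf.inv_right⟩⟩
  · obtain ⟨h1, h2⟩ := H.child_dual_le hγ (hF hd) he hf (by rintro rfl; exact hfF hd)
    rw [inversive_comm]
    exact ⟨h1, fun h => ⟨c, Or.inl he.1.1, c', Or.inl he.2.1.1, he.2.2.1, he.inv_left, (h2 h).2.1,
      he.inv_right, (h2 h).2.2⟩⟩
  · by_cases h : d' = d
    · subst h
      obtain ⟨h1, h2⟩ := H.sibling_le hγ (hP _ hd) he hf hne
      refine ⟨h1, fun h => ?_⟩
      obtain ⟨b, hb, hbe, hbf⟩ := h2 h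
      obtain ⟨n, hn, -⟩ := (hP _ hd).apex
      exact ⟨n, Or.inr ⟨_, hd, hn⟩, b, Or.inl hb.1, hn.1 b hb, he.inv_apex hn, hf.inv_apex hn,
        hbe, hbf⟩
    · obtain ⟨h1, h2⟩ := H.child_child_le hγ (hF hd) he (hF hd') hf h
      exact ⟨h1, fun h => ⟨c, Or.inl he.1.1, c', Or.inl he.2.1.1, he.2.2.1, he.inv_left, (h2 h).2.1,
        he.inv_right, (h2 h).2.2⟩⟩

/-- Every new face is a triangle, whatever the subdivided polygon was, so a parameter other than `1`
can occur only in the first stacking. -/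
theorem face_stack_child {d c c' e n : OrientedCircle} (hd : d ∈ F) (he : IsChild B γ d c c' e)
    (hn : IsApex B γ d n) : face (stackBase B γ F) e = {c, c', n} := by
  ext a
  simp only [mem_insert_iff, mem_singleton_iff]
  constructor
  · rintro ⟨ha | ⟨d', hd', ha⟩, h⟩
    · rcases H.child_base_eq hγ (hF hd) he ha h with h | h <;> simp [h]
    · by_cases hdd : d = d'
      · subst hdd
        obtain ⟨n₀, -, hn₀⟩ := (hP _ hd).apex
        right; right
        exact (hn₀ a ha).trans (hn₀ n hn).symm
      · have := H.apex_child_lt hF hP hγ hd' ha hd he hdd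
        rw [h] at this; norm_num at this
  · rintro (rfl | rfl | rfl)
    · exact ⟨Or.inl he.1.1, he.inv_left⟩
    · exact ⟨Or.inl he.2.1.1, he.inv_right⟩
    · exact ⟨Or.inr ⟨d, hd, hn⟩, he.inv_apex hn⟩

theorem face_stack_old {d : OrientedCircle} (hd : d ∈ B') (hdF : d ∉ F) :
    face (stackBase B γ F) d = face B d := by
  ext a
  constructor
  · rintro ⟨ha | ⟨d', hd', ha⟩, h⟩
    · exact ⟨ha, h⟩
    · have := H.apex_dual_lt hF hP hγ hd' ha hd (by rintro rfl; exact hdF hd')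
      rw [h] at this; norm_num at this
  · rintro ⟨ha, h⟩
    exact ⟨Or.inl ha, h⟩

theorem stack_edge_face : ∀ c ∈ stackBase B γ F, ∀ c' ∈ stackBase B γ F, inversive c c' = -1 →
    ∃ d ∈ stackDual B B' γ F, inversive c d = 0 ∧ inversive c' d = 0 := by
  have key : ∀ d ∈ F, ∀ n, IsApex B γ d n → ∀ c ∈ B, inversive n c = -1 →
      ∃ d ∈ stackDual B B' γ F, inversive n d = 0 ∧ inversive c d = 0 := by
    intro d hd n hn c hc h
    by_cases hcd : c ∈ face B d
    · obtain ⟨a, ha, -, -, -, hca, -⟩ := (hP d hd).neighbors c hcd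
      obtain ⟨e, he⟩ := exists_isChild (γ := γ) hcd ha hca
      exact ⟨e, Or.inr ⟨d, hd, _, _, he⟩, he.inv_apex hn, he.inv_left⟩
    · exact absurd h (H.apex_base_lt hF hP hγ hd hn hc hcd).ne
  rintro c (hc | ⟨d, hd, hc⟩) c' (hc' | ⟨d', hd', hc'⟩) h
  · obtain ⟨d, hd, h1, h2⟩ := H.edge_face c hc c' hc' h
    obtain ⟨e, he, h3, h4, -⟩ := exists_stackDual (F := F) (γ := γ) hd ⟨hc, h1⟩ ⟨hc', h2⟩ h
    exact ⟨e, he, h3, h4⟩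
  · obtain ⟨e, he, h1, h2⟩ := key d' hd' c' hc' c hc (by rwa [inversive_comm])
    exact ⟨e, he, h2, h1⟩
  · exact key d hd c hc c' hc' h
  · by_cases hdd : d' = d
    · subst hdd
      obtain ⟨n, -, hn⟩ := (hP _ hd).apex
      rw [hn c hc, hn c' hc', inversive_self] at h
      norm_num at h
    · exact absurd h (H.apex_apex_lt hF hP hγ hd hc hd' hc' hdd).ne

theorem stack_face_adj : ∀ d ∈ stackDual B B' γ F, ∀ c ∈ face (stackBase B γ F) d,
    ∀ c' ∈ face (stackBase B γ F) d, inversive c c' = -1 → ∃ d' ∈ stackDual B B' γ F,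
      inversive d d' = -1 ∧ inversive c d' = 0 ∧ inversive c' d' = 0 := by
  rintro e (⟨he, heF⟩ | ⟨d, hd, a, a', he⟩)
  · intro c hc c' hc' h
    rw [H.face_stack_old hF hP hγ he heF] at hc hc'
    obtain ⟨d', hd', h1, h2, h3⟩ := H.face_adj e he c hc c' hc' h
    obtain ⟨f, hf, h4, h5, h6⟩ := exists_stackDual (F := F) (γ := γ) hd' ⟨hc.1, h2⟩ ⟨hc'.1, h3⟩ h
    exact ⟨f, hf, h6 e h1 (by rw [inversive_comm, hc.2]) (by rw [inversive_comm, hc'.2]), h4, h5⟩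
  · obtain ⟨n, hn, -⟩ := (hP d hd).apex
    -- the neighbour across the old edge
    have key1 : ∃ f ∈ stackDual B B' γ F, inversive e f = -1 ∧ inversive a f = 0 ∧
        inversive a' f = 0 := by
      obtain ⟨d', hd', h1, h2, h3⟩ := H.face_adj d (hF hd) a he.1 a' he.2.1 he.2.2.1
      obtain ⟨f, hf, h4, h5, h6⟩ := exists_stackDual (F := F) (γ := γ) hd' ⟨he.1.1, h2⟩ ⟨he.2.1.1, h3⟩
        he.2.2.1
      refine ⟨f, hf, h6 e ?_ (by rw [inversive_comm, he.inv_left])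
        (by rw [inversive_comm, he.inv_right]), h4, h5⟩
      rw [inversive_comm, he.inv, inversive_comm d' d, h1, inversive_comm d', h2, inversive_comm d',
        h3]
      ring
    -- the neighbour across a new edge
    have key2 : ∀ a a' : OrientedCircle, IsChild B γ d a a' e → ∃ f ∈ stackDual B B' γ F,
        inversive e f = -1 ∧ inversive a f = 0 ∧ inversive n f = 0 := by
      intro a a' he
      have : ∃ b ∈ face B d, a' ≠ b ∧ inversive a b = -1 := by
        obtain ⟨b, hb, b', hb', hne, h1, h2⟩ := (hP d hd).neighbors a he.1
        by_cases h : a' = b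
        · exact ⟨b', hb', by rwa [h], h2⟩
        · exact ⟨b, hb, h, h1⟩
      obtain ⟨b, hb, hne, hab⟩ := this
      obtain ⟨f, hf⟩ := exists_isChild (γ := γ) he.1 hb hab
      exact ⟨f, Or.inr ⟨d, hd, _, _, hf⟩, sibling_tangent (hP d hd) he hf hne, hf.inv_left,
        hf.inv_apex hn⟩
    intro c hc c' hc' h
    rw [H.face_stack_child hF hP hγ hd he hn] at hc hc'
    have hsw : ∀ {x y : OrientedCircle}, (∃ f ∈ stackDual B B' γ F, inversive e f = -1 ∧
        inversive x f = 0 ∧ inversive y f = 0) → ∃ f ∈ stackDual B B' γ F, inversive e f = -1 ∧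
        inversive y f = 0 ∧ inversive x f = 0 := by
      rintro x y ⟨f, hf, h1, h2, h3⟩
      exact ⟨f, hf, h1, h3, h2⟩
    rcases hc with rfl | rfl | rfl <;> rcases hc' with rfl | rfl | rfl
    · exact absurd rfl (FlagTiling.ne_of_inversive h)
    · exact key1
    · exact key2 _ _ he
    · exact hsw key1
    · exact absurd rfl (FlagTiling.ne_of_inversive h)
    · exact key2 _ _ he.symm
    · exact hsw (key2 _ _ he)
    · exact hsw (key2 _ _ he.symm)
    · exact absurd rfl (FlagTiling.ne_of_inversive h)

/-- Each face has only one apex, and its positive product with the dual circle of the face keeps the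
two centres within distance two. The centres of the subdivided faces are locally finite. -/
theorem stack_finite (R : ℝ) : {c ∈ stackBase B γ F | ‖c.center‖ ≤ R}.Finite := by
  have h1 : {c | ∃ d ∈ {d ∈ B' | ‖d.center‖ ≤ R + 2}, d ∈ F ∧ IsApex B γ d c}.Finite := by
    have : {c | ∃ d ∈ {d ∈ B' | ‖d.center‖ ≤ R + 2}, d ∈ F ∧ IsApex B γ d c} =
        ⋃ d ∈ {d ∈ B' | ‖d.center‖ ≤ R + 2}, {c | d ∈ F ∧ IsApex B γ d c} := by
      ext; simp; tauto
    rw [this]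
    refine (H.finite' (R + 2)).biUnion fun d _ => Set.Subsingleton.finite ?_
    rintro a ⟨hd, ha⟩ b ⟨-, hb⟩
    obtain ⟨n, -, hn⟩ := (hP d hd).apex
    rw [hn a ha, hn b hb]
  refine ((H.finite R).union h1).subset ?_
  rintro c ⟨hc | ⟨d, hd, hc⟩, hcR⟩
  · exact Or.inl ⟨hc, hcR⟩
  · refine Or.inr ⟨d, ⟨hF hd, ?_⟩, hd, hc⟩
    have h2 := dist_center_le (H.one_le_curv' d (hF hd))
      (H.lt_curv_apex hF hP hγ hd hc zero_le_one H.one_le_curv).le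
      (by rw [inversive_comm, hc.2]; linarith [hγ.1])
    have : d.center = c.center + (d.center - c.center) := by ring
    rw [this]
    exact (norm_add_le _ _).trans (by linarith)

omit hP in
theorem stack_finite' (R : ℝ) : {c ∈ stackDual B B' γ F | ‖c.center‖ ≤ R}.Finite := by
  have h1 : (⋃ d ∈ {d ∈ B' | ‖d.center‖ ≤ R + 2}, ⋃ c ∈ {c ∈ B | ‖c.center‖ ≤ R + 4},
      ⋃ c' ∈ {c ∈ B | ‖c.center‖ ≤ R + 4}, {e | IsChild B γ d c c' e}).Finite :=
    (H.finite' (R + 2)).biUnion fun d _ => (H.finite (R + 4)).biUnion fun c _ =>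
      (H.finite (R + 4)).biUnion fun c' _ => Set.Subsingleton.finite
        fun a ha b hb => ha.unique hb
  refine ((H.finite' R).union h1).subset ?_
  rintro e ⟨⟨he, -⟩ | ⟨d, hd, c, c', he⟩, heR⟩
  · exact Or.inl ⟨he, heR⟩
  · right
    have hdB := H.one_le_curv' d (hF hd)
    have h2 := dist_center_le hdB (H.curv_child hγ (hF hd) he)
      (by rw [inversive_comm, he.inv_parent]; norm_num)
    have hdR : ‖d.center‖ ≤ R + 2 := by
      have : d.center = e.center + (d.center - e.center) := by ring
      rw [this]
      exact (norm_add_le _ _).trans (by linarith)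
    have hcR : ∀ a ∈ face B d, ‖a.center‖ ≤ R + 4 := by
      intro a ha
      have h3 := dist_center_le (H.one_le_curv a ha.1) hdB ha.2.ge
      have : a.center = d.center + (a.center - d.center) := by ring
      rw [this]
      exact (norm_add_le _ _).trans (by linarith)
    simp only [mem_iUnion]
    exact ⟨d, ⟨hF hd, hdR⟩, c, ⟨he.1.1, hcR c he.1⟩, c', ⟨he.2.1.1, hcR c' he.2.1⟩, he⟩

theorem stack : Config (stackBase B γ F) (stackDual B B' γ F) where
  one_le_curv := by
    rintro c (hc | ⟨d, hd, hc⟩)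
    · exact H.one_le_curv c hc
    · exact (H.lt_curv_apex hF hP hγ hd hc zero_le_one H.one_le_curv).le
  one_le_curv' := by
    rintro e (⟨he, -⟩ | ⟨d, hd, c, c', he⟩)
    · exact H.one_le_curv' e he
    · exact H.curv_child hγ (hF hd) he
  inv_le := H.stack_inv_le hF hP hγ
  inv_le' d hd d' hd' h := (H.stack_dual_le hF hP hγ d hd d' hd' h).1
  inv_dual := H.stack_inv_dual hF hP hγ
  infinite := H.infinite.mono fun c hc => Or.inl hc
  finite := H.stack_finite hF hP hγ
  finite' := H.stack_finite' hF hγ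
  edge_face := H.stack_edge_face hF hP hγ
  face_adj := H.stack_face_adj hF hP hγ
  edge' d hd d' hd' h := (H.stack_dual_le hF hP hγ d hd d' hd' (FlagTiling.ne_of_inversive h)).2 h

end stack

end Config

/-! ### Triangular and square faces -/

namespace OrientedCircle

/-- The face `d` is a triangle: three mutually tangent circles of `B` are orthogonal to `d`. -/
def IsTriangle (B : Set OrientedCircle) (d : OrientedCircle) : Prop :=
  ∃ c₁ c₂ c₃, face B d = {c₁, c₂, c₃} ∧ inversive c₁ c₂ = -1 ∧ inversive c₂ c₃ = -1 ∧
    inversive c₁ c₃ = -1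

/-- The face `d` is a square: four circles of equal radius around `d`. -/
def IsSquare (B : Set OrientedCircle) (d : OrientedCircle) : Prop :=
  ∃ c₁ c₂ c₃ c₄, face B d = {c₁, c₂, c₃, c₄} ∧ inversive c₁ c₂ = -1 ∧ inversive c₂ c₃ = -1 ∧
    inversive c₃ c₄ = -1 ∧ inversive c₁ c₄ = -1 ∧ inversive c₁ c₃ = -3 ∧ inversive c₂ c₄ = -3

variable {B : Set OrientedCircle} {d n : OrientedCircle}

theorem IsApex.vec_eq {c₁ c₂ c₃ : OrientedCircle} (hn : IsApex B 1 d n) (h₁ : c₁ ∈ face B d)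
    (h₂ : c₂ ∈ face B d) (h₃ : c₃ ∈ face B d) (h₁₂ : inversive c₁ c₂ = -1)
    (h₂₃ : inversive c₂ c₃ = -1) (h₁₃ : inversive c₁ c₃ = -1) :
    n.vec = c₁.vec + c₂.vec + c₃.vec + (2 : ℝ) • d.vec := by
  have e₁ := hn.1 c₁ h₁
  have e₂ := hn.1 c₂ h₂
  have e₃ := hn.1 c₃ h₃
  have e := hn.2
  rw [inversive_comm] at e₁ e₂ e₃ e
  refine eq_of_ip_eq h₁₂ h₂₃ h₁₃.le h₁.2 h₂.2 h₃.2 ?_ ?_ ?_ ?_ <;>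
  simp only [map_add, _root_.map_smul, smul_eq_mul, ip_vec, inversive_self, e₁, e₂, e₃, e, h₁.2,
    h₂.2, h₃.2, h₁₂, h₁₃, h₂₃, inversive_comm c₂ c₁, inversive_comm c₃ c₁, inversive_comm c₃ c₂,
    inversive_comm d c₁, inversive_comm d c₂, inversive_comm d c₃] <;> norm_num

/-- With all mutual products equal to `-1` the fan condition reads `-2 = -2`. The apex vector has
weights `1, 1, 1` on the circles and `2` on `d`, and `bound` follows because `3 * m ≤ m` for `m ≤
0`. -/
theorem IsTriangle.polyFace (h : IsTriangle B d) : PolyFace B 1 d := by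
  obtain ⟨c₁, c₂, c₃, hf, h₁₂, h₂₃, h₁₃⟩ := h
  have h₁ : c₁ ∈ face B d := by simp [hf]
  have h₂ : c₂ ∈ face B d := by simp [hf]
  have h₃ : c₃ ∈ face B d := by simp [hf]
  have h₂₁ := inversive_comm c₂ c₁ ▸ h₁₂
  have h₃₁ := inversive_comm c₃ c₁ ▸ h₁₃
  have h₃₂ := inversive_comm c₃ c₂ ▸ h₂₃
  have ne₁₂ := FlagTiling.ne_of_inversive h₁₂
  have ne₁₃ := FlagTiling.ne_of_inversive h₁₃
  have ne₂₃ := FlagTiling.ne_of_inversive h₂₃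
  have hv : ∀ n, IsApex B 1 d n → n.vec = c₁.vec + c₂.vec + c₃.vec + (2 : ℝ) • d.vec := fun n hn =>
    hn.vec_eq h₁ h₂ h₃ h₁₂ h₂₃ h₁₃
  constructor
  · intro c hc
    rw [hf] at hc
    rcases hc with rfl | rfl | rfl
    · exact ⟨_, h₂, _, h₃, ne₂₃, h₁₂, h₁₃⟩
    · exact ⟨_, h₁, _, h₃, ne₁₃, h₂₁, h₂₃⟩
    · exact ⟨_, h₁, _, h₂, ne₁₂, h₃₁, h₃₂⟩
  · intro c _ c' hc' c'' hc'' _ _ hne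
    rw [hf] at hc' hc''
    rcases hc' with rfl | rfl | rfl <;> rcases hc'' with rfl | rfl | rfl <;>
      first
      | exact absurd rfl hne
      | (simp only [h₁₂, h₁₃, h₂₃, h₂₁, h₃₁, h₃₂]; norm_num)
  · refine ⟨ofVec (c₁.vec + c₂.vec + c₃.vec + (2 : ℝ) • d.vec) ?_, ⟨?_, ?_⟩, fun n hn =>
      vec_injective (hv n hn)⟩
    · simp only [map_add, _root_.map_smul, smul_eq_mul, ip_vec, LinearMap.add_apply,
        LinearMap.smul_apply, inversive_self, h₁.2, h₂.2, h₃.2, h₁₂, h₁₃, h₂₃, h₂₁, h₃₁, h₃₂,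
        inversive_comm d c₁, inversive_comm d c₂, inversive_comm d c₃]
      norm_num
    · intro c hc
      rw [hf] at hc
      rw [inversive_comm, ← ip_vec, vec_ofVec]
      rcases hc with rfl | rfl | rfl <;>
      · simp only [map_add, _root_.map_smul, smul_eq_mul, ip_vec, inversive_self, h₁.2, h₂.2, h₃.2,
          h₁₂, h₁₃, h₂₃, h₂₁, h₃₁, h₃₂]
        norm_num
    · rw [inversive_comm, ← ip_vec, vec_ofVec]
      simp only [map_add, _root_.map_smul, smul_eq_mul, ip_vec, inversive_self, h₁.2, h₂.2, h₃.2,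
        inversive_comm d c₁, inversive_comm d c₂, inversive_comm d c₃]
      norm_num
  · intro n hn w m hm hw hd
    rw [hv n hn]
    simp only [map_add, _root_.map_smul, LinearMap.add_apply, LinearMap.smul_apply, smul_eq_mul]
    linarith [hw c₁ h₁, hw c₂ h₂, hw c₃ h₃]

/-- Two neighbours of a vertex are opposite, with product `-3`, so the fan condition reads `γ ^ 2 *
(-4) = -2`. The apex vector is half the sum of one opposite pair plus `2 * γ` times `d`; the total
weight one on the circles gives `bound`. -/
theorem IsSquare.polyFace (h : IsSquare B d) {γ : ℝ} (hγ : γ ^ 2 = 1 / 2) :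
    PolyFace B γ d := by
  obtain ⟨c₁, c₂, c₃, c₄, hf, h₁₂, h₂₃, h₃₄, h₁₄, h₁₃, h₂₄⟩ := h
  have h₁ : c₁ ∈ face B d := by simp [hf]
  have h₂ : c₂ ∈ face B d := by simp [hf]
  have h₃ : c₃ ∈ face B d := by simp [hf]
  have h₄ : c₄ ∈ face B d := by simp [hf]
  have h₂₁ := inversive_comm c₂ c₁ ▸ h₁₂
  have h₃₁ := inversive_comm c₃ c₁ ▸ h₁₃
  have h₃₂ := inversive_comm c₃ c₂ ▸ h₂₃
  have h₄₁ := inversive_comm c₄ c₁ ▸ h₁₄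
  have h₄₂ := inversive_comm c₄ c₂ ▸ h₂₄
  have h₄₃ := inversive_comm c₄ c₃ ▸ h₃₄
  have ne₁₃ : c₁ ≠ c₃ := by rintro rfl; rw [inversive_self] at h₁₃; norm_num at h₁₃
  have ne₂₄ : c₂ ≠ c₄ := by rintro rfl; rw [inversive_self] at h₂₄; norm_num at h₂₄
  have hv : ∀ n, IsApex B γ d n →
      n.vec = (1 / 2 : ℝ) • (c₁.vec + c₃.vec) + (2 * γ) • d.vec := by
    intro n hn
    have e₁ := hn.1 c₁ h₁
    have e₂ := hn.1 c₂ h₂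
    have e₃ := hn.1 c₃ h₃
    have e := hn.2
    rw [inversive_comm] at e₁ e₂ e₃ e
    refine eq_of_ip_eq h₁₂ h₂₃ (h₁₃.le.trans (by norm_num)) h₁.2 h₂.2 h₃.2 ?_ ?_ ?_ ?_ <;>
    simp only [map_add, _root_.map_smul, smul_eq_mul, ip_vec, inversive_self, e₁, e₂, e₃, e, h₁.2,
      h₂.2, h₃.2, h₁₂, h₁₃, h₂₃, h₂₁, h₃₁, h₃₂,
      inversive_comm d c₁, inversive_comm d c₂, inversive_comm d c₃] <;> norm_num
  constructor
  · intro c hc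
    rw [hf] at hc
    rcases hc with rfl | rfl | rfl | rfl
    · exact ⟨_, h₂, _, h₄, ne₂₄, h₁₂, h₁₄⟩
    · exact ⟨_, h₁, _, h₃, ne₁₃, h₂₁, h₂₃⟩
    · exact ⟨_, h₂, _, h₄, ne₂₄, h₃₂, h₃₄⟩
    · exact ⟨_, h₁, _, h₃, ne₁₃, h₄₁, h₄₃⟩
  · intro c hc c' hc' c'' hc'' e e' hne
    rw [hf] at hc hc' hc''
    rw [hγ]
    rcases hc with rfl | rfl | rfl | rfl <;> rcases hc' with rfl | rfl | rfl | rfl <;>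
      rcases hc'' with rfl | rfl | rfl | rfl <;>
      simp only [inversive_self, h₁₂, h₂₃, h₃₄, h₁₄, h₁₃, h₂₄, h₂₁, h₃₁, h₃₂, h₄₁, h₄₂, h₄₃] at e e' ⊢ <;>
      first
      | exact absurd rfl hne
      | (norm_num; done)
      | (norm_num at e; done)
      | (norm_num at e'; done)
  · refine ⟨ofVec ((1 / 2 : ℝ) • (c₁.vec + c₃.vec) + (2 * γ) • d.vec) ?_, ⟨?_, ?_⟩, fun n hn =>
      vec_injective (hv n hn)⟩
    · simp only [map_add, _root_.map_smul, smul_eq_mul, ip_vec, LinearMap.add_apply,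
        LinearMap.smul_apply, inversive_self, h₁.2, h₃.2, h₁₃, h₃₁,
        inversive_comm d c₁, inversive_comm d c₃]
      linear_combination 4 * hγ
    · intro c hc
      rw [hf] at hc
      rw [inversive_comm, ← ip_vec, vec_ofVec]
      rcases hc with rfl | rfl | rfl | rfl <;>
      · simp only [map_add, _root_.map_smul, smul_eq_mul, ip_vec, inversive_self, h₁.2, h₂.2, h₃.2,
          h₄.2, h₁₃, h₃₁, h₂₁, h₂₃, h₄₁, h₄₃]
        norm_num
    · rw [inversive_comm, ← ip_vec, vec_ofVec]
      simp only [map_add, _root_.map_smul, smul_eq_mul, ip_vec, inversive_self, h₁.2, h₃.2,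
        inversive_comm d c₁, inversive_comm d c₃]
      norm_num
  · intro n hn w m hm hw hd
    rw [hv n hn]
    simp only [map_add, _root_.map_smul, LinearMap.add_apply, LinearMap.smul_apply, smul_eq_mul]
    linarith [hw c₁ h₁, hw c₃ h₃]

/-! ### Subdividing triangles of centres -/

/-- The point `z` lies in the triangle `a b c`. -/
def InTriangle (a b c z : ℂ) : Prop :=
  ∃ α β γ : ℝ, 0 ≤ α ∧ 0 ≤ β ∧ 0 ≤ γ ∧ α + β + γ = 1 ∧ z = α * a + β * b + γ * c

/-- Solving the expression of `q` for `c` gives the barycentric coordinates of `z` in the triangle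
`a b q`; the two inequalities say that those at `a` and `b` are nonnegative. -/
theorem InTriangle.of_le {a b c q z : ℂ} {x y w α β γ : ℝ} (hw : 0 < w)
    (hs : x + y + w = 1) (hq : q = x * a + y * b + w * c)
    (hg : 0 ≤ γ) (hs' : α + β + γ = 1) (hz : z = α * a + β * b + γ * c)
    (h1 : γ * x ≤ α * w) (h2 : γ * y ≤ β * w) : InTriangle a b q z := by
  have hw' := hw.ne'
  refine ⟨(α * w - γ * x) / w, (β * w - γ * y) / w, γ / w, div_nonneg (sub_nonneg.2 h1) hw.le,
    div_nonneg (sub_nonneg.2 h2) hw.le, div_nonneg hg hw.le, ?_, ?_⟩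
  · field_simp
    linear_combination w * hs' - γ * hs
  · rw [hz, hq]
    have : (w : ℂ) ≠ 0 := Complex.ofReal_ne_zero.2 hw'
    push_cast
    field_simp
    ring

/-- An interior point of a triangle divides it into three triangles. -/
theorem InTriangle.split {a b c q z : ℂ} {x y w : ℝ} (hx : 0 < x) (hy : 0 < y) (hw : 0 < w)
    (hs : x + y + w = 1) (hq : q = x * a + y * b + w * c) (h : InTriangle a b c z) :
    InTriangle a b q z ∨ InTriangle b c q z ∨ InTriangle c a q z := by
  obtain ⟨α, β, γ, ha, hb, hg, hs', hz⟩ := h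
  have key1 : γ * x ≤ α * w → γ * y ≤ β * w → InTriangle a b q z :=
    fun h1 h2 => InTriangle.of_le hw hs hq hg hs' hz h1 h2
  have key2 : α * y ≤ β * x → α * w ≤ γ * x → InTriangle b c q z :=
    fun h1 h2 => InTriangle.of_le (a := b) (b := c) (c := a) hx (x := y) (y := w) (by linarith) (by rw [hq]; ring) ha
      (α := β) (β := γ) (by linarith) (by rw [hz]; ring) h1 h2
  have key3 : β * w ≤ γ * y → β * x ≤ α * y → InTriangle c a q z :=
    fun h1 h2 => InTriangle.of_le (a := c) (b := a) (c := b) hy (x := w) (y := x) (by linarith) (by rw [hq]; ring) hb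
      (α := γ) (β := α) (by linarith) (by rw [hz]; ring) h1 h2
  -- The smallest of the ratios `α / x`, `β / y`, `γ / w` decides in which of the three triangles
  -- the point lies.
  rcases le_total (γ * x) (α * w) with h1 | h1
  · rcases le_total (γ * y) (β * w) with h2 | h2
    · exact Or.inl (key1 h1 h2)
    · refine Or.inr (Or.inr (key3 h2 ?_))
      have h3 : β * w * x ≤ γ * y * x := mul_le_mul_of_nonneg_right h2 hx.le
      have h4 : γ * x * y ≤ α * w * y := mul_le_mul_of_nonneg_right h1 hy.le
      exact le_of_mul_le_mul_right (by linarith) hw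
  · rcases le_total (α * y) (β * x) with h2 | h2
    · exact Or.inr (Or.inl (key2 h2 h1))
    · refine Or.inr (Or.inr (key3 ?_ h2))
      have h3 : β * x * w ≤ α * y * w := mul_le_mul_of_nonneg_right h2 hw.le
      have h4 : α * w * y ≤ γ * x * y := mul_le_mul_of_nonneg_right h1 hy.le
      exact le_of_mul_le_mul_right (by linarith) hx

theorem curv_mul_center {c : OrientedCircle} (hc : 0 < c.curv) : (c.curv : ℂ) * c.center = c.h := by
  have : (c.curv : ℂ) ≠ 0 := Complex.ofReal_ne_zero.2 hc.ne'
  rw [center]; field_simp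

/-- The centre of the inscribed circle lies inside the triangle of centres. -/
theorem exists_center_comb {c₁ c₂ c₃ : OrientedCircle} (p₁ : 0 < c₁.curv) (p₂ : 0 < c₂.curv)
    (p₃ : 0 < c₃.curv) (p : 0 < d.curv) (h₁ : inversive c₁ d = 0)
    (h₂ : inversive c₂ d = 0) (h₃ : inversive c₃ d = 0) (h₁₂ : inversive c₁ c₂ = -1)
    (h₂₃ : inversive c₂ c₃ = -1) (h₁₃ : inversive c₁ c₃ = -1) :
    ∃ x y w : ℝ, 0 < x ∧ 0 < y ∧ 0 < w ∧ x + y + w = 1 ∧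
      d.center = x * c₁.center + y * c₂.center + w * c₃.center := by
  -- The vector `(1, 0, 0)` has neither a curvature nor a centre component, so these two components
  -- of the identity express the centre of `d` as a convex combination with the displayed weights.
  have hv : (c₂.curv + c₃.curv) • c₁.vec + (c₁.curv + c₃.curv) • c₂.vec +
      (c₁.curv + c₂.curv) • c₃.vec = (2 * d.curv) • d.vec + (4 : ℝ) • (1, 0, 0) := by
    refine eq_of_ip_eq h₁₂ h₂₃ h₁₃.le h₁ h₂ h₃ ?_ ?_ ?_ ?_ <;>
    simp only [map_add, _root_.map_smul, smul_eq_mul, ip_vec, ip_infty, inversive_self, h₁, h₂, h₃,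
      h₁₂, h₁₃, h₂₃, inversive_comm c₂ c₁, inversive_comm c₃ c₁, inversive_comm c₃ c₂,
      inversive_comm d c₁, inversive_comm d c₂, inversive_comm d c₃] <;> ring
  have e1 := congrArg (fun v => v.2.1) hv
  have e2 := congrArg (fun v => v.2.2) hv
  simp only [vec, Prod.snd_add, Prod.fst_add, Prod.smul_snd, Prod.smul_fst, smul_eq_mul, mul_zero,
    add_zero, smul_zero, Complex.real_smul] at e1 e2
  rw [← curv_mul_center p₁, ← curv_mul_center p₂, ← curv_mul_center p₃, ← curv_mul_center p] at e2
  have hd : (d.curv : ℂ) ≠ 0 := Complex.ofReal_ne_zero.2 p.ne'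
  refine ⟨(c₂.curv + c₃.curv) * c₁.curv / (2 * d.curv ^ 2),
    (c₁.curv + c₃.curv) * c₂.curv / (2 * d.curv ^ 2),
    (c₁.curv + c₂.curv) * c₃.curv / (2 * d.curv ^ 2), by positivity, by positivity, by positivity,
    ?_, ?_⟩
  · field_simp; linear_combination e1
  · push_cast at e2 ⊢
    field_simp; linear_combination -e2

theorem contact_comb {c₁ c₂ : OrientedCircle} (p₁ : 0 < c₁.curv) (p₂ : 0 < c₂.curv) :
    contact c₁ c₂ = (c₁.curv / (c₁.curv + c₂.curv) : ℝ) * c₁.center +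
      (c₂.curv / (c₁.curv + c₂.curv) : ℝ) * c₂.center := by
  rw [contact, ← curv_mul_center p₁, ← curv_mul_center p₂]
  push_cast
  ring

/-- The centre of the apex lies inside the triangle of centres. -/
theorem exists_apex_comb {c₁ c₂ c₃ : OrientedCircle} (p₁ : 0 < c₁.curv) (p₂ : 0 < c₂.curv)
    (p₃ : 0 < c₃.curv) (p : 0 < d.curv) (h₁ : c₁ ∈ face B d) (h₂ : c₂ ∈ face B d)
    (h₃ : c₃ ∈ face B d) (h₁₂ : inversive c₁ c₂ = -1)
    (h₂₃ : inversive c₂ c₃ = -1) (h₁₃ : inversive c₁ c₃ = -1) (hn : IsApex B 1 d n) :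
    ∃ x y w : ℝ, 0 < x ∧ 0 < y ∧ 0 < w ∧ x + y + w = 1 ∧
      n.center = x * c₁.center + y * c₂.center + w * c₃.center := by
  obtain ⟨x, y, w, hx, hy, hw, hs, hq⟩ :=
    exists_center_comb p₁ p₂ p₃ p h₁.2 h₂.2 h₃.2 h₁₂ h₂₃ h₁₃
  have hv := hn.vec_eq h₁ h₂ h₃ h₁₂ h₂₃ h₁₃
  have e1 := congrArg (fun v => v.2.1) hv
  have e2 := congrArg (fun v => v.2.2) hv
  simp only [vec, Prod.snd_add, Prod.fst_add, Prod.smul_snd, Prod.smul_fst, smul_eq_mul,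
    Complex.real_smul] at e1 e2
  have pn : 0 < n.curv := by rw [e1]; positivity
  rw [← curv_mul_center p₁, ← curv_mul_center p₂, ← curv_mul_center p₃, ← curv_mul_center p,
    ← curv_mul_center pn] at e2
  have hd : (n.curv : ℂ) ≠ 0 := Complex.ofReal_ne_zero.2 pn.ne'
  refine ⟨(c₁.curv + 2 * d.curv * x) / n.curv, (c₂.curv + 2 * d.curv * y) / n.curv,
    (c₃.curv + 2 * d.curv * w) / n.curv, by positivity, by positivity, by positivity, ?_, ?_⟩
  · field_simp; linear_combination 2 * d.curv * hs - e1
  · rw [hq] at e2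
    push_cast at e2 ⊢
    field_simp; linear_combination e2

end OrientedCircle

/-! ### Coverings of the plane by triangular faces -/

open OrientedCircle

/-- The triangles of centres of the triangular faces cover the plane. -/
def TriangleCover (B B' : Set OrientedCircle) : Prop :=
  ∀ z : ℂ, ∃ d ∈ B', ∃ c₁ ∈ face B d, ∃ c₂ ∈ face B d, ∃ c₃ ∈ face B d, inversive c₁ c₂ = -1 ∧
    inversive c₂ c₃ = -1 ∧ inversive c₁ c₃ = -1 ∧ InTriangle c₁.center c₂.center c₃.center z

namespace Config

variable {B B' F : Set OrientedCircle} {γ : ℝ}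

theorem pos (H : Config B B') {c : OrientedCircle} (hc : c ∈ B) : 0 < c.curv :=
  one_pos.trans_le (H.one_le_curv c hc)

theorem pos' (H : Config B B') {d : OrientedCircle} (hd : d ∈ B') : 0 < d.curv :=
  one_pos.trans_le (H.one_le_curv' d hd)

theorem admissible_one : Admissible 1 := ⟨one_pos, Or.inl (by norm_num)⟩

theorem stack_isTriangle (H : Config B B') (hF : F ⊆ B') (hP : ∀ d ∈ F, PolyFace B γ d)
    (hγ : Admissible γ) (hB : ∀ d ∈ B' \ F, IsTriangle B d) :
    ∀ d ∈ stackDual B B' γ F, IsTriangle (stackBase B γ F) d := by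
  rintro e (he | ⟨d, hd, c, c', he⟩)
  · obtain ⟨c₁, c₂, c₃, h, h'⟩ := hB e he
    exact ⟨c₁, c₂, c₃, by rw [H.face_stack_old hF hP hγ he.1 he.2, h], h'⟩
  · obtain ⟨n, hn, -⟩ := (hP d hd).apex
    exact ⟨c, c', n, H.face_stack_child hF hP hγ hd he hn, he.2.2.1,
      by rw [inversive_comm]; exact hn.1 c' he.2.1, by rw [inversive_comm]; exact hn.1 c he.1⟩

/-- The centre of the apex is an interior point of the triangle of centres, so it splits the
triangle into three, and these belong to the children. -/
theorem stack_triangleCover (H : Config B B') (hF : F ⊆ B') (hP : ∀ d ∈ F, PolyFace B 1 d)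
    (hT : TriangleCover B B') : TriangleCover (stackBase B 1 F) (stackDual B B' 1 F) := by
  intro z
  obtain ⟨d, hd, c₁, h₁, c₂, h₂, c₃, h₃, h₁₂, h₂₃, h₁₃, hz⟩ := hT z
  by_cases hdF : d ∈ F
  · obtain ⟨n, hn, -⟩ := (hP d hdF).apex
    obtain ⟨x, y, w, hx, hy, hw, hs, hq⟩ := exists_apex_comb (H.pos h₁.1) (H.pos h₂.1) (H.pos h₃.1)
      (H.pos' hd) h₁ h₂ h₃ h₁₂ h₂₃ h₁₃ hn
    have key : ∀ c ∈ face B d, ∀ c' ∈ face B d, inversive c c' = -1 →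
        InTriangle c.center c'.center n.center z → ∃ d ∈ stackDual B B' 1 F,
          ∃ c₁ ∈ face (stackBase B 1 F) d, ∃ c₂ ∈ face (stackBase B 1 F) d,
          ∃ c₃ ∈ face (stackBase B 1 F) d, inversive c₁ c₂ = -1 ∧ inversive c₂ c₃ = -1 ∧
            inversive c₁ c₃ = -1 ∧ InTriangle c₁.center c₂.center c₃.center z := by
      intro c hc c' hc' h ht
      obtain ⟨e, he⟩ := exists_isChild (γ := 1) hc hc' h
      have hf := H.face_stack_child hF hP admissible_one hdF he hn
      exact ⟨e, Or.inr ⟨d, hdF, c, c', he⟩, c, by simp [hf], c', by simp [hf], n, by simp [hf], h,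
        by rw [inversive_comm]; exact hn.1 c' hc', by rw [inversive_comm]; exact hn.1 c hc, ht⟩
    rcases hz.split hx hy hw hs hq with h | h | h
    · exact key c₁ h₁ c₂ h₂ h₁₂ h
    · exact key c₂ h₂ c₃ h₃ h₂₃ h
    · exact key c₃ h₃ c₁ h₁ (by rwa [inversive_comm]) h
  · rw [← H.face_stack_old hF hP admissible_one hd hdF] at h₁ h₂ h₃
    exact ⟨d, Or.inl ⟨hd, hdF⟩, c₁, h₁, c₂, h₂, c₃, h₃, h₁₂, h₂₃, h₁₃, hz⟩

/-- The dual circle of a triangular face is inscribed in the triangle of centres. The incentre and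
the points of contact divide the triangle into six right triangles, which are the required flags. -/
theorem flagTiling (H : Config B B') (hT : TriangleCover B B') : FlagTiling B B' where
  one_le_curv := H.one_le_curv
  one_le_curv' := H.one_le_curv'
  inv_le := H.inv_le
  inv_le' := H.inv_le'
  inv_dual := H.inv_dual
  infinite := H.infinite
  infinite' := by
    intro hfin
    obtain ⟨R, hR⟩ := (hfin.image fun d => ‖d.center‖).bddAbove
    -- If the dual centres were bounded by `|R|`, all vertices would lie within `|R| + 2` of the
    -- origin, and this point could not be covered.
    obtain ⟨d, hd, c₁, h₁, c₂, h₂, c₃, h₃, -, -, -, α, β, γ, ha, hb, hg, hs, hz⟩ :=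
      hT ((|R| + 3 : ℝ) : ℂ)
    have h4 : ‖d.center‖ ≤ |R| := (hR ⟨d, hd, rfl⟩).trans (le_abs_self R)
    have key : ∀ c ∈ face B d, ‖c.center‖ ≤ |R| + 2 := by
      intro c hc
      have h5 := dist_center_le (H.one_le_curv c hc.1) (H.one_le_curv' d hd) hc.2.ge
      have : c.center = d.center + (c.center - d.center) := by ring
      rw [this]
      exact (norm_add_le _ _).trans (by linarith)
    have h5 : ‖((|R| + 3 : ℝ) : ℂ)‖ ≤ α * ‖c₁.center‖ + β * ‖c₂.center‖ + γ * ‖c₃.center‖ := by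
      rw [hz]
      refine (norm_add₃_le).trans ?_
      rw [norm_mul, norm_mul, norm_mul, Complex.norm_real, Complex.norm_real, Complex.norm_real,
        Real.norm_of_nonneg ha, Real.norm_of_nonneg hb, Real.norm_of_nonneg hg]
    rw [Complex.norm_real, Real.norm_of_nonneg (by positivity)] at h5
    have h6 := mul_le_mul_of_nonneg_left (key c₁ h₁) ha
    have h7 := mul_le_mul_of_nonneg_left (key c₂ h₂) hb
    have h8 := mul_le_mul_of_nonneg_left (key c₃ h₃) hg
    have h9 : α * (|R| + 2) + β * (|R| + 2) + γ * (|R| + 2) = |R| + 2 := by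
      linear_combination (|R| + 2) * hs
    linarith
  finite := H.finite
  finite' := H.finite'
  edge c hc c' hc' h := by
    obtain ⟨d, hd, h1, h2⟩ := H.edge_face c hc c' hc' h
    obtain ⟨d', hd', h3, h4, h5⟩ := H.face_adj d hd c ⟨hc, h1⟩ c' ⟨hc', h2⟩ h
    exact ⟨d, hd, d', hd', h3, h1, h4, h2, h5⟩
  edge' := H.edge'
  cover z := by
    obtain ⟨d, hd, c₁, h₁, c₂, h₂, c₃, h₃, h₁₂, h₂₃, h₁₃, hz⟩ := hT z
    obtain ⟨x, y, w, hx, hy, hw, hs, hq⟩ := exists_center_comb (H.pos h₁.1) (H.pos h₂.1)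
      (H.pos h₃.1) (H.pos' hd) h₁.2 h₂.2 h₃.2 h₁₂ h₂₃ h₁₃
    have key : ∀ c ∈ face B d, ∀ c' ∈ face B d, inversive c c' = -1 →
        ∀ α β γ : ℝ, 0 ≤ α → 0 ≤ β → 0 ≤ γ → α + β + γ = 1 →
        z = α * c.center + β * c'.center + γ * d.center →
        β * c.curv ≤ α * c'.curv → ∃ c ∈ B, ∃ c' ∈ B, ∃ d ∈ B', ∃ d' ∈ B', inversive c c' = -1 ∧
          inversive d d' = -1 ∧ (inversive c d = 0 ∧ inversive c d' = 0 ∧ inversive c' d = 0 ∧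
          inversive c' d' = 0) ∧ ∃ α β γ : ℝ, 0 ≤ α ∧ 0 ≤ β ∧ 0 ≤ γ ∧ α + β + γ = 1 ∧
          z = α * c.center + β * contact c c' + γ * d.center := by
      intro c hc c' hc' h α β γ ha hb hg hs hz hle
      obtain ⟨d', hd', h3, h4, h5⟩ := H.face_adj d hd c hc c' hc' h
      have p := H.pos hc.1
      have p' := H.pos hc'.1
      have e : ((c.curv : ℂ) + c'.curv) ≠ 0 := by
        rw [← Complex.ofReal_add]; exact Complex.ofReal_ne_zero.2 (by positivity)
      have e' : (c'.curv : ℂ) ≠ 0 := Complex.ofReal_ne_zero.2 p'.ne'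
      -- The contact point is the curvature-weighted mean of the two centres. Eliminating the centre
      -- of `c'` gives these weights, and `hle` makes the first one nonnegative.
      refine ⟨c, hc.1, c', hc'.1, d, hd, d', hd', h, h3, ⟨hc.2, h4, hc'.2, h5⟩,
        (α * c'.curv - β * c.curv) / c'.curv, β * (c.curv + c'.curv) / c'.curv, γ,
        div_nonneg (sub_nonneg.2 hle) p'.le, by positivity, hg, ?_, ?_⟩
      · field_simp; linear_combination c'.curv * hs
      · rw [hz, contact_comb p p']
        push_cast
        field_simp
        ring
    have hsplit : ∃ c ∈ face B d, ∃ c' ∈ face B d, inversive c c' = -1 ∧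
        InTriangle c.center c'.center d.center z := by
      rcases hz.split hx hy hw hs hq with h | h | h
      · exact ⟨c₁, h₁, c₂, h₂, h₁₂, h⟩
      · exact ⟨c₂, h₂, c₃, h₃, h₂₃, h⟩
      · exact ⟨c₃, h₃, c₁, h₁, by rwa [inversive_comm], h⟩
    obtain ⟨c, hc, c', hc', h, α, β, γ, ha, hb, hg, hs, hz⟩ := hsplit
    rcases le_total (β * c.curv) (α * c'.curv) with hle | hle
    · exact key c hc c' hc' h α β γ ha hb hg hs hz hle
    · exact key c' hc' c hc (by rwa [inversive_comm]) β α γ hb ha hg (by linarith)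
        (by rw [hz]; ring) hle

end Config

/-! ### Isometries acting on oriented circles -/

/-- The linear part of an isometry of the plane. -/
noncomputable def linPart (k : ℂ ≃ᵢ ℂ) : ℂ ≃ₗᵢ[ℝ] ℂ :=
  k.toRealAffineIsometryEquiv.linearIsometryEquiv

theorem isometry_sub (k : ℂ ≃ᵢ ℂ) (z w : ℂ) : k z - k w = linPart k (z - w) :=
  (k.toRealAffineIsometryEquiv.map_vsub z w).symm

theorem isometry_apply (k : ℂ ≃ᵢ ℂ) (z : ℂ) : k z = linPart k z + k 0 := by
  have := isometry_sub k z 0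
  rw [sub_zero] at this
  rw [← this]; ring

theorem linPart_mul (k k' : ℂ ≃ᵢ ℂ) (z : ℂ) : linPart (k * k') z = linPart k (linPart k' z) := by
  have h := isometry_sub (k * k') z 0
  have h' := isometry_sub k' z 0
  rw [sub_zero] at h h'
  rw [← h, ← h', IsometryEquiv.mul_apply, IsometryEquiv.mul_apply, isometry_sub]

theorem linPart_one (z : ℂ) : linPart 1 z = z := by
  have h := isometry_sub 1 z 0
  simpa using h.symm

theorem inner_eq (z w : ℂ) : inner ℝ z w = z.re * w.re + z.im * w.im := by
  rw [Complex.inner]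
  simp
  ring

namespace OrientedCircle

/-- The linear action of an isometry of the plane on inversive coordinates. -/
noncomputable def actVec (k : ℂ ≃ᵢ ℂ) : (ℝ × ℝ × ℂ) →ₗ[ℝ] (ℝ × ℝ × ℂ) where
  toFun v := (v.1 + 2 * inner ℝ (linPart k v.2.2) (k 0) + v.2.1 * ‖k 0‖ ^ 2, v.2.1,
    linPart k v.2.2 + v.2.1 • k 0)
  map_add' v w := by
    simp only [Prod.fst_add, Prod.snd_add, map_add, inner_add_left, add_smul, Prod.mk_add_mk]
    ext <;> simp <;> ring
  map_smul' r v := by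
    simp only [Prod.smul_fst, Prod.smul_snd, _root_.map_smul, inner_smul_left, smul_eq_mul,
      RingHom.id_apply, Prod.smul_mk, conj_trivial, smul_add, mul_smul]
    ext <;> simp <;> ring

theorem ip_actVec (k : ℂ ≃ᵢ ℂ) (v w : ℝ × ℝ × ℂ) : ip (actVec k v) (actVec k w) = ip v w := by
  simp only [ip_apply, actVec, LinearMap.coe_mk, AddHom.coe_mk]
  rw [← inner_eq, ← inner_eq, ← (linPart k).inner_map_map v.2.2 w.2.2]
  simp only [inner_add_left, inner_add_right, inner_smul_left, inner_smul_right, conj_trivial,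
    real_inner_self_eq_norm_sq, real_inner_comm (k 0)]
  rw [real_inner_comm (linPart k w.2.2) (k 0)]
  ring

noncomputable instance : MulAction (ℂ ≃ᵢ ℂ) OrientedCircle where
  smul k c := ofVec (actVec k c.vec) (by rw [ip_actVec, ip_vec, inversive_self])
  one_smul c := by
    refine vec_injective ?_
    change actVec 1 c.vec = c.vec
    simp [actVec, linPart_one]
  mul_smul k k' c := by
    refine vec_injective ?_
    change actVec (k * k') c.vec = actVec k (actVec k' c.vec)
    have h : (k * k') 0 = linPart k (k' 0) + k 0 := by
      rw [IsometryEquiv.mul_apply, isometry_apply]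
    simp only [actVec, LinearMap.coe_mk, AddHom.coe_mk, h, linPart_mul, map_add, _root_.map_smul]
    refine Prod.ext ?_ (Prod.ext rfl ?_)
    · simp only [inner_add_left, inner_add_right, inner_smul_left, LinearIsometryEquiv.inner_map_map,
        norm_add_sq_real, LinearIsometryEquiv.norm_map, conj_trivial]
      ring
    · simp only [smul_add]
      ring

theorem vec_smul (k : ℂ ≃ᵢ ℂ) (c : OrientedCircle) : (k • c).vec = actVec k c.vec := rfl

theorem curv_smul (k : ℂ ≃ᵢ ℂ) (c : OrientedCircle) : (k • c).curv = c.curv := rfl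

theorem inversive_smul (k : ℂ ≃ᵢ ℂ) (c d : OrientedCircle) :
    inversive (k • c) (k • d) = inversive c d := by
  rw [← ip_vec, vec_smul, vec_smul, ip_actVec, ip_vec]

theorem center_smul (k : ℂ ≃ᵢ ℂ) {c : OrientedCircle} (hc : 0 < c.curv) :
    (k • c).center = k c.center := by
  have h : (k • c).h = linPart k c.h + c.curv • k 0 := rfl
  have hc' : (c.curv : ℂ) ≠ 0 := Complex.ofReal_ne_zero.2 hc.ne'
  rw [center, curv_smul, h, isometry_apply k c.center, center, div_eq_inv_mul c.h,
    ← Complex.ofReal_inv, ← Complex.real_smul, _root_.map_smul, Complex.real_smul, Complex.real_smul]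
  push_cast
  field_simp

theorem ext_center {c d : OrientedCircle} (hc : 0 < c.curv) (h : c.curv = d.curv)
    (h' : c.center = d.center) : c = d := by
  have hd : 0 < d.curv := h ▸ hc
  have h1 : c.h = d.h := by rw [← curv_mul_center hc, ← curv_mul_center hd, h, h']
  refine OrientedCircle.ext ?_ h h1
  have e1 := c.normalized
  have e2 := d.normalized
  rw [h, h1] at e1
  exact mul_left_cancel₀ hd.ne' (by linarith)

theorem curv_ofCenter (z : ℂ) (r : ℝ) (hr : 0 < r) : (ofCenter z r hr).curv = 1 / r := rfl

theorem center_ofCenter (z : ℂ) (r : ℝ) (hr : 0 < r) : (ofCenter z r hr).center = z := by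
  have := hr.ne'
  refine Complex.ext ?_ ?_
  · rw [center_re]; simp only [ofCenter]; field_simp
  · rw [center_im]; simp only [ofCenter]; field_simp

theorem smul_ofCenter (k : ℂ ≃ᵢ ℂ) (z : ℂ) (r : ℝ) (hr : 0 < r) :
    k • ofCenter z r hr = ofCenter (k z) r hr := by
  have h : 0 < (ofCenter z r hr).curv := by rw [curv_ofCenter]; positivity
  refine ext_center h rfl ?_
  rw [center_smul k h, center_ofCenter, center_ofCenter]

variable {B B' F : Set OrientedCircle} {γ : ℝ} {k : ℂ ≃ᵢ ℂ} {d n : OrientedCircle}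

theorem mem_of_stabilizer (hk : k ∈ MulAction.stabilizer (ℂ ≃ᵢ ℂ) B) (c : OrientedCircle) :
    k • c ∈ B ↔ c ∈ B :=
  MulAction.mem_stabilizer_set.1 hk c

theorem mem_face_smul (hk : k ∈ MulAction.stabilizer (ℂ ≃ᵢ ℂ) B) (c d : OrientedCircle) :
    k • c ∈ face B (k • d) ↔ c ∈ face B d := by
  simp only [face, mem_ofPred_eq, mem_of_stabilizer hk, inversive_smul]

theorem IsApex.smul (hk : k ∈ MulAction.stabilizer (ℂ ≃ᵢ ℂ) B) (hn : IsApex B γ d n) :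
    IsApex B γ (k • d) (k • n) := by
  refine ⟨fun c hc => ?_, by rw [inversive_smul, hn.2]⟩
  have h := hn.1 (k⁻¹ • c) (by rwa [← mem_face_smul hk, smul_inv_smul])
  rwa [← inversive_smul k, smul_inv_smul] at h

theorem IsChild.smul (hk : k ∈ MulAction.stabilizer (ℂ ≃ᵢ ℂ) B) {c c' e : OrientedCircle}
    (he : IsChild B γ d c c' e) : IsChild B γ (k • d) (k • c) (k • c') (k • e) := by
  refine ⟨(mem_face_smul hk c d).2 he.1, (mem_face_smul hk c' d).2 he.2.1,
    by rw [inversive_smul, he.2.2.1], ?_⟩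
  simp only [vec_smul, he.2.2.2, map_add, _root_.map_smul]

/-- For a group one inclusion suffices, since the inverse elements provide the other one. -/
theorem mem_stabilizer_of_subgroup {H : Subgroup (ℂ ≃ᵢ ℂ)} {S : Set OrientedCircle}
    (h : ∀ k ∈ H, ∀ c ∈ S, k • c ∈ S) : H ≤ MulAction.stabilizer (ℂ ≃ᵢ ℂ) S := by
  intro k hk
  rw [MulAction.mem_stabilizer_set]
  refine fun c => ⟨fun hc => ?_, h k hk c⟩
  have := h k⁻¹ (H.inv_mem hk) _ hc
  rwa [inv_smul_smul] at this

theorem stackBase_stabilizer {H : Subgroup (ℂ ≃ᵢ ℂ)} (hB : H ≤ MulAction.stabilizer (ℂ ≃ᵢ ℂ) B)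
    (hF : H ≤ MulAction.stabilizer (ℂ ≃ᵢ ℂ) F) :
    H ≤ MulAction.stabilizer (ℂ ≃ᵢ ℂ) (stackBase B γ F) := by
  refine mem_stabilizer_of_subgroup fun k hk => ?_
  rintro c (hc | ⟨d, hd, hc⟩)
  · exact Or.inl ((mem_of_stabilizer (hB hk) c).2 hc)
  · exact Or.inr ⟨k • d, (mem_of_stabilizer (hF hk) d).2 hd, hc.smul (hB hk)⟩

theorem stackDual_stabilizer {H : Subgroup (ℂ ≃ᵢ ℂ)} (hB : H ≤ MulAction.stabilizer (ℂ ≃ᵢ ℂ) B)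
    (hB' : H ≤ MulAction.stabilizer (ℂ ≃ᵢ ℂ) B') (hF : H ≤ MulAction.stabilizer (ℂ ≃ᵢ ℂ) F) :
    H ≤ MulAction.stabilizer (ℂ ≃ᵢ ℂ) (stackDual B B' γ F) := by
  refine mem_stabilizer_of_subgroup fun k hk => ?_
  rintro c (hc | ⟨d, hd, a, a', hc⟩)
  · exact Or.inl ⟨(mem_of_stabilizer (hB' hk) c).2 hc.1,
      fun h => hc.2 ((mem_of_stabilizer (hF hk) c).1 h)⟩
  · exact Or.inr ⟨k • d, (mem_of_stabilizer (hF hk) d).2 hd, k • a, k • a', hc.smul (hB hk)⟩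

end OrientedCircle

/-! ### Rigid faces and refinements with prescribed symmetry -/

open OrientedCircle

namespace Config

variable {B B' F : Set OrientedCircle} {γ : ℝ}

theorem apex_notMem (H : Config B B') (hF : F ⊆ B') (hP : ∀ d ∈ F, PolyFace B γ d)
    (hγ : Admissible γ) {d n : OrientedCircle} (hd : d ∈ F) (hn : IsApex B γ d n) : n ∉ B := by
  intro h
  have := H.apex_base_le hF hP hγ hd hn h
  rw [inversive_self] at this
  norm_num at this

/-- Subdivide all faces of a configuration of regular faces, and all faces of the result. There is
a face of the second subdivision which no isometry that preserves the given configuration fixes. -/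
theorem exists_rigid_face (H : Config B B') (hP : ∀ d ∈ B', PolyFace B γ d) (hγ : Admissible γ)
    (hne : B'.Nonempty) {B₁ B₁' B₂ B₂' : Set OrientedCircle} (h₁ : B₁ = stackBase B γ B')
    (h₁' : B₁' = stackDual B B' γ B') (h₂ : B₂ = stackBase B₁ 1 B₁')
    (h₂' : B₂' = stackDual B₁ B₁' 1 B₁') (hface : ∀ d ∈ B', (face B d).Nonempty) :
    ∃ d₀ ∈ B₂', ∀ k : ℂ ≃ᵢ ℂ, k ∈ MulAction.stabilizer (ℂ ≃ᵢ ℂ) B →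
      k ∈ MulAction.stabilizer (ℂ ≃ᵢ ℂ) B₁ → k ∈ MulAction.stabilizer (ℂ ≃ᵢ ℂ) B₂ →
      k • d₀ = d₀ → k = 1 := by
  have H₁ : Config B₁ B₁' := by rw [h₁, h₁']; exact H.stack Subset.rfl hP hγ
  have T₁ : ∀ d ∈ B₁', IsTriangle B₁ d := by
    rw [h₁, h₁']; exact H.stack_isTriangle Subset.rfl hP hγ (by simp)
  have P₁ : ∀ d ∈ B₁', PolyFace B₁ 1 d := fun d hd => (T₁ d hd).polyFace
  obtain ⟨d, hd⟩ := hne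
  obtain ⟨c, hc⟩ := hface d hd
  obtain ⟨c', hc', -, -, -, hcc, -⟩ := (hP d hd).neighbors c hc
  obtain ⟨n₁, hn₁, -⟩ := (hP d hd).apex
  obtain ⟨e, he⟩ := exists_isChild (γ := γ) hc hc' hcc
  have heB : e ∈ B₁' := by rw [h₁']; exact Or.inr ⟨d, hd, c, c', he⟩
  have hfe : face B₁ e = {c, c', n₁} := by
    rw [h₁]; exact H.face_stack_child Subset.rfl hP hγ hd he hn₁
  obtain ⟨n₂, hn₂, -⟩ := (P₁ e heB).apex
  have hcn : inversive c n₁ = -1 := by rw [inversive_comm]; exact hn₁.1 c hc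
  have hc₁ : c ∈ face B₁ e := by simp [hfe]
  have hn₁e : n₁ ∈ face B₁ e := by simp [hfe]
  obtain ⟨d₀, hd₀⟩ := exists_isChild (γ := 1) hc₁ hn₁e hcn
  have hf₀ : face B₂ d₀ = {c, n₁, n₂} := by
    rw [h₂]; exact H₁.face_stack_child Subset.rfl P₁ admissible_one heB hd₀ hn₂
  refine ⟨d₀, by rw [h₂']; exact Or.inr ⟨e, heB, c, n₁, hd₀⟩, fun k hk hk₁ hk₂ hkd => ?_⟩
  have hn₁B : n₁ ∉ B := H.apex_notMem Subset.rfl hP hγ hd hn₁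
  have hn₂B : n₂ ∉ B₁ := H₁.apex_notMem Subset.rfl P₁ admissible_one heB hn₂
  have hBB : B ⊆ B₁ := by rw [h₁]; exact subset_union_left
  -- The three vertices are of different age: `c` lies in `B`, `n₁` appears in `B₁`, and `n₂` only
  -- in `B₂`. An isometry that preserves the generations and permutes the vertices fixes each of
  -- them.
  have hperm : ∀ a ∈ face B₂ d₀, k • a = c ∨ k • a = n₁ ∨ k • a = n₂ := by
    intro a ha
    have := (mem_face_smul hk₂ a d₀).2 ha
    rwa [hkd, hf₀] at this
  have e₁ : k • c = c := by
    have h : k • c ∈ B := (mem_of_stabilizer hk c).2 hc.1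
    rcases hperm c (by simp [hf₀]) with h' | h' | h'
    · exact h'
    · exact absurd (h' ▸ h) hn₁B
    · exact absurd (hBB (h' ▸ h)) hn₂B
  have e₂ : k • n₁ = n₁ := by
    have h : k • n₁ ∈ B₁ := (mem_of_stabilizer hk₁ n₁).2 hn₁e.1
    rcases hperm n₁ (by simp [hf₀]) with h' | h' | h'
    · exact absurd ((mem_of_stabilizer hk n₁).1 (h' ▸ hc.1)) hn₁B
    · exact h'
    · exact absurd (h' ▸ h) hn₂B
  have e₃ : k • n₂ = n₂ := by
    rcases hperm n₂ (by simp [hf₀]) with h' | h' | h'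
    · exact absurd ((mem_of_stabilizer hk₁ n₂).1 (h' ▸ hc₁.1)) hn₂B
    · exact absurd ((mem_of_stabilizer hk₁ n₂).1 (h' ▸ hn₁e.1)) hn₂B
    · exact h'
  ext z
  -- The vertices and `d₀` form a basis, so `k` acts trivially on all coordinate vectors. Testing
  -- this on the unit circle about `z` shows that `k` fixes `z`.
  obtain ⟨x, y, w, t, hv⟩ := exists_comb hcn
    (show inversive n₁ n₂ = -1 by rw [inversive_comm]; exact hn₂.1 n₁ hn₁e)
    (show inversive c n₂ = -1 by rw [inversive_comm]; exact hn₂.1 c hc₁).le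
    hd₀.inv_left hd₀.inv_right (hd₀.inv_apex hn₂) (ofCenter z 1 one_pos).vec
  have hfix : k • ofCenter z 1 one_pos = ofCenter z 1 one_pos := by
    refine vec_injective ?_
    rw [vec_smul, hv]
    simp only [map_add, _root_.map_smul, ← vec_smul, e₁, e₂, e₃, hkd]
  rw [smul_ofCenter] at hfix
  have := congrArg center hfix
  rwa [center_ofCenter, center_ofCenter] at this

/-- Each group of isometries that preserves a configuration of regular faces is the full group of
isometries that preserve a suitable subdivision (and the original configuration). -/
theorem exists_refinement (H : Config B B') (hP : ∀ d ∈ B', PolyFace B γ d) (hγ : Admissible γ)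
    (hne : B'.Nonempty) (hface : ∀ d ∈ B', (face B d).Nonempty)
    (hcov : TriangleCover (stackBase B γ B') (stackDual B B' γ B'))
    (hBB' : MulAction.stabilizer (ℂ ≃ᵢ ℂ) B ≤ MulAction.stabilizer (ℂ ≃ᵢ ℂ) B')
    {κ : ℝ} (hκ : ∀ c ∈ B, c.curv = κ) {G : Subgroup (ℂ ≃ᵢ ℂ)}
    (hG : G ≤ MulAction.stabilizer (ℂ ≃ᵢ ℂ) B) :
    ∃ C C' : Set OrientedCircle, FlagTiling C C' ∧ B ⊆ C ∧ (∀ c ∈ C, c ∉ B → κ < c.curv) ∧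
      (∀ k ∈ G, k ∈ MulAction.stabilizer (ℂ ≃ᵢ ℂ) C ∧ k ∈ MulAction.stabilizer (ℂ ≃ᵢ ℂ) C') ∧
      ∀ k ∈ MulAction.stabilizer (ℂ ≃ᵢ ℂ) B, k ∈ MulAction.stabilizer (ℂ ≃ᵢ ℂ) C → k ∈ G := by
  set B₁ := stackBase B γ B' with h₁
  set B₁' := stackDual B B' γ B' with h₁'
  set B₂ := stackBase B₁ 1 B₁' with h₂
  set B₂' := stackDual B₁ B₁' 1 B₁' with h₂'
  have H₁ : Config B₁ B₁' := H.stack Subset.rfl hP hγ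
  have T₁ : ∀ d ∈ B₁', IsTriangle B₁ d := H.stack_isTriangle Subset.rfl hP hγ (by simp)
  have P₁ : ∀ d ∈ B₁', PolyFace B₁ 1 d := fun d hd => (T₁ d hd).polyFace
  have H₂ : Config B₂ B₂' := H₁.stack Subset.rfl P₁ admissible_one
  have T₂ : ∀ d ∈ B₂', IsTriangle B₂ d :=
    H₁.stack_isTriangle Subset.rfl P₁ admissible_one (by simp)
  have P₂ : ∀ d ∈ B₂', PolyFace B₂ 1 d := fun d hd => (T₂ d hd).polyFace
  have cov₂ : TriangleCover B₂ B₂' := H₁.stack_triangleCover Subset.rfl P₁ hcov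
  have S₁ : MulAction.stabilizer (ℂ ≃ᵢ ℂ) B ≤ MulAction.stabilizer (ℂ ≃ᵢ ℂ) B₁ :=
    stackBase_stabilizer le_rfl hBB'
  have S₁' : MulAction.stabilizer (ℂ ≃ᵢ ℂ) B ≤ MulAction.stabilizer (ℂ ≃ᵢ ℂ) B₁' :=
    stackDual_stabilizer le_rfl hBB' hBB'
  have S₂ : MulAction.stabilizer (ℂ ≃ᵢ ℂ) B ≤ MulAction.stabilizer (ℂ ≃ᵢ ℂ) B₂ :=
    stackBase_stabilizer S₁ S₁'
  have S₂' : MulAction.stabilizer (ℂ ≃ᵢ ℂ) B ≤ MulAction.stabilizer (ℂ ≃ᵢ ℂ) B₂' :=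
    stackDual_stabilizer S₁ S₁' S₁'
  obtain ⟨d₀, hd₀, hrigid⟩ := H.exists_rigid_face hP hγ hne h₁ h₁' h₂ h₂' hface
  -- Only this orbit is subdivided in the third step; it marks the plane with a pattern that records
  -- `G`.
  set F : Set OrientedCircle := {d | ∃ g ∈ G, d = g • d₀} with hF
  have hFB : F ⊆ B₂' := by
    rintro _ ⟨g, hg, rfl⟩
    exact (mem_of_stabilizer (S₂' (hG hg)) d₀).2 hd₀
  have PF : ∀ d ∈ F, PolyFace B₂ 1 d := fun d hd => P₂ d (hFB hd)
  have SF : G ≤ MulAction.stabilizer (ℂ ≃ᵢ ℂ) F := by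
    refine mem_stabilizer_of_subgroup ?_
    rintro k hk _ ⟨g, hg, rfl⟩
    exact ⟨k * g, G.mul_mem hk hg, (mul_smul k g d₀).symm⟩
  have hκ' : 0 ≤ κ := by
    obtain ⟨c, hc⟩ := H.infinite.nonempty
    rw [← hκ c hc]; exact (H.pos hc).le
  have hκ₁ : ∀ c ∈ B₁, c ∉ B → κ < c.curv := by
    rintro c (hc | ⟨d, hd, hc⟩) hcB
    · exact absurd hc hcB
    · exact H.lt_curv_apex Subset.rfl hP hγ hd hc hκ' fun c hc => (hκ c hc).ge
  have hκ₁' : ∀ c ∈ B₁, κ ≤ c.curv := fun c hc => by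
    by_cases h : c ∈ B
    · exact (hκ c h).ge
    · exact (hκ₁ c hc h).le
  have hκ₂ : ∀ c ∈ B₂, c ∉ B → κ < c.curv := by
    rintro c (hc | ⟨d, hd, hc⟩) hcB
    · exact hκ₁ c hc hcB
    · exact H₁.lt_curv_apex Subset.rfl P₁ admissible_one hd hc hκ' hκ₁'
  have hκ₂' : ∀ c ∈ B₂, κ ≤ c.curv := fun c hc => by
    by_cases h : c ∈ B
    · exact (hκ c h).ge
    · exact (hκ₂ c hc h).le
  refine ⟨stackBase B₂ 1 F, stackDual B₂ B₂' 1 F,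
    (H₂.stack hFB PF admissible_one).flagTiling (H₂.stack_triangleCover hFB PF cov₂),
    fun c hc => Or.inl (Or.inl (Or.inl hc)), ?_, fun k hk =>
      ⟨stackBase_stabilizer (hG.trans S₂) SF hk,
        stackDual_stabilizer (hG.trans S₂) (hG.trans S₂') SF hk⟩, ?_⟩
  · rintro c (hc | ⟨d, hd, hc⟩) hcB
    · exact hκ₂ c hc hcB
    · exact H₂.lt_curv_apex hFB PF admissible_one hd hc hκ' hκ₂'
  · intro k hk hkC
    obtain ⟨n, hn, -⟩ := (P₂ d₀ hd₀).apex
    have hd₀F : d₀ ∈ F := ⟨1, G.one_mem, (one_smul _ _).symm⟩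
    have hnB : n ∉ B₂ := H₂.apex_notMem hFB PF admissible_one hd₀F hn
    have hkn : k • n ∈ stackBase B₂ 1 F := (mem_of_stabilizer hkC n).2 (Or.inr ⟨d₀, hd₀F, hn⟩)
    rcases hkn with h | ⟨_, ⟨g, hg, rfl⟩, hkn⟩
    · exact absurd ((mem_of_stabilizer (S₂ hk) n).1 h) hnB
    -- An apex recognises its face: it has product `2` with its own dual circle and less than `-1`
    -- with every other one.
    · have hkd : k • d₀ = g • d₀ := by
        by_contra hne
        have h1 := H₂.apex_dual_lt hFB PF admissible_one ⟨g, hg, rfl⟩ hkn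
          ((mem_of_stabilizer (S₂' hk) d₀).2 hd₀) hne
        rw [inversive_smul, hn.2] at h1
        norm_num at h1
      have hgk : g⁻¹ * k ∈ MulAction.stabilizer (ℂ ≃ᵢ ℂ) B :=
        Subgroup.mul_mem _ (Subgroup.inv_mem _ (hG hg)) hk
      have h1 := hrigid (g⁻¹ * k) hgk (S₁ hgk) (S₂ hgk)
        (by rw [mul_smul, hkd, inv_smul_smul])
      rw [inv_mul_eq_one] at h1
      exact h1 ▸ hg

end Config

/-! ### The square configuration -/

namespace OrientedCircle

theorem inversive_ofCenter (z w : ℂ) {r s : ℝ} (hr : 0 < r) (hs : 0 < s) :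
    inversive (ofCenter z r hr) (ofCenter w s hs) = (r ^ 2 + s ^ 2 - ‖z - w‖ ^ 2) / (2 * r * s) := by
  have := hr.ne'
  have := hs.ne'
  rw [norm_sub_sq]
  simp only [inversive, ofCenter]
  field_simp
  ring

theorem finite_of_coordinates {f : ℤ → ℤ → OrientedCircle}
    (hf : ∀ R : ℝ, ∃ K : ℤ, ∀ m n, ‖(f m n).center‖ ≤ R → |m| ≤ K ∧ |n| ≤ K) (R : ℝ) :
    {c | (∃ m n, c = f m n) ∧ ‖c.center‖ ≤ R}.Finite := by
  obtain ⟨K, hK⟩ := hf R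
  refine (((finite_Icc (-K) K).prod (finite_Icc (-K) K)).image fun p => f p.1 p.2).subset ?_
  rintro _ ⟨⟨m, n, rfl⟩, hc⟩
  obtain ⟨h1, h2⟩ := hK m n hc
  exact ⟨(m, n), ⟨abs_le.1 h1, abs_le.1 h2⟩, rfl⟩

theorem InTriangle.mk {a b c z : ℂ} {α β : ℝ} (hα : 0 ≤ α) (hβ : 0 ≤ β) (h : 0 ≤ 1 - α - β)
    (hz : z = α * a + β * b + (1 - α - β : ℝ) * c) : InTriangle a b c z :=
  ⟨α, β, _, hα, hβ, h, by ring, hz⟩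

/-- Sums of two squares of integers equal to one. -/
theorem int_sq_add_sq_eq_one {a b : ℤ} (h : a ^ 2 + b ^ 2 = 1) :
    (a = 1 ∧ b = 0) ∨ (a = -1 ∧ b = 0) ∨ (a = 0 ∧ b = 1) ∨ (a = 0 ∧ b = -1) := by
  have h1 : -1 ≤ a ∧ a ≤ 1 := by constructor <;> nlinarith
  have h2 : -1 ≤ b ∧ b ≤ 1 := by constructor <;> nlinarith
  obtain ⟨h3, h4⟩ := h1
  obtain ⟨h5, h6⟩ := h2
  interval_cases a <;> interval_cases b <;> simp_all

theorem int_mul_sub_one_nonneg (a : ℤ) : 0 ≤ a * (a - 1) := by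
  rcases le_or_gt a 0 with h | h
  · exact mul_nonneg_of_nonpos_of_nonpos h (by omega)
  · exact mul_nonneg h.le (by omega)

theorem int_mul_sub_one_eq_zero {a : ℤ} (h : a * (a - 1) = 0) : a = 0 ∨ a = 1 := by
  rcases mul_eq_zero.1 h with h | h <;> omega

/-- The circles of `squareBase`. -/
noncomputable def squareCircle (m n : ℤ) : OrientedCircle :=
  ofCenter (2 * (m : ℂ) + 2 * (n : ℂ) * Complex.I) 1 one_pos

/-- The circles of the dual configuration of `squareBase`. -/
noncomputable def squareDualCircle (m n : ℤ) : OrientedCircle :=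
  ofCenter ((2 * m + 1 : ℂ) + (2 * n + 1 : ℂ) * Complex.I) 1 one_pos

theorem mem_squareBase {c : OrientedCircle} : c ∈ squareBase ↔ ∃ m n, c = squareCircle m n :=
  Iff.rfl

theorem squareCircle_mem (m n : ℤ) : squareCircle m n ∈ squareBase := ⟨m, n, rfl⟩

/-- The dual configuration of `squareBase`. -/
def squareDual : Set OrientedCircle := {c | ∃ m n, c = squareDualCircle m n}

theorem squareDualCircle_mem (m n : ℤ) : squareDualCircle m n ∈ squareDual := ⟨m, n, rfl⟩

theorem inversive_square (m n m' n' : ℤ) : inversive (squareCircle m n) (squareCircle m' n') =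
    ((1 - 2 * ((m' - m) ^ 2 + (n' - n) ^ 2) : ℤ) : ℝ) := by
  rw [squareCircle, squareCircle, inversive_ofCenter, norm_sub_sq]
  simp
  ring

theorem inversive_squareDual (m n m' n' : ℤ) :
    inversive (squareDualCircle m n) (squareDualCircle m' n') =
    ((1 - 2 * ((m' - m) ^ 2 + (n' - n) ^ 2) : ℤ) : ℝ) := by
  rw [squareDualCircle, squareDualCircle, inversive_ofCenter, norm_sub_sq]
  simp
  ring

/-- Products of consecutive integers are nonnegative, so the value is a nonpositive even integer:
orthogonality, or a product below `-1`. -/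
theorem inversive_square_dual (m n M N : ℤ) :
    inversive (squareCircle m n) (squareDualCircle M N) =
    ((-2 * ((m - M) * (m - M - 1) + (n - N) * (n - N - 1)) : ℤ) : ℝ) := by
  rw [squareCircle, squareDualCircle, inversive_ofCenter, norm_sub_sq]
  simp
  ring

theorem square_tangent {m n m' n' : ℤ}
    (h : inversive (squareCircle m n) (squareCircle m' n') = -1) :
    (m' = m + 1 ∧ n' = n) ∨ (m' = m - 1 ∧ n' = n) ∨ (m' = m ∧ n' = n + 1) ∨
      (m' = m ∧ n' = n - 1) := by
  rw [inversive_square] at h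
  have h1 : (m' - m) ^ 2 + (n' - n) ^ 2 = 1 := by
    have : (1 - 2 * ((m' - m) ^ 2 + (n' - n) ^ 2) : ℤ) = -1 := by exact_mod_cast h
    omega
  have := int_sq_add_sq_eq_one h1
  omega

theorem squareDual_tangent {m n m' n' : ℤ}
    (h : inversive (squareDualCircle m n) (squareDualCircle m' n') = -1) :
    (m' = m + 1 ∧ n' = n) ∨ (m' = m - 1 ∧ n' = n) ∨ (m' = m ∧ n' = n + 1) ∨
      (m' = m ∧ n' = n - 1) := by
  rw [inversive_squareDual, ← inversive_square] at h
  exact square_tangent h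

theorem square_orthogonal {m n M N : ℤ}
    (h : inversive (squareCircle m n) (squareDualCircle M N) = 0) :
    (m = M ∨ m = M + 1) ∧ (n = N ∨ n = N + 1) := by
  rw [inversive_square_dual] at h
  have h1 : (-2 * ((m - M) * (m - M - 1) + (n - N) * (n - N - 1)) : ℤ) = 0 := by exact_mod_cast h
  have h2 := int_mul_sub_one_nonneg (m - M)
  have h3 := int_mul_sub_one_nonneg (n - N)
  have h4 := int_mul_sub_one_eq_zero (a := m - M) (by linarith)
  have h5 := int_mul_sub_one_eq_zero (a := n - N) (by linarith)
  omega

theorem curv_squareCircle (m n : ℤ) : (squareCircle m n).curv = 1 := by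
  rw [squareCircle, curv_ofCenter, div_one]

theorem curv_squareDualCircle (m n : ℤ) : (squareDualCircle m n).curv = 1 := by
  rw [squareDualCircle, curv_ofCenter, div_one]

theorem center_squareCircle (m n : ℤ) :
    (squareCircle m n).center = 2 * (m : ℂ) + 2 * (n : ℂ) * Complex.I := center_ofCenter _ _ _

theorem center_squareDualCircle (m n : ℤ) :
    (squareDualCircle m n).center = (2 * m + 1 : ℂ) + (2 * n + 1 : ℂ) * Complex.I :=
  center_ofCenter _ _ _

theorem square_finite (R : ℝ) : {c ∈ squareBase | ‖c.center‖ ≤ R}.Finite := by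
  refine finite_of_coordinates (f := squareCircle) (fun R => ⟨⌈R⌉, fun m n h => ?_⟩) R
  have h1 := (Complex.abs_re_le_norm _).trans h
  have h2 := (Complex.abs_im_le_norm _).trans h
  rw [center_squareCircle] at h1 h2
  simp at h1 h2
  have e1 : |(m : ℝ)| ≤ R := by linarith [abs_nonneg (m : ℝ)]
  have e2 : |(n : ℝ)| ≤ R := by linarith [abs_nonneg (n : ℝ)]
  exact ⟨by exact_mod_cast e1.trans (Int.le_ceil R), by exact_mod_cast e2.trans (Int.le_ceil R)⟩

theorem squareDual_finite (R : ℝ) : {c ∈ squareDual | ‖c.center‖ ≤ R}.Finite := by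
  refine finite_of_coordinates (f := squareDualCircle) (fun R => ⟨⌈R + 1⌉, fun m n h => ?_⟩) R
  have h1 := (Complex.abs_re_le_norm _).trans h
  have h2 := (Complex.abs_im_le_norm _).trans h
  rw [center_squareDualCircle] at h1 h2
  simp at h1 h2
  have key : ∀ k : ℤ, |2 * (k : ℝ) + 1| ≤ R → |k| ≤ ⌈R + 1⌉ := by
    intro k hk
    have h3 : |(k : ℝ)| ≤ R + 1 := by
      rw [abs_le] at hk ⊢
      constructor <;> linarith
    exact_mod_cast h3.trans (Int.le_ceil _)
  exact ⟨key m h1, key n h2⟩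

theorem squareCircle_injective {m n m' n' : ℤ} (h : squareCircle m n = squareCircle m' n') :
    m = m' ∧ n = n' := by
  have := congrArg center h
  rw [center_squareCircle, center_squareCircle, Complex.ext_iff] at this
  simp at this
  exact this

theorem square_edge (m n : ℤ) : inversive (squareCircle m n) (squareCircle (m + 1) n) = -1 ∧
    inversive (squareCircle m n) (squareCircle m (n + 1)) = -1 := by
  simp only [inversive_square]
  constructor <;> · push_cast; ring

theorem square_corner (m n : ℤ) : inversive (squareCircle m n) (squareDualCircle m n) = 0 ∧
    inversive (squareCircle (m + 1) n) (squareDualCircle m n) = 0 ∧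
    inversive (squareCircle m (n + 1)) (squareDualCircle m n) = 0 ∧
    inversive (squareCircle (m + 1) (n + 1)) (squareDualCircle m n) = 0 := by
  simp only [inversive_square_dual]
  refine ⟨?_, ?_, ?_, ?_⟩ <;> · push_cast; ring

theorem int_sq_add_sq_pos {a b : ℤ} (h : ¬(a = 0 ∧ b = 0)) : 1 ≤ a ^ 2 + b ^ 2 := by
  by_contra! h1
  have h2 : a ^ 2 + b ^ 2 = 0 := by nlinarith
  have h3 : a = 0 := by nlinarith
  have h4 : b = 0 := by nlinarith
  exact h ⟨h3, h4⟩

theorem square_config : Config squareBase squareDual where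
  one_le_curv := by rintro _ ⟨m, n, rfl⟩; exact (curv_squareCircle m n).ge
  one_le_curv' := by rintro _ ⟨m, n, rfl⟩; exact (curv_squareDualCircle m n).ge
  inv_le := by
    intro c hc c' hc' hne
    obtain ⟨m, n, rfl⟩ := mem_squareBase.1 hc
    obtain ⟨m', n', rfl⟩ := mem_squareBase.1 hc'
    rw [inversive_square]
    have := int_sq_add_sq_pos (a := m' - m) (b := n' - n) (by
      rintro ⟨h1, h2⟩
      rw [sub_eq_zero] at h1 h2
      rw [h1, h2] at hne
      exact hne rfl)
    exact_mod_cast (by linarith : (1 - 2 * ((m' - m) ^ 2 + (n' - n) ^ 2) : ℤ) ≤ -1)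
  inv_le' := by
    rintro _ ⟨m, n, rfl⟩ _ ⟨m', n', rfl⟩ hne
    rw [inversive_squareDual]
    have := int_sq_add_sq_pos (a := m' - m) (b := n' - n) (by
      rintro ⟨h1, h2⟩
      rw [sub_eq_zero] at h1 h2
      rw [h1, h2] at hne
      exact hne rfl)
    exact_mod_cast (by linarith : (1 - 2 * ((m' - m) ^ 2 + (n' - n) ^ 2) : ℤ) ≤ -1)
  inv_dual := by
    intro c hc d ⟨M, N, hd⟩
    obtain ⟨m, n, rfl⟩ := mem_squareBase.1 hc
    rw [hd, inversive_square_dual]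
    have h2 := int_mul_sub_one_nonneg (m - M)
    have h3 := int_mul_sub_one_nonneg (n - N)
    have h4 : (-2 * ((m - M) * (m - M - 1) + (n - N) * (n - N - 1)) : ℤ) = 0 ∨
        (-2 * ((m - M) * (m - M - 1) + (n - N) * (n - N - 1)) : ℤ) < -1 := by omega
    exact_mod_cast h4
  infinite := by
    refine (infinite_range_of_injective (f := fun m : ℤ => squareCircle m 0) fun m m' h =>
      (squareCircle_injective h).1).mono ?_
    rintro _ ⟨m, rfl⟩
    exact squareCircle_mem m 0
  finite := square_finite
  finite' := squareDual_finite
  edge_face := by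
    intro c hc c' hc' h
    obtain ⟨m, n, rfl⟩ := mem_squareBase.1 hc
    obtain ⟨m', n', rfl⟩ := mem_squareBase.1 hc'
    rcases square_tangent h with ⟨rfl, rfl⟩ | ⟨rfl, rfl⟩ | ⟨rfl, rfl⟩ | ⟨rfl, rfl⟩
    · exact ⟨_, squareDualCircle_mem m n', by simp [inversive_square_dual]⟩
    · exact ⟨_, squareDualCircle_mem (m - 1) n', by simp [inversive_square_dual]⟩
    · exact ⟨_, squareDualCircle_mem m' n, by simp [inversive_square_dual]⟩
    · exact ⟨_, squareDualCircle_mem m' (n - 1), by simp [inversive_square_dual]⟩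
  face_adj := by
    rintro _ ⟨M, N, rfl⟩ c ⟨hc, h1⟩ c' ⟨hc', h2⟩ h
    obtain ⟨m, n, rfl⟩ := mem_squareBase.1 hc
    obtain ⟨m', n', rfl⟩ := mem_squareBase.1 hc'
    have h1 := square_orthogonal h1
    have h2 := square_orthogonal h2
    have h := square_tangent h
    -- The neighbouring dual centre is the point reflection of the given one in the midpoint of the
    -- edge.
    refine ⟨_, squareDualCircle_mem (m + m' - M - 1) (n + n' - N - 1), ?_⟩
    simp only [inversive_squareDual, inversive_square_dual]
    obtain ⟨rfl | rfl, rfl | rfl⟩ := h1 <;> obtain ⟨rfl | rfl, rfl | rfl⟩ := h2 <;>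
      first
      | exfalso; omega
      | refine ⟨?_, ?_, ?_⟩ <;> · push_cast; ring
  edge' := by
    rintro _ ⟨m, n, rfl⟩ _ ⟨m', n', rfl⟩ h
    rcases squareDual_tangent h with ⟨rfl, rfl⟩ | ⟨rfl, rfl⟩ | ⟨rfl, rfl⟩ | ⟨rfl, rfl⟩
    · refine ⟨_, squareCircle_mem (m + 1) n', _, squareCircle_mem (m + 1) (n' + 1),
        (square_edge _ _).2, ?_⟩
      simp [inversive_square_dual]
    · refine ⟨_, squareCircle_mem m n', _, squareCircle_mem m (n' + 1), (square_edge _ _).2, ?_⟩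
      simp [inversive_square_dual]
    · refine ⟨_, squareCircle_mem m' (n + 1), _, squareCircle_mem (m' + 1) (n + 1),
        (square_edge _ _).1, ?_⟩
      simp [inversive_square_dual]
    · refine ⟨_, squareCircle_mem m' n, _, squareCircle_mem (m' + 1) n, (square_edge _ _).1, ?_⟩
      simp [inversive_square_dual]

theorem mem_face_square {M N : ℤ} {c : OrientedCircle} :
    c ∈ face squareBase (squareDualCircle M N) ↔ c = squareCircle M N ∨ c = squareCircle (M + 1) N ∨
      c = squareCircle (M + 1) (N + 1) ∨ c = squareCircle M (N + 1) := by
  have h := square_corner M N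
  constructor
  · rintro ⟨hc, hd⟩
    obtain ⟨m, n, rfl⟩ := mem_squareBase.1 hc
    obtain ⟨rfl | rfl, rfl | rfl⟩ := square_orthogonal hd <;> simp
  · rintro (rfl | rfl | rfl | rfl)
    · exact ⟨squareCircle_mem _ _, h.1⟩
    · exact ⟨squareCircle_mem _ _, h.2.1⟩
    · exact ⟨squareCircle_mem _ _, h.2.2.2⟩
    · exact ⟨squareCircle_mem _ _, h.2.2.1⟩

theorem isSquare_square (M N : ℤ) : IsSquare squareBase (squareDualCircle M N) := by
  refine ⟨squareCircle M N, squareCircle (M + 1) N, squareCircle (M + 1) (N + 1),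
    squareCircle M (N + 1), ?_, ?_⟩
  · ext c
    rw [mem_face_square]
    rfl
  · simp only [inversive_square]
    refine ⟨?_, ?_, ?_, ?_, ?_, ?_⟩ <;> · push_cast; ring

theorem square_polyFace {γ : ℝ} (hγ : γ ^ 2 = 1 / 2) :
    ∀ d ∈ squareDual, PolyFace squareBase γ d := by
  rintro _ ⟨M, N, rfl⟩
  exact (isSquare_square M N).polyFace hγ

theorem square_face_nonempty : ∀ d ∈ squareDual, (face squareBase d).Nonempty := by
  rintro _ ⟨M, N, rfl⟩
  exact ⟨_, mem_face_square.2 (Or.inl rfl)⟩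

/-- The parameter of square faces. -/
theorem admissible_sqrt : Admissible (√2 / 2) ∧ (√2 / 2) ^ 2 = (1 / 2 : ℝ) := by
  have h : (√2 / 2) ^ 2 = (1 / 2 : ℝ) := by
    rw [div_pow, Real.sq_sqrt (by norm_num)]; norm_num
  exact ⟨⟨by positivity, Or.inr h⟩, h⟩

theorem one_lt_sqrt_two : (0 : ℝ) < √2 - 1 := by
  have : 1 < √2 := Real.lt_sqrt_of_sq_lt (by norm_num)
  linarith

/-- The centre of the square is at distance `√2` from the four unit circle centres, which leaves the
radius `√2 - 1` for the inserted circle. -/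
theorem square_isApex (M N : ℤ) : IsApex squareBase (√2 / 2) (squareDualCircle M N)
    (ofCenter (squareDualCircle M N).center (√2 - 1) one_lt_sqrt_two) := by
  have h0 := one_lt_sqrt_two.ne'
  have h2 : √2 ^ 2 = (2 : ℝ) := Real.sq_sqrt (by norm_num)
  constructor
  · intro c hc
    have key : ∀ m n : ℤ, ((2 * M + 1 - 2 * m) ^ 2 + (2 * N + 1 - 2 * n) ^ 2 : ℝ) = 2 →
        inversive (ofCenter (squareDualCircle M N).center (√2 - 1) one_lt_sqrt_two)
          (squareCircle m n) = -1 := by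
      intro m n hmn
      rw [squareCircle, inversive_ofCenter, norm_sub_sq, center_squareDualCircle]
      simp
      rw [hmn]
      field_simp
      linear_combination h2
    rcases mem_face_square.1 hc with rfl | rfl | rfl | rfl <;> refine key _ _ ?_ <;>
      · push_cast; ring
  · rw [center_squareDualCircle, squareDualCircle, inversive_ofCenter, sub_self, norm_zero]
    field_simp
    linear_combination -h2

end OrientedCircle

open OrientedCircle

namespace Config

theorem stack_cover_of_mem {B B' : Set OrientedCircle} {γ : ℝ} (H : Config B B')
    (hP : ∀ d ∈ B', PolyFace B γ d) (hγ : Admissible γ) {d n : OrientedCircle} (hd : d ∈ B')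
    (hn : IsApex B γ d n) {z : ℂ} {c c' : OrientedCircle} (hc : c ∈ face B d) (hc' : c' ∈ face B d)
    (h : inversive c c' = -1) (hz : InTriangle c.center c'.center n.center z) :
    ∃ d ∈ stackDual B B' γ B', ∃ c₁ ∈ face (stackBase B γ B') d, ∃ c₂ ∈ face (stackBase B γ B') d,
      ∃ c₃ ∈ face (stackBase B γ B') d, inversive c₁ c₂ = -1 ∧ inversive c₂ c₃ = -1 ∧
        inversive c₁ c₃ = -1 ∧ InTriangle c₁.center c₂.center c₃.center z := by
  obtain ⟨e, he⟩ := exists_isChild (γ := γ) hc hc' h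
  have hf := H.face_stack_child Subset.rfl hP hγ hd he hn
  exact ⟨e, Or.inr ⟨d, hd, c, c', he⟩, c, by simp [hf], c', by simp [hf], n, by simp [hf], h,
    by rw [inversive_comm]; exact hn.1 c' hc', by rw [inversive_comm]; exact hn.1 c hc, hz⟩

end Config

namespace OrientedCircle

/-- The faces of the square configuration are not triangles, so the covering by triangles can start
only after the first stacking. -/
theorem square_stack_cover : TriangleCover (stackBase squareBase (√2 / 2) squareDual)
    (stackDual squareBase squareDual (√2 / 2) squareDual) := by
  intro z
  obtain ⟨hγ, hγ'⟩ := admissible_sqrt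
  set m := ⌊z.re / 2⌋
  set n := ⌊z.im / 2⌋
  obtain ⟨f, hf⟩ : ∃ f, f = z.re / 2 - m := ⟨_, rfl⟩
  obtain ⟨g, hg⟩ : ∃ g, g = z.im / 2 - n := ⟨_, rfl⟩
  have f0 : 0 ≤ f := by rw [hf]; linarith [Int.floor_le (z.re / 2)]
  have f1 : f ≤ 1 := by rw [hf]; linarith [Int.lt_floor_add_one (z.re / 2)]
  have g0 : 0 ≤ g := by rw [hg]; linarith [Int.floor_le (z.im / 2)]
  have g1 : g ≤ 1 := by rw [hg]; linarith [Int.lt_floor_add_one (z.im / 2)]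
  have hre : z.re = 2 * (m + f) := by rw [hf]; ring
  have him : z.im = 2 * (n + g) := by rw [hg]; ring
  have hz : z = 2 * (m + f : ℂ) + 2 * (n + g : ℂ) * Complex.I := by
    apply Complex.ext <;> simp [hre, him]
  have key := fun {c c' : OrientedCircle} (hc) (hc') (h) (h') =>
    square_config.stack_cover_of_mem (square_polyFace hγ') hγ (squareDualCircle_mem m n)
      (square_isApex m n) (z := z) (c := c) (c' := c') hc hc' h h'
  simp only [center_ofCenter, center_squareDualCircle] at key
  have m1 : squareCircle m n ∈ face squareBase (squareDualCircle m n) :=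
    mem_face_square.2 (Or.inl rfl)
  have m2 : squareCircle (m + 1) n ∈ face squareBase (squareDualCircle m n) :=
    mem_face_square.2 (Or.inr (Or.inl rfl))
  have m3 : squareCircle (m + 1) (n + 1) ∈ face squareBase (squareDualCircle m n) :=
    mem_face_square.2 (Or.inr (Or.inr (Or.inl rfl)))
  have m4 : squareCircle m (n + 1) ∈ face squareBase (squareDualCircle m n) :=
    mem_face_square.2 (Or.inr (Or.inr (Or.inr rfl)))
  -- The two diagonals cut the lattice square into four triangles with the centre of the apex as a
  -- common vertex.
  rcases le_total g f with h1 | h1 <;> rcases le_total g (1 - f) with h2 | h2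
  · refine key m1 m2 (square_edge m n).1
      (InTriangle.mk (α := 1 - f - g) (β := f - g) (by linarith) (by linarith) (by linarith) ?_)
    rw [hz, center_squareCircle, center_squareCircle]
    push_cast; ring
  · refine key m2 m3 (square_edge (m + 1) n).2
      (InTriangle.mk (α := f - g) (β := f + g - 1) (by linarith) (by linarith) (by linarith) ?_)
    rw [hz, center_squareCircle, center_squareCircle]
    push_cast; ring
  · refine key m1 m4 (square_edge m n).2
      (InTriangle.mk (α := 1 - f - g) (β := g - f) (by linarith) (by linarith) (by linarith) ?_)
    rw [hz, center_squareCircle, center_squareCircle]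
    push_cast; ring
  · refine key m4 m3 (square_edge m (n + 1)).1
      (InTriangle.mk (α := g - f) (β := f + g - 1) (by linarith) (by linarith) (by linarith) ?_)
    rw [hz, center_squareCircle, center_squareCircle]
    push_cast; ring

theorem isometry_midpoint (k : ℂ ≃ᵢ ℂ) (z w : ℂ) : k ((z + w) / 2) = (k z + k w) / 2 := by
  have h : (z + w) / 2 = (1 / 2 : ℝ) • (z + w) := by
    rw [Complex.real_smul]; push_cast; ring
  rw [isometry_apply k z, isometry_apply k w, isometry_apply, h, _root_.map_smul, map_add,
    Complex.real_smul]
  push_cast; ring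

/-- A dual centre is the midpoint of two diagonally opposite base centres. Such pairs are recognised
by the product `-3`, which isometries preserve, and isometries preserve midpoints. -/
theorem square_stabilizer_le : MulAction.stabilizer (ℂ ≃ᵢ ℂ) squareBase ≤
    MulAction.stabilizer (ℂ ≃ᵢ ℂ) squareDual := by
  refine mem_stabilizer_of_subgroup ?_
  rintro k hk _ ⟨M, N, rfl⟩
  obtain ⟨m, n, h1⟩ := mem_squareBase.1 ((mem_of_stabilizer hk _).2 (squareCircle_mem M N))
  obtain ⟨m', n', h2⟩ :=
    mem_squareBase.1 ((mem_of_stabilizer hk _).2 (squareCircle_mem (M + 1) (N + 1)))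
  have p : ∀ m n, 0 < (squareCircle m n).curv := fun m n => by rw [curv_squareCircle]; exact one_pos
  have q : ∀ m n, 0 < (squareDualCircle m n).curv := fun m n => by
    rw [curv_squareDualCircle]; exact one_pos
  have h3 : inversive (squareCircle m n) (squareCircle m' n') = -3 := by
    rw [← h1, ← h2, inversive_smul, inversive_square]
    push_cast; ring
  rw [inversive_square] at h3
  have h4 : (m' - m) ^ 2 + (n' - n) ^ 2 = 2 := by
    have : (1 - 2 * ((m' - m) ^ 2 + (n' - n) ^ 2) : ℤ) = -3 := by exact_mod_cast h3
    omega
  have h5 : (m' = m + 1 ∨ m' = m - 1) ∧ (n' = n + 1 ∨ n' = n - 1) := by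
    obtain ⟨a, rfl⟩ : ∃ a, m' = m + a := ⟨m' - m, by ring⟩
    obtain ⟨b, rfl⟩ : ∃ b, n' = n + b := ⟨n' - n, by ring⟩
    simp only [add_sub_cancel_left] at h4
    have b1 : -1 ≤ a ∧ a ≤ 1 := by constructor <;> nlinarith
    have b2 : -1 ≤ b ∧ b ≤ 1 := by constructor <;> nlinarith
    obtain ⟨_, _⟩ := b1
    obtain ⟨_, _⟩ := b2
    interval_cases a <;> interval_cases b <;> simp_all <;> omega
  have h6 : (squareDualCircle M N).center =
      ((squareCircle M N).center + (squareCircle (M + 1) (N + 1)).center) / 2 := by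
    rw [center_squareDualCircle, center_squareCircle, center_squareCircle]
    push_cast; ring
  have h7 : (k • squareDualCircle M N).center =
      ((squareCircle m n).center + (squareCircle m' n').center) / 2 := by
    rw [center_smul k (q M N), h6, isometry_midpoint, ← center_smul k (p _ _), h1,
      ← center_smul k (p _ _), h2]
  obtain ⟨a, b, h8⟩ : ∃ a b : ℤ, m + m' = 2 * a + 1 ∧ n + n' = 2 * b + 1 := by
    rcases h5.1 with rfl | rfl <;> rcases h5.2 with rfl | rfl
    · exact ⟨m, n, by ring, by ring⟩
    · exact ⟨m, n - 1, by ring, by ring⟩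
    · exact ⟨m - 1, n, by ring, by ring⟩
    · exact ⟨m - 1, n - 1, by ring, by ring⟩
  refine ⟨a, b, ext_center (q M N) ?_ ?_⟩
  · rw [curv_smul, curv_squareDualCircle, curv_squareDualCircle]
  · rw [h7, center_squareCircle, center_squareCircle, center_squareDualCircle]
    have e1 : (m + m' : ℂ) = 2 * a + 1 := by exact_mod_cast h8.1
    have e2 : (n + n' : ℂ) = 2 * b + 1 := by exact_mod_cast h8.2
    linear_combination e1 + e2 * Complex.I

/-- An isometry that preserves the centres of the circles preserves `squareBase`. -/
theorem square_smul_mem {k : ℂ ≃ᵢ ℂ}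
    (h : ∀ m n : ℤ, ∃ m' n' : ℤ, k (2 * (m : ℂ) + 2 * (n : ℂ) * Complex.I) =
      2 * (m' : ℂ) + 2 * (n' : ℂ) * Complex.I) : ∀ c ∈ squareBase, k • c ∈ squareBase := by
  rintro _ ⟨m, n, rfl⟩
  obtain ⟨m', n', h'⟩ := h m n
  exact ⟨m', n', by rw [smul_ofCenter]; simp only [h']⟩

end OrientedCircle

/-! ### The triangular configuration -/

namespace OrientedCircle

/-- The point with coordinates `x`, `y` in the basis `1`, `(1 + i√3) / 2`. -/
noncomputable def eis (x y : ℝ) : ℂ := (x : ℂ) + (y : ℂ) * ((1 + Complex.I * (√3 : ℂ)) / 2)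

theorem eis_re (x y : ℝ) : (eis x y).re = x + y / 2 := by
  simp [eis]; ring

theorem eis_im (x y : ℝ) : (eis x y).im = y * √3 / 2 := by
  simp [eis]; ring

theorem sqrt_three_sq : √3 ^ 2 = (3 : ℝ) := Real.sq_sqrt (by norm_num)

theorem eis_dist_sq (x y x' y' : ℝ) : ‖eis x y - eis x' y'‖ ^ 2 =
    (x' - x) ^ 2 + (x' - x) * (y' - y) + (y' - y) ^ 2 := by
  rw [norm_sub_sq, eis_re, eis_re, eis_im, eis_im]
  linear_combination ((y - y') ^ 2 / 4) * sqrt_three_sq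

/-- The circles of `triangularBase`. -/
noncomputable def triCircle (m n : ℤ) : OrientedCircle := ofCenter (eis m n) (1 / 2) one_half_pos

/-- The number `√3 / 6` is the inradius of the equilateral triangle of side one. -/
theorem sqrt_three_div_pos : (0 : ℝ) < √3 / 6 := by positivity

/-- The circles of the dual configuration of `triangularBase`, with `e = 1` or `e = -1`. -/
noncomputable def triDualCircle (m n e : ℤ) : OrientedCircle :=
  ofCenter (eis (m + e / 3) (n + e / 3)) (√3 / 6) sqrt_three_div_pos

theorem mem_triangularBase {c : OrientedCircle} : c ∈ triangularBase ↔ ∃ m n, c = triCircle m n := by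
  simp only [triangularBase, triCircle, eis, mem_ofPred_eq, Complex.ofReal_intCast]

theorem triCircle_mem (m n : ℤ) : triCircle m n ∈ triangularBase :=
  mem_triangularBase.2 ⟨m, n, rfl⟩

/-- The dual configuration of `triangularBase`. -/
def triangularDual : Set OrientedCircle :=
  {c | ∃ m n e, (e = 1 ∨ e = -1) ∧ c = triDualCircle m n e}

theorem triDualCircle_mem {e : ℤ} (he : e = 1 ∨ e = -1) (m n : ℤ) :
    triDualCircle m n e ∈ triangularDual := ⟨m, n, e, he, rfl⟩

theorem inversive_tri (m n m' n' : ℤ) : inversive (triCircle m n) (triCircle m' n') =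
    ((1 - 2 * ((m' - m) ^ 2 + (m' - m) * (n' - n) + (n' - n) ^ 2) : ℤ) : ℝ) := by
  rw [triCircle, triCircle, inversive_ofCenter, eis_dist_sq]
  push_cast
  ring

theorem inversive_triDual (m n e m' n' e' : ℤ) :
    inversive (triDualCircle m n e) (triDualCircle m' n' e') =
    ((1 - 6 * ((m' - m) ^ 2 + (m' - m) * (n' - n) + (n' - n) ^ 2)
      - 6 * ((e' - e) * ((m' - m) + (n' - n))) - 2 * (e' - e) ^ 2 : ℤ) : ℝ) := by
  rw [triDualCircle, triDualCircle, inversive_ofCenter, eis_dist_sq]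
  have : √3 ≠ 0 := by positivity
  push_cast
  field_simp
  rw [sqrt_three_sq]
  ring

theorem inversive_tri_dual (m n M N : ℤ) {e : ℤ} (he : e = 1 ∨ e = -1) :
    inversive (triCircle m n) (triDualCircle M N e) = -2 * √3 *
    (((M - m) ^ 2 + (M - m) * (N - n) + (N - n) ^ 2 + e * ((M - m) + (N - n)) : ℤ) : ℝ) := by
  rw [triCircle, triDualCircle, inversive_ofCenter, eis_dist_sq]
  have : √3 ≠ 0 := by positivity
  have he : (e : ℝ) ^ 2 = 1 := by rcases he with rfl | rfl <;> norm_num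
  push_cast
  field_simp
  ring_nf
  rw [he, sqrt_three_sq]
  ring

theorem int_eis_pos {a b : ℤ} (h : ¬(a = 0 ∧ b = 0)) : 1 ≤ a ^ 2 + a * b + b ^ 2 := by
  by_contra! h1
  have h3 : a = 0 := by nlinarith [sq_nonneg (a + 2 * b)]
  have h4 : b = 0 := by nlinarith [sq_nonneg (2 * a + b)]
  exact h ⟨h3, h4⟩

theorem int_eis_eq_one {a b : ℤ} (h : a ^ 2 + a * b + b ^ 2 = 1) :
    (a = 1 ∧ b = 0) ∨ (a = -1 ∧ b = 0) ∨ (a = 0 ∧ b = 1) ∨ (a = 0 ∧ b = -1) ∨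
      (a = 1 ∧ b = -1) ∨ (a = -1 ∧ b = 1) := by
  have h1 : -1 ≤ a ∧ a ≤ 1 := by constructor <;> nlinarith [sq_nonneg (a + 2 * b)]
  have h2 : -1 ≤ b ∧ b ≤ 1 := by constructor <;> nlinarith [sq_nonneg (2 * a + b)]
  obtain ⟨h3, h4⟩ := h1
  obtain ⟨h5, h6⟩ := h2
  interval_cases a <;> interval_cases b <;> simp_all

theorem int_eis_add_nonneg (a b : ℤ) : 0 ≤ a ^ 2 + a * b + b ^ 2 + (a + b) := by
  nlinarith [sq_nonneg (2 * a + b + 1), sq_nonneg (3 * b + 1)]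

theorem int_eis_add_eq_zero {a b : ℤ} (h : a ^ 2 + a * b + b ^ 2 + (a + b) = 0) :
    (a = 0 ∧ b = 0) ∨ (a = -1 ∧ b = 0) ∨ (a = 0 ∧ b = -1) := by
  have h1 : -1 ≤ a ∧ a ≤ 0 := by
    constructor <;> nlinarith [sq_nonneg (a + 2 * b + 1), sq_nonneg (3 * a + 1)]
  have h2 : -1 ≤ b ∧ b ≤ 0 := by
    constructor <;> nlinarith [sq_nonneg (2 * a + b + 1), sq_nonneg (3 * b + 1)]
  obtain ⟨h3, h4⟩ := h1
  obtain ⟨h5, h6⟩ := h2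
  interval_cases a <;> interval_cases b <;> simp_all

/-- The expression arises from the product of two dual circles in triangles of opposite orientation,
which is `-7` minus six times it, up to the signs of `a` and `b`. The minimal value `-1` is thus
tangency, attained at the three neighbours. -/
theorem int_eis_two_nonneg (a b : ℤ) : -1 ≤ a ^ 2 + a * b + b ^ 2 + 2 * (a + b) := by
  nlinarith [sq_nonneg (2 * a + b + 2), sq_nonneg (3 * b + 2)]

theorem int_eis_two_eq {a b : ℤ} (h : a ^ 2 + a * b + b ^ 2 + 2 * (a + b) = -1) :
    (a = -1 ∧ b = 0) ∨ (a = 0 ∧ b = -1) ∨ (a = -1 ∧ b = -1) := by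
  have h1 : -1 ≤ a ∧ a ≤ 0 := by
    constructor <;> nlinarith [sq_nonneg (a + 2 * b + 2), sq_nonneg (3 * a + 2)]
  have h2 : -1 ≤ b ∧ b ≤ 0 := by
    constructor <;> nlinarith [sq_nonneg (2 * a + b + 2), sq_nonneg (3 * b + 2)]
  obtain ⟨h3, h4⟩ := h1
  obtain ⟨h5, h6⟩ := h2
  interval_cases a <;> interval_cases b <;> simp_all

theorem tri_tangent {m n m' n' : ℤ} (h : inversive (triCircle m n) (triCircle m' n') = -1) :
    (m' = m + 1 ∧ n' = n) ∨ (m' = m - 1 ∧ n' = n) ∨ (m' = m ∧ n' = n + 1) ∨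
      (m' = m ∧ n' = n - 1) ∨ (m' = m + 1 ∧ n' = n - 1) ∨ (m' = m - 1 ∧ n' = n + 1) := by
  rw [inversive_tri] at h
  have h1 : (m' - m) ^ 2 + (m' - m) * (n' - n) + (n' - n) ^ 2 = 1 := by
    have : (1 - 2 * ((m' - m) ^ 2 + (m' - m) * (n' - n) + (n' - n) ^ 2) : ℤ) = -1 := by
      exact_mod_cast h
    omega
  have := int_eis_eq_one h1
  omega

theorem triDual_inversive_le {m n e m' n' e' : ℤ} (he : e = 1 ∨ e = -1) (he' : e' = 1 ∨ e' = -1)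
    (hne : triDualCircle m n e ≠ triDualCircle m' n' e') :
    inversive (triDualCircle m n e) (triDualCircle m' n' e') ≤ -1 ∧
    (inversive (triDualCircle m n e) (triDualCircle m' n' e') = -1 → e' = -e ∧
      ((m' = m + e ∧ n' = n) ∨ (m' = m ∧ n' = n + e) ∨ (m' = m + e ∧ n' = n + e))) := by
  rw [inversive_triDual]
  obtain ⟨a, rfl⟩ : ∃ a, m' = m + a := ⟨m' - m, by ring⟩
  obtain ⟨b, rfl⟩ : ∃ b, n' = n + b := ⟨n' - n, by ring⟩
  simp only [add_sub_cancel_left]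
  have h0 : e = e' → ¬(a = 0 ∧ b = 0) := by
    rintro rfl ⟨rfl, rfl⟩
    simp at hne
  obtain ⟨v, hv⟩ : ∃ v, v = 1 - 6 * (a ^ 2 + a * b + b ^ 2) - 6 * ((e' - e) * (a + b))
    - 2 * (e' - e) ^ 2 := ⟨_, rfl⟩
  rw [← hv]
  have key : v ≤ -1 ∧ (v = -1 → e' = -e ∧
      ((m + a = m + e ∧ n + b = n) ∨ (m + a = m ∧ n + b = n + e) ∨
        (m + a = m + e ∧ n + b = n + e))) := by
    rcases he with rfl | rfl <;> rcases he' with rfl | rfl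
    · have := int_eis_pos (h0 rfl)
      refine ⟨by linarith, fun h => by exfalso; linarith⟩
    · have h1 := int_eis_two_nonneg (-a) (-b)
      refine ⟨by linarith, fun h => ⟨rfl, ?_⟩⟩
      have h2 := int_eis_two_eq (a := -a) (b := -b) (by linarith)
      omega
    · have h1 := int_eis_two_nonneg a b
      refine ⟨by linarith, fun h => ⟨rfl, ?_⟩⟩
      have h2 := int_eis_two_eq (a := a) (b := b) (by linarith)
      omega
    · have := int_eis_pos (h0 rfl)
      refine ⟨by linarith, fun h => by exfalso; linarith⟩
  exact ⟨by exact_mod_cast key.1, fun h => key.2 (by exact_mod_cast h)⟩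

theorem int_eis_mul_nonneg {e : ℤ} (he : e = 1 ∨ e = -1) (a b : ℤ) :
    0 ≤ a ^ 2 + a * b + b ^ 2 + e * (a + b) := by
  have h1 := int_eis_add_nonneg a b
  have h2 := int_eis_add_nonneg (-a) (-b)
  rcases he with rfl | rfl <;> linarith

theorem tri_orthogonal {m n M N e : ℤ} (he : e = 1 ∨ e = -1)
    (h : inversive (triCircle m n) (triDualCircle M N e) = 0) :
    (m = M ∧ n = N) ∨ (m = M + e ∧ n = N) ∨ (m = M ∧ n = N + e) := by
  rw [inversive_tri_dual _ _ _ _ he] at h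
  have h0 : -2 * √3 ≠ 0 := by simp
  have h1 := (mul_eq_zero.1 h).resolve_left h0
  have h2 : (M - m) ^ 2 + (M - m) * (N - n) + (N - n) ^ 2 + e * ((M - m) + (N - n)) = 0 := by
    exact_mod_cast h1
  rcases he with rfl | rfl
  · have := int_eis_add_eq_zero (a := M - m) (b := N - n) (by linarith)
    omega
  · have := int_eis_add_eq_zero (a := m - M) (b := n - N) (by linarith)
    omega

theorem tri_corner (M N : ℤ) {e : ℤ} (he : e = 1 ∨ e = -1) :
    inversive (triCircle M N) (triDualCircle M N e) = 0 ∧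
    inversive (triCircle (M + e) N) (triDualCircle M N e) = 0 ∧
    inversive (triCircle M (N + e)) (triDualCircle M N e) = 0 := by
  simp only [inversive_tri_dual _ _ _ _ he]
  rcases he with rfl | rfl <;> norm_num

theorem curv_triCircle (m n : ℤ) : (triCircle m n).curv = 2 := by
  rw [triCircle, curv_ofCenter]; norm_num

theorem curv_triDualCircle (m n e : ℤ) : (triDualCircle m n e).curv = 1 / (√3 / 6) := rfl

theorem center_triCircle (m n : ℤ) : (triCircle m n).center = eis m n := center_ofCenter _ _ _

theorem center_triDualCircle (m n e : ℤ) :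
    (triDualCircle m n e).center = eis (m + e / 3) (n + e / 3) := center_ofCenter _ _ _

theorem eis_bound {x y R : ℝ} (h : ‖eis x y‖ ≤ R) : |x| ≤ 2 * R ∧ |y| ≤ 2 * R := by
  have h0 := (norm_nonneg _).trans h
  have h1 := eis_dist_sq x y 0 0
  have h2 : eis 0 0 = 0 := by simp [eis]
  rw [h2, sub_zero] at h1
  have h3 : ‖eis x y‖ ^ 2 ≤ R ^ 2 := pow_le_pow_left₀ (norm_nonneg _) h 2
  constructor <;> refine abs_le_of_sq_le_sq ?_ (by linarith)
  · nlinarith [sq_nonneg (x + 2 * y)]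
  · nlinarith [sq_nonneg (2 * x + y)]

theorem tri_finite (R : ℝ) : {c ∈ triangularBase | ‖c.center‖ ≤ R}.Finite := by
  refine (finite_of_coordinates (f := triCircle) (fun R => ⟨⌈2 * R⌉, fun m n h => ?_⟩) R).subset
    fun c hc => ⟨mem_triangularBase.1 hc.1, hc.2⟩
  rw [center_triCircle] at h
  obtain ⟨h1, h2⟩ := eis_bound h
  exact ⟨by exact_mod_cast h1.trans (Int.le_ceil _), by exact_mod_cast h2.trans (Int.le_ceil _)⟩

theorem triDual_finite (R : ℝ) : {c ∈ triangularDual | ‖c.center‖ ≤ R}.Finite := by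
  have key : ∀ e : ℤ, (e = 1 ∨ e = -1) → ∀ R : ℝ, ∃ K : ℤ, ∀ m n : ℤ,
      ‖(triDualCircle m n e).center‖ ≤ R → |m| ≤ K ∧ |n| ≤ K := by
    refine fun e he R => ⟨⌈2 * R + 1⌉, fun m n h => ?_⟩
    rw [center_triDualCircle] at h
    obtain ⟨h1, h2⟩ := eis_bound h
    have h3 : ∀ k : ℤ, |(k : ℝ) + e / 3| ≤ 2 * R → |k| ≤ ⌈2 * R + 1⌉ := by
      intro k hk
      have h3 : |(k : ℝ)| ≤ 2 * R + 1 := by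
        rw [abs_le] at hk ⊢
        rcases he with rfl | rfl <;> norm_num at hk ⊢ <;> constructor <;> linarith
      exact_mod_cast h3.trans (Int.le_ceil _)
    exact ⟨h3 m h1, h3 n h2⟩
  refine ((finite_of_coordinates (key 1 (Or.inl rfl)) R).union
    (finite_of_coordinates (key (-1) (Or.inr rfl)) R)).subset ?_
  rintro c ⟨⟨m, n, e, rfl | rfl, rfl⟩, hR⟩
  · exact Or.inl ⟨⟨m, n, rfl⟩, hR⟩
  · exact Or.inr ⟨⟨m, n, rfl⟩, hR⟩

theorem tri_edge (m n : ℤ) {e : ℤ} (he : e = 1 ∨ e = -1) :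
    inversive (triCircle m n) (triCircle (m + e) n) = -1 ∧
    inversive (triCircle m n) (triCircle m (n + e)) = -1 ∧
    inversive (triCircle (m + e) n) (triCircle m (n + e)) = -1 := by
  simp only [inversive_tri]
  rcases he with rfl | rfl <;> norm_num

theorem tri_config : Config triangularBase triangularDual where
  one_le_curv := by
    intro c hc
    obtain ⟨m, n, rfl⟩ := mem_triangularBase.1 hc
    rw [curv_triCircle]; norm_num
  one_le_curv' := by
    rintro _ ⟨m, n, e, he, rfl⟩
    rw [curv_triDualCircle, one_le_div (by positivity)]
    nlinarith [sqrt_three_sq, Real.sqrt_nonneg 3]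
  inv_le := by
    intro c hc c' hc' hne
    obtain ⟨m, n, rfl⟩ := mem_triangularBase.1 hc
    obtain ⟨m', n', rfl⟩ := mem_triangularBase.1 hc'
    rw [inversive_tri]
    have := int_eis_pos (a := m' - m) (b := n' - n) (by
      rintro ⟨h1, h2⟩
      rw [sub_eq_zero] at h1 h2
      rw [h1, h2] at hne
      exact hne rfl)
    exact_mod_cast (by linarith :
      (1 - 2 * ((m' - m) ^ 2 + (m' - m) * (n' - n) + (n' - n) ^ 2) : ℤ) ≤ -1)
  inv_le' := by
    rintro _ ⟨m, n, e, he, rfl⟩ _ ⟨m', n', e', he', rfl⟩ hne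
    exact (triDual_inversive_le he he' hne).1
  inv_dual := by
    rintro c hc _ ⟨M, N, e, he, rfl⟩
    obtain ⟨m, n, rfl⟩ := mem_triangularBase.1 hc
    rw [inversive_tri_dual _ _ _ _ he]
    rcases (int_eis_mul_nonneg he (M - m) (N - n)).eq_or_lt with h | h
    · left
      rw [← h]; simp
    · right
      have h1 : (1 : ℝ) ≤ (((M - m) ^ 2 + (M - m) * (N - n) + (N - n) ^ 2 +
          e * ((M - m) + (N - n)) : ℤ) : ℝ) := by exact_mod_cast h
      have h2 : 1 < √3 := Real.lt_sqrt_of_sq_lt (by norm_num)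
      nlinarith
  infinite := by
    refine (infinite_range_of_injective (f := fun m : ℤ => triCircle m 0) fun m m' h => ?_).mono ?_
    · have := congrArg center h
      simp only [center_triCircle] at this
      have := congrArg Complex.re this
      rw [eis_re, eis_re] at this
      simpa using this
    · rintro _ ⟨m, rfl⟩
      exact triCircle_mem m 0
  finite := tri_finite
  finite' := triDual_finite
  edge_face := by
    intro c hc c' hc' h
    obtain ⟨m, n, rfl⟩ := mem_triangularBase.1 hc
    obtain ⟨m', n', rfl⟩ := mem_triangularBase.1 hc'
    have he : (1 : ℤ) = 1 ∨ (1 : ℤ) = -1 := Or.inl rfl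
    rcases tri_tangent h with ⟨rfl, rfl⟩ | ⟨rfl, rfl⟩ | ⟨rfl, rfl⟩ | ⟨rfl, rfl⟩ | ⟨rfl, rfl⟩ |
      ⟨rfl, rfl⟩
    · exact ⟨_, triDualCircle_mem he m n', by simp [inversive_tri_dual _ _ _ _ he]⟩
    · exact ⟨_, triDualCircle_mem he (m - 1) n', by simp [inversive_tri_dual _ _ _ _ he]⟩
    · exact ⟨_, triDualCircle_mem he m' n, by simp [inversive_tri_dual _ _ _ _ he]⟩
    · exact ⟨_, triDualCircle_mem he m' (n - 1), by simp [inversive_tri_dual _ _ _ _ he]⟩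
    · exact ⟨_, triDualCircle_mem he m (n - 1), by simp [inversive_tri_dual _ _ _ _ he]⟩
    · exact ⟨_, triDualCircle_mem he (m - 1) n, by simp [inversive_tri_dual _ _ _ _ he]⟩
  face_adj := by
    rintro _ ⟨M, N, e, he, rfl⟩ c ⟨hc, h1⟩ c' ⟨hc', h2⟩ h
    obtain ⟨m, n, rfl⟩ := mem_triangularBase.1 hc
    obtain ⟨m', n', rfl⟩ := mem_triangularBase.1 hc'
    have h1 := tri_orthogonal he h1
    have h2 := tri_orthogonal he h2
    have h := tri_tangent h
    have he' : -e = 1 ∨ -e = -1 := by omega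
    -- Again the point reflection in the midpoint of the edge, which reverses the orientation of the
    -- triangle.
    refine ⟨_, triDualCircle_mem he' (m + m' - M) (n + n' - N), ?_⟩
    simp only [inversive_triDual, inversive_tri_dual _ _ _ _ he']
    rcases h1 with ⟨rfl, rfl⟩ | ⟨rfl, rfl⟩ | ⟨rfl, rfl⟩ <;>
      rcases h2 with ⟨rfl, rfl⟩ | ⟨rfl, rfl⟩ | ⟨rfl, rfl⟩ <;>
      rcases he with rfl | rfl <;>
      first
      | exfalso; omega
      | refine ⟨?_, ?_, ?_⟩ <;> · push_cast; ring
  edge' := by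
    rintro _ ⟨m, n, e, he, rfl⟩ _ ⟨m', n', e', he', rfl⟩ h
    obtain ⟨rfl, hmn⟩ :=
      (triDual_inversive_le he he' (FlagTiling.ne_of_inversive h)).2 h
    obtain ⟨c1, c2, c3⟩ := tri_corner m n he
    obtain ⟨d1, d2, d3⟩ := tri_corner m' n' he'
    obtain ⟨t1, t2, t3⟩ := tri_edge m n he
    rcases hmn with ⟨rfl, rfl⟩ | ⟨rfl, rfl⟩ | ⟨rfl, rfl⟩
    · refine ⟨_, triCircle_mem m n', _, triCircle_mem (m + e) n', t1, c1, ?_, c2, d1⟩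
      simpa using d2
    · refine ⟨_, triCircle_mem m' n, _, triCircle_mem m' (n + e), t2, c1, ?_, c3, d1⟩
      simpa using d3
    · refine ⟨_, triCircle_mem (m + e) n, _, triCircle_mem m (n + e), t3, c2, ?_, c3, ?_⟩
      · simpa using d3
      · simpa using d2

theorem mem_face_tri {M N e : ℤ} (he : e = 1 ∨ e = -1) {c : OrientedCircle} :
    c ∈ face triangularBase (triDualCircle M N e) ↔
      c = triCircle M N ∨ c = triCircle (M + e) N ∨ c = triCircle M (N + e) := by
  obtain ⟨h1, h2, h3⟩ := tri_corner M N he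
  constructor
  · rintro ⟨hc, hd⟩
    obtain ⟨m, n, rfl⟩ := mem_triangularBase.1 hc
    obtain ⟨rfl, rfl⟩ | ⟨rfl, rfl⟩ | ⟨rfl, rfl⟩ := tri_orthogonal he hd <;> simp
  · rintro (rfl | rfl | rfl)
    · exact ⟨triCircle_mem _ _, h1⟩
    · exact ⟨triCircle_mem _ _, h2⟩
    · exact ⟨triCircle_mem _ _, h3⟩

theorem tri_polyFace : ∀ d ∈ triangularDual, PolyFace triangularBase 1 d := by
  rintro _ ⟨M, N, e, he, rfl⟩
  obtain ⟨h1, h2, h3⟩ := tri_edge M N he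
  refine IsTriangle.polyFace ⟨triCircle M N, triCircle (M + e) N, triCircle M (N + e), ?_, h1, h3,
    h2⟩
  ext c
  rw [mem_face_tri he]
  rfl

theorem tri_face_nonempty : ∀ d ∈ triangularDual, (face triangularBase d).Nonempty := by
  rintro _ ⟨M, N, e, he, rfl⟩
  exact ⟨_, (mem_face_tri he).2 (Or.inl rfl)⟩

theorem exists_eis (z : ℂ) : ∃ x y : ℝ, z = eis x y := by
  have h : √3 ≠ 0 := by positivity
  refine ⟨z.re - z.im / √3, z.im * 2 / √3, Complex.ext ?_ ?_⟩
  · rw [eis_re]; ring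
  · rw [eis_im]; field_simp

theorem tri_cover : TriangleCover triangularBase triangularDual := by
  intro z
  obtain ⟨x, y, rfl⟩ := exists_eis z
  obtain ⟨f, hf⟩ : ∃ f, f = x - ⌊x⌋ := ⟨_, rfl⟩
  obtain ⟨g, hg⟩ : ∃ g, g = y - ⌊y⌋ := ⟨_, rfl⟩
  have f0 : 0 ≤ f := by rw [hf]; linarith [Int.floor_le x]
  have f1 : f ≤ 1 := by rw [hf]; linarith [Int.lt_floor_add_one x]
  have g0 : 0 ≤ g := by rw [hg]; linarith [Int.floor_le y]
  have g1 : g ≤ 1 := by rw [hg]; linarith [Int.lt_floor_add_one y]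
  obtain ⟨m, hm⟩ : ∃ m, m = ⌊x⌋ := ⟨_, rfl⟩
  obtain ⟨n, hn⟩ : ∃ n, n = ⌊y⌋ := ⟨_, rfl⟩
  rw [← hm] at hf
  rw [← hn] at hg
  have hx : x = m + f := by linarith
  have hy : y = n + g := by linarith
  have key : ∀ M N e : ℤ, (e = 1 ∨ e = -1) → InTriangle (triCircle M N).center
      (triCircle (M + e) N).center (triCircle M (N + e)).center (eis x y) →
      ∃ d ∈ triangularDual, ∃ c₁ ∈ face triangularBase d, ∃ c₂ ∈ face triangularBase d,
        ∃ c₃ ∈ face triangularBase d, inversive c₁ c₂ = -1 ∧ inversive c₂ c₃ = -1 ∧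
          inversive c₁ c₃ = -1 ∧ InTriangle c₁.center c₂.center c₃.center (eis x y) := by
    intro M N e he h
    obtain ⟨h1, h2, h3⟩ := tri_edge M N he
    exact ⟨_, triDualCircle_mem he M N, _, (mem_face_tri he).2 (Or.inl rfl), _,
      (mem_face_tri he).2 (Or.inr (Or.inl rfl)), _, (mem_face_tri he).2 (Or.inr (Or.inr rfl)),
      h1, h3, h2, h⟩
  -- The diagonal of the unit cell separates the triangle at the corner `(m, n)` with `e = 1` from
  -- the triangle at the opposite corner with `e = -1`.
  rcases le_total (f + g) 1 with h | h
  · refine key m n 1 (Or.inl rfl) (InTriangle.mk (α := 1 - f - g) (β := f) (by linarith) f0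
      (by linarith) ?_)
    simp only [center_triCircle, eis, hx, hy]
    push_cast; ring
  · refine key (m + 1) (n + 1) (-1) (Or.inr rfl) (InTriangle.mk (α := f + g - 1) (β := 1 - f)
      (by linarith) (by linarith) (by linarith) ?_)
    simp only [center_triCircle, eis, hx, hy]
    push_cast; ring

theorem isometry_centroid (k : ℂ ≃ᵢ ℂ) (x y z : ℂ) :
    k ((x + y + z) / 3) = (k x + k y + k z) / 3 := by
  have h : (x + y + z) / 3 = (1 / 3 : ℝ) • (x + y + z) := by
    rw [Complex.real_smul]; push_cast; ring
  rw [isometry_apply k x, isometry_apply k y, isometry_apply k z, isometry_apply, h,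
    _root_.map_smul, map_add, map_add, Complex.real_smul]
  push_cast; ring

/-- A dual centre is the centroid of the centres of three mutually tangent base circles; isometries
preserve such triples and their centroids. -/
theorem tri_stabilizer_le : MulAction.stabilizer (ℂ ≃ᵢ ℂ) triangularBase ≤
    MulAction.stabilizer (ℂ ≃ᵢ ℂ) triangularDual := by
  refine mem_stabilizer_of_subgroup ?_
  rintro k hk _ ⟨M, N, e, he, rfl⟩
  have hm : ∀ m n, ∃ m' n', k • triCircle m n = triCircle m' n' := fun m n =>
    mem_triangularBase.1 ((mem_of_stabilizer hk _).2 (triCircle_mem m n))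
  obtain ⟨t1, t2, t3⟩ := tri_edge M N he
  obtain ⟨m₁, n₁, h1⟩ := hm M N
  obtain ⟨m₂, n₂, h2⟩ := hm (M + e) N
  obtain ⟨m₃, n₃, h3⟩ := hm M (N + e)
  have p : ∀ m n, 0 < (triCircle m n).curv := fun m n => by rw [curv_triCircle]; exact two_pos
  have q : ∀ m n e, 0 < (triDualCircle m n e).curv := fun m n e => by
    rw [curv_triDualCircle]; positivity
  rw [← inversive_smul k, h1, h2] at t1
  rw [← inversive_smul k, h1, h3] at t2
  rw [← inversive_smul k, h2, h3] at t3
  have t1 := tri_tangent t1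
  have t2 := tri_tangent t2
  have t3 := tri_tangent t3
  have h6 : (triDualCircle M N e).center = ((triCircle M N).center +
      (triCircle (M + e) N).center + (triCircle M (N + e)).center) / 3 := by
    simp only [center_triDualCircle, center_triCircle, eis]
    push_cast; ring
  have h7 : (k • triDualCircle M N e).center = ((triCircle m₁ n₁).center +
      (triCircle m₂ n₂).center + (triCircle m₃ n₃).center) / 3 := by
    rw [center_smul k (q M N e), h6, isometry_centroid, ← center_smul k (p _ _), h1,
      ← center_smul k (p _ _), h2, ← center_smul k (p _ _), h3]
  obtain ⟨a, b, f, hf, e1, e2⟩ : ∃ a b f : ℤ, (f = 1 ∨ f = -1) ∧ m₁ + m₂ + m₃ = 3 * a + f ∧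
      n₁ + n₂ + n₃ = 3 * b + f := by
    -- The coordinate sums of a unit triangle are both `1` or both `-1` modulo three, according to
    -- its orientation.
    have : ((m₁ + m₂ + m₃) % 3 = 1 ∧ (n₁ + n₂ + n₃) % 3 = 1) ∨
        ((m₁ + m₂ + m₃) % 3 = 2 ∧ (n₁ + n₂ + n₃) % 3 = 2) := by omega
    rcases this with ⟨h, h'⟩ | ⟨h, h'⟩
    · exact ⟨(m₁ + m₂ + m₃) / 3, (n₁ + n₂ + n₃) / 3, 1, Or.inl rfl, by omega, by omega⟩
    · exact ⟨(m₁ + m₂ + m₃) / 3 + 1, (n₁ + n₂ + n₃) / 3 + 1, -1, Or.inr rfl, by omega, by omega⟩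
  refine ⟨a, b, f, hf, ext_center (q M N e) rfl ?_⟩
  rw [h7]
  simp only [center_triDualCircle, center_triCircle, eis]
  have e1' : (m₁ + m₂ + m₃ : ℂ) = 3 * a + f := by exact_mod_cast e1
  have e2' : (n₁ + n₂ + n₃ : ℂ) = 3 * b + f := by exact_mod_cast e2
  push_cast
  linear_combination e1' / 3 + e2' * ((1 + Complex.I * (√3 : ℂ)) / 2) / 3

/-- An isometry that preserves the centres of the circles preserves `triangularBase`. -/
theorem tri_smul_mem {k : ℂ ≃ᵢ ℂ}
    (h : ∀ m n : ℤ, ∃ m' n' : ℤ, k (eis m n) = eis m' n') :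
    ∀ c ∈ triangularBase, k • c ∈ triangularBase := by
  intro c hc
  obtain ⟨m, n, rfl⟩ := mem_triangularBase.1 hc
  obtain ⟨m', n', h'⟩ := h m n
  refine mem_triangularBase.2 ⟨m', n', ?_⟩
  rw [triCircle, smul_ofCenter]
  simp only [h', triCircle]

end OrientedCircle

/-! ### Moebius symmetries of a flag tiling -/

theorem ball_center_unique {p q : ℂ} {r : ℝ} (hr : 0 < r) (h : Metric.ball p r = Metric.ball q r) :
    p = q := by
  by_contra hne
  have h0 : 0 < ‖p - q‖ := norm_pos_iff.2 (sub_ne_zero.2 hne)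
  have h1 : ‖p - q‖ < r := by
    have : p ∈ Metric.ball q r := h ▸ Metric.mem_ball_self hr
    rwa [Metric.mem_ball, dist_eq_norm] at this
  -- The point beyond `p`, as seen from `q`, at distance `r - ‖p - q‖ / 2` from `p`: it lies in the
  -- first ball, but at distance `r + ‖p - q‖ / 2` from `q`.
  set s := (r - ‖p - q‖ / 2) / ‖p - q‖ with hs
  have s0 : 0 < s := div_pos (by linarith) h0
  have hs' : s * ‖p - q‖ = r - ‖p - q‖ / 2 := div_mul_cancel₀ _ h0.ne'
  have h2 : p + s * (p - q) ∈ Metric.ball p r := by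
    rw [Metric.mem_ball, dist_eq_norm, add_sub_cancel_left, norm_mul, Complex.norm_real,
      Real.norm_of_nonneg s0.le, hs']
    linarith
  rw [h, Metric.mem_ball, dist_eq_norm] at h2
  have h3 : p + s * (p - q) - q = (1 + s : ℝ) * (p - q) := by push_cast; ring
  rw [h3, norm_mul, Complex.norm_real, Real.norm_of_nonneg (by linarith)] at h2
  linarith

namespace OrientedCircle

theorem interior_eq_ball {c : OrientedCircle} (hc : 0 < c.curv) :
    c.interior = ((↑) : ℂ → OnePoint ℂ) '' Metric.ball c.center (1 / c.curv) := by
  ext w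
  cases w with
  | infty => simp [infty_notMem_interior hc]
  | coe z =>
    have h : (0 : ℝ) ≤ 1 / c.curv := by positivity
    rw [mem_interior_coe, form_eq_mul_power hc, power_eq_dist hc,
      (OnePoint.coe_injective).mem_set_image, Metric.mem_ball, dist_eq_norm,
      mul_neg_iff, and_iff_right hc, or_iff_left (fun h => hc.not_gt h.1), sub_neg, ← one_div_pow]
    exact pow_lt_pow_iff_left₀ (norm_nonneg _) h two_ne_zero

theorem interior_injective {c d : OrientedCircle} (hc : 0 < c.curv) (hd : 0 < d.curv)
    (h : c.interior = d.interior) : c = d := by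
  rw [interior_eq_ball hc, interior_eq_ball hd, OnePoint.coe_injective.image_injective.eq_iff] at h
  have hc' : 0 < 1 / c.curv := by positivity
  have h1 := congrArg Metric.diam h
  rw [Metric.diam_ball_eq _ hc'.le, Metric.diam_ball_eq _ (by positivity)] at h1
  have h2 : 1 / c.curv = 1 / d.curv := by linarith
  rw [← h2] at h
  refine ext_center hc ?_ (ball_center_unique hc' h)
  simpa using h2

theorem image_interior {f : OnePoint ℂ → OnePoint ℂ} {k : ℂ ≃ᵢ ℂ} {ρ : ℝ} (hρ : 0 < ρ)
    (hf : ∀ z : ℂ, f z = ((ρ * k z : ℂ) : OnePoint ℂ)) {c : OrientedCircle} (hc : 0 < c.curv) :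
    f '' c.interior =
      ((↑) : ℂ → OnePoint ℂ) '' Metric.ball (ρ * k c.center) (ρ / c.curv) := by
  have h1 := k.image_ball c.center (1 / c.curv)
  have h2 := smul_ball hρ.ne' (k c.center) (1 / c.curv)
  rw [Complex.real_smul, Real.norm_of_nonneg hρ.le, mul_one_div] at h2
  rw [interior_eq_ball hc, ← h2, ← h1, image_image, ← image_smul, image_image, image_image]
  simp only [hf, Complex.real_smul]

theorem image_interior_isometry {f : OnePoint ℂ → OnePoint ℂ} {k : ℂ ≃ᵢ ℂ}
    (hf : ∀ z : ℂ, f z = (k z : OnePoint ℂ)) {c : OrientedCircle} (hc : 0 < c.curv) :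
    f '' c.interior = (k • c).interior := by
  rw [image_interior (k := k) one_pos (by simpa using hf) hc, interior_eq_ball (by rwa [curv_smul]),
    center_smul k hc, curv_smul]
  simp

end OrientedCircle

open OrientedCircle

/-- The image of `z` differs from the image of `∞` by a constant divided by the denominator, which
is large for large `z`. The radius is chosen to make this quotient at most one. -/
theorem gl_smul_far (g : GL (Fin 2) ℂ) (h : g • (∞ : OnePoint ℂ) ≠ ∞) :
    ∃ (a : ℂ) (R : ℝ), ∀ z : ℂ, R ≤ ‖z‖ → ∃ y : ℂ, g • (z : OnePoint ℂ) = y ∧ ‖y - a‖ ≤ 1 := by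
  have hc : g 1 0 ≠ 0 := fun h' => h (OnePoint.smul_infty_eq_self_iff.2 h')
  have hc' := norm_pos_iff.2 hc
  set D := g 0 1 * g 1 0 - g 0 0 * g 1 1 with hD
  refine ⟨g 0 0 / g 1 0, (‖D‖ / ‖g 1 0‖ + ‖g 1 1‖ + 1) / ‖g 1 0‖, fun z hz => ?_⟩
  rw [div_le_iff₀ hc', ← norm_mul] at hz
  have h1 : ‖D‖ / ‖g 1 0‖ + 1 ≤ ‖g 1 0 * z + g 1 1‖ := by
    have := norm_sub_le (g 1 0 * z + g 1 1) (g 1 1)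
    rw [add_sub_cancel_right] at this
    rw [mul_comm] at hz
    linarith
  have h2 : 0 ≤ ‖D‖ / ‖g 1 0‖ := by positivity
  have h3 : 0 < ‖g 1 0 * z + g 1 1‖ := by linarith
  have h4 : g 1 0 * z + g 1 1 ≠ 0 := norm_pos_iff.1 h3
  refine ⟨(g 0 0 * z + g 0 1) / (g 1 0 * z + g 1 1), ?_, ?_⟩
  · rw [OnePoint.smul_some_eq_ite, if_neg h4]
  · have h5 : (g 0 0 * z + g 0 1) / (g 1 0 * z + g 1 1) - g 0 0 / g 1 0 =
        D / g 1 0 / (g 1 0 * z + g 1 1) := by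
      rw [hD, div_sub_div _ _ h4 hc, div_div, mul_comm (g 1 0)]
      ring
    rw [h5, norm_div, norm_div, div_le_one h3]
    linarith

theorem moebius_far {f : Equiv.Perm (OnePoint ℂ)} (hf : f ∈ moebiusGroup) (h : f ∞ ≠ ∞) :
    ∃ (a : ℂ) (R : ℝ), ∀ z : ℂ, R ≤ ‖z‖ → ∃ y : ℂ, f z = y ∧ ‖y - a‖ ≤ 1 := by
  obtain ⟨g, hg | hg⟩ := hf
  · rw [hg] at h
    obtain ⟨a, R, hR⟩ := gl_smul_far g h
    exact ⟨a, R, fun z hz => by rw [hg]; exact hR z hz⟩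
  · rw [hg, OnePoint.map_infty] at h
    obtain ⟨a, R, hR⟩ := gl_smul_far g h
    exact ⟨a, R, fun z hz => by
      rw [hg, OnePoint.map_some]; exact hR _ (by rwa [RCLike.norm_conj])⟩

/-- The ratio is factored out in front of the translation as well, so that the bracket is an
isometry and all scaling sits in one positive number. -/
theorem gl_smul_affine (g : GL (Fin 2) ℂ) (h : g • (∞ : OnePoint ℂ) = ∞) :
    ∃ (ρ : ℝ) (u : Circle) (t : ℂ), 0 < ρ ∧
      ∀ z : ℂ, g • (z : OnePoint ℂ) = ((ρ * (u * z + t) : ℂ) : OnePoint ℂ) := by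
  have hc : g 1 0 = 0 := OnePoint.smul_infty_eq_self_iff.1 h
  have hdet : g 0 0 * g 1 1 ≠ 0 := by
    have := g.det_ne_zero
    rw [Matrix.det_fin_two] at this
    intro h'
    apply this
    rw [h', hc, mul_zero, sub_zero]
  have ha := left_ne_zero_of_mul hdet
  have hd := right_ne_zero_of_mul hdet
  have hq : g 0 0 / g 1 1 ≠ 0 := div_ne_zero ha hd
  have hq' : (‖g 0 0 / g 1 1‖ : ℂ) ≠ 0 := by simpa using hq
  refine ⟨‖g 0 0 / g 1 1‖, ⟨(g 0 0 / g 1 1) / ‖g 0 0 / g 1 1‖, ?_⟩,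
    g 0 1 / g 1 1 / ‖g 0 0 / g 1 1‖, norm_pos_iff.2 hq, fun z => ?_⟩
  · refine mem_sphere_zero_iff_norm.2 ?_
    rw [norm_div, Complex.norm_real, norm_norm]
    exact div_self (norm_ne_zero_iff.2 hq)
  · rw [OnePoint.smul_some_eq_ite, hc, zero_mul, zero_add, if_neg hd, mul_add, ← mul_assoc,
      mul_div_cancel₀ _ hq', mul_div_cancel₀ _ hq']
    congr 1
    field_simp

theorem moebius_similarity {f : Equiv.Perm (OnePoint ℂ)} (hf : f ∈ moebiusGroup) (h : f ∞ = ∞) :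
    ∃ (ρ : ℝ) (k : ℂ ≃ᵢ ℂ), 0 < ρ ∧ ∀ z : ℂ, f z = ((ρ * k z : ℂ) : OnePoint ℂ) := by
  obtain ⟨g, hg | hg⟩ := hf
  · rw [hg] at h
    obtain ⟨ρ, u, t, hρ, hu⟩ := gl_smul_affine g h
    refine ⟨ρ, (rotation u).toIsometryEquiv.trans (IsometryEquiv.addRight t), hρ, fun z => ?_⟩
    rw [hg, hu]
    simp
  · rw [hg, OnePoint.map_infty] at h
    obtain ⟨ρ, u, t, hρ, hu⟩ := gl_smul_affine g h
    refine ⟨ρ, (Complex.conjLIE.trans (rotation u)).toIsometryEquiv.trans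
      (IsometryEquiv.addRight t), hρ, fun z => ?_⟩
    rw [hg, OnePoint.map_some, hu]
    simp

theorem isometry_mem_moebiusGroup {f : Equiv.Perm (OnePoint ℂ)} {k : ℂ ≃ᵢ ℂ} (h : f ∞ = ∞)
    (hf : ∀ z : ℂ, f z = (k z : OnePoint ℂ)) : f ∈ moebiusGroup := by
  obtain ⟨u, hu⟩ := linear_isometry_complex (linPart k)
  have hdet : (!![(u : ℂ), k 0; 0, 1] : Matrix (Fin 2) (Fin 2) ℂ).det ≠ 0 := by
    rw [Matrix.det_fin_two_of]; simp
  have key : ∀ z : ℂ, (Matrix.GeneralLinearGroup.mkOfDetNeZero _ hdet) • (z : OnePoint ℂ) =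
      ((u * z + k 0 : ℂ) : OnePoint ℂ) := by
    intro z
    rw [OnePoint.smul_some_eq_ite]
    simp [Matrix.GeneralLinearGroup.mkOfDetNeZero]
  have key' : (Matrix.GeneralLinearGroup.mkOfDetNeZero _ hdet) • (∞ : OnePoint ℂ) = ∞ := by
    rw [OnePoint.smul_infty_eq_self_iff]
    simp [Matrix.GeneralLinearGroup.mkOfDetNeZero]
  refine ⟨Matrix.GeneralLinearGroup.mkOfDetNeZero _ hdet, ?_⟩
  rcases hu with hu | hu
  · left
    intro w
    cases w with
    | infty => rw [h, key']
    | coe z => rw [hf, key, isometry_apply, hu, rotation_apply]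
  · right
    intro w
    cases w with
    | infty => rw [h, OnePoint.map_infty, key']
    | coe z =>
      rw [hf, OnePoint.map_some, key, isometry_apply, hu, LinearIsometryEquiv.trans_apply,
        rotation_apply, Complex.conjLIE_apply]

theorem exists_of_mem_moebiusStabilizer {f : Equiv.Perm (OnePoint ℂ)} {S : Set OrientedCircle}
    (hf : f ∈ moebiusStabilizer S) {c : OrientedCircle} (hc : c ∈ S) :
    (∃ d ∈ S, f '' c.interior = d.interior) ∧ ∃ d ∈ S, f '' d.interior = c.interior := by
  have h := MulAction.mem_stabilizer_iff.1 hf.2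
  constructor
  · have : f • c.interior ∈ f • (OrientedCircle.interior '' S) := ⟨_, ⟨c, hc, rfl⟩, rfl⟩
    rw [h] at this
    obtain ⟨d, hd, hd'⟩ := this
    exact ⟨d, hd, hd'.symm⟩
  · have : c.interior ∈ f • (OrientedCircle.interior '' S) := by rw [h]; exact ⟨c, hc, rfl⟩
    obtain ⟨_, ⟨d, hd, rfl⟩, hd'⟩ := this
    exact ⟨d, hd, hd'⟩

theorem mem_moebiusStabilizer_of_isometry {f : Equiv.Perm (OnePoint ℂ)} {k : ℂ ≃ᵢ ℂ} (h : f ∞ = ∞)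
    (hf : ∀ z : ℂ, f z = (k z : OnePoint ℂ)) {S : Set OrientedCircle} (hS : ∀ c ∈ S, 0 < c.curv) :
    f ∈ moebiusStabilizer S ↔ k ∈ MulAction.stabilizer (ℂ ≃ᵢ ℂ) S := by
  constructor
  · intro hfS
    rw [MulAction.mem_stabilizer_set]
    intro c
    constructor
    · intro hc
      have pc : 0 < (k • c).curv := hS _ hc
      obtain ⟨d, hd, hd'⟩ := (exists_of_mem_moebiusStabilizer hfS hc).2
      rw [image_interior_isometry hf (hS d hd)] at hd'
      have hkd : k • d = k • c := interior_injective (hS d hd) pc hd'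
      rw [smul_left_cancel_iff] at hkd
      exact hkd ▸ hd
    · intro hc
      obtain ⟨d, hd, hd'⟩ := (exists_of_mem_moebiusStabilizer hfS hc).1
      rw [image_interior_isometry hf (hS c hc)] at hd'
      rw [interior_injective (show 0 < (k • c).curv from hS c hc) (hS d hd) hd']
      exact hd
  · intro hk
    refine ⟨isometry_mem_moebiusGroup h hf, ?_⟩
    refine MulAction.mem_stabilizer_iff.2 ?_
    ext s
    constructor
    · rintro ⟨_, ⟨c, hc, rfl⟩, rfl⟩
      exact ⟨k • c, (mem_of_stabilizer hk c).2 hc, (image_interior_isometry hf (hS c hc)).symm⟩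
    · rintro ⟨c, hc, rfl⟩
      have hc' : k⁻¹ • c ∈ S := (mem_of_stabilizer (Subgroup.inv_mem _ hk) c).2 hc
      refine ⟨_, ⟨k⁻¹ • c, hc', rfl⟩, ?_⟩
      change f '' _ = _
      rw [image_interior_isometry hf (hS _ hc'), smul_inv_smul]

namespace FlagTiling

variable {C C' B : Set OrientedCircle}

/-- Otherwise the infinitely many circles far from the origin would be mapped injectively to circles
with centres near the image of `∞`, and there are only finitely many of those. -/
theorem moebiusStabilizer_fix_infty (T : FlagTiling C C') {f : Equiv.Perm (OnePoint ℂ)}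
    (hf : f ∈ moebiusStabilizer C) : f ∞ = ∞ := by
  by_contra h
  obtain ⟨a, R, hR⟩ := moebius_far hf.1 h
  have hinf := T.infinite_setOf_le (R + 1)
  choose! φ hφ hφ' using fun c (hc : c ∈ C) => (exists_of_mem_moebiusStabilizer hf hc).1
  have hmaps : MapsTo φ {c ∈ C | R + 1 < ‖c.center‖} {c ∈ C | ‖c.center‖ ≤ ‖a‖ + 1} := by
    rintro c ⟨hc, hcR⟩
    refine ⟨hφ c hc, ?_⟩
    have hd := T.pos (hφ c hc)
    have h1 : ((φ c).center : OnePoint ℂ) ∈ (φ c).interior := by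
      rw [interior_eq_ball hd]
      exact ⟨_, Metric.mem_ball_self (by positivity), rfl⟩
    rw [← hφ' c hc, interior_eq_ball (T.pos hc)] at h1
    obtain ⟨_, ⟨z, hz, rfl⟩, hz'⟩ := h1
    rw [Metric.mem_ball, dist_eq_norm] at hz
    have h2 : 1 / c.curv ≤ 1 := (div_le_one (T.pos hc)).2 (T.one_le_curv c hc)
    have h3 := norm_le_norm_add_norm_sub' c.center z
    rw [norm_sub_rev] at h3
    obtain ⟨y, hy, hya⟩ := hR z (by linarith)
    rw [hz', OnePoint.coe_eq_coe] at hy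
    have h4 := norm_le_norm_add_norm_sub' y a
    rw [hy]
    linarith
  have hinj : InjOn φ {c ∈ C | R + 1 < ‖c.center‖} := by
    rintro c ⟨hc, -⟩ d ⟨hd, -⟩ hcd
    have h1 := hφ' c hc
    rw [hcd, ← hφ' d hd, f.injective.image_injective.eq_iff] at h1
    exact interior_injective (T.pos hc) (T.pos hd) h1
  exact hinf ((T.finite (‖a‖ + 1)).of_injOn hmaps hinj)

/-- The circles of `B` are the largest ones of `C`. This excludes similarities of ratio other than
one, and it makes `B` recognisable inside `C`. -/
theorem symmetryGroup_eq (T : FlagTiling C C') {κ : ℝ} (hB : B ⊆ C) (hne : B.Nonempty)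
    (hκ : ∀ c ∈ B, c.curv = κ) (hC : ∀ c ∈ C, c ∉ B → κ < c.curv) {f : Equiv.Perm (OnePoint ℂ)} :
    f ∈ symmetryGroup C C' ↔ ∃ k : ℂ ≃ᵢ ℂ, k ∈ MulAction.stabilizer (ℂ ≃ᵢ ℂ) B ∧
      k ∈ MulAction.stabilizer (ℂ ≃ᵢ ℂ) C ∧ k ∈ MulAction.stabilizer (ℂ ≃ᵢ ℂ) C' ∧
      f ∞ = ∞ ∧ ∀ z : ℂ, f z = (k z : OnePoint ℂ) := by
  constructor
  · rintro ⟨hf, hf'⟩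
    have hinfty := T.moebiusStabilizer_fix_infty hf
    obtain ⟨ρ, k, hρ, hk⟩ := moebius_similarity hf.1 hinfty
    obtain ⟨c, hc⟩ := hne
    have hle : ∀ c ∈ C, κ ≤ c.curv := fun c hc => by
      by_cases h : c ∈ B
      · exact (hκ c h).ge
      · exact (hC c hc h).le
    have hκ0 : 0 < κ := hκ c hc ▸ T.pos (hB hc)
    have hcurv : ∀ c ∈ C, ∀ d ∈ C, f '' c.interior = d.interior → ρ * d.curv = c.curv := by
      intro c hc d hd h
      have pc := T.pos hc
      have pd := T.pos hd
      rw [image_interior hρ hk pc, interior_eq_ball pd,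
        OnePoint.coe_injective.image_injective.eq_iff] at h
      have h1 := congrArg Metric.diam h
      rw [Metric.diam_ball_eq _ (by positivity), Metric.diam_ball_eq _ (by positivity)] at h1
      field_simp at h1
      linarith
    -- The image and the preimage of a largest circle are no larger than it; each gives one
    -- inequality for the ratio.
    have hρ1 : ρ = 1 := by
      obtain ⟨⟨d, hd, h1⟩, e, he, h2⟩ := exists_of_mem_moebiusStabilizer hf (hB hc)
      have h1 := hcurv c (hB hc) d hd h1
      have h2 := hcurv e he c (hB hc) h2
      rw [hκ c hc] at h1 h2
      have h3 := hle d hd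
      have h4 := hle e he
      refine le_antisymm ?_ ?_
      · by_contra! h; nlinarith
      · by_contra! h; nlinarith
    have hk' : ∀ z : ℂ, f z = (k z : OnePoint ℂ) := fun z => by rw [hk, hρ1]; simp
    have kC := (mem_moebiusStabilizer_of_isometry hinfty hk' (fun c hc => T.pos hc)).1 hf
    refine ⟨k, ?_, kC, (mem_moebiusStabilizer_of_isometry hinfty hk' (fun c hc => T.symm.pos hc)).1 hf',
      hinfty, hk'⟩
    have key : ∀ c ∈ C, c ∈ B ↔ c.curv = κ := fun c hc =>
      ⟨hκ c, fun h => by by_contra h'; exact (hC c hc h').ne' h⟩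
    rw [MulAction.mem_stabilizer_set]
    intro d
    constructor
    · intro hd
      have hdC := (mem_of_stabilizer kC d).1 (hB hd)
      exact (key d hdC).2 (hκ (k • d) hd)
    · intro hd
      exact (key _ ((mem_of_stabilizer kC d).2 (hB hd))).2 (hκ d hd)
  · rintro ⟨k, -, hC, hC', hinfty, hk⟩
    exact ⟨(mem_moebiusStabilizer_of_isometry hinfty hk (fun c hc => T.pos hc)).2 hC,
      (mem_moebiusStabilizer_of_isometry hinfty hk (fun c hc => T.symm.pos hc)).2 hC'⟩

end FlagTiling

/-! ### Point group, translation lattice and lattice charts -/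

/-- The linear part as a homomorphism. -/
noncomputable def linHom : (ℂ ≃ᵢ ℂ) →* (ℂ ≃ₗᵢ[ℝ] ℂ) where
  toFun := linPart
  map_one' := LinearIsometryEquiv.ext linPart_one
  map_mul' k k' := LinearIsometryEquiv.ext (linPart_mul k k')

/-- The point group of a group of isometries of the plane. -/
noncomputable def pointGroup (G : Subgroup (ℂ ≃ᵢ ℂ)) : Subgroup (ℂ ≃ₗᵢ[ℝ] ℂ) := G.map linHom

/-- The lattice of translations in a group of isometries of the plane. -/
def translations (G : Subgroup (ℂ ≃ᵢ ℂ)) : AddSubgroup ℂ where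
  carrier := {v | IsometryEquiv.addRight v ∈ G}
  zero_mem' := by
    have : IsometryEquiv.addRight (0 : ℂ) = 1 := by ext z; simp
    rw [mem_ofPred_eq, this]
    exact G.one_mem
  add_mem' := by
    intro v w hv hw
    have : IsometryEquiv.addRight (v + w) = IsometryEquiv.addRight w * IsometryEquiv.addRight v := by
      ext z; simp [IsometryEquiv.mul_apply, add_assoc]
    rw [mem_ofPred_eq, this]
    exact G.mul_mem hw hv
  neg_mem' := by
    intro v hv
    have : IsometryEquiv.addRight (-v) = (IsometryEquiv.addRight v)⁻¹ := by
      rw [eq_inv_iff_mul_eq_one]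
      ext z; simp [IsometryEquiv.mul_apply]
    rw [mem_ofPred_eq, this]
    exact G.inv_mem hv

variable {G : Subgroup (ℂ ≃ᵢ ℂ)}

theorem mem_translations {v : ℂ} : v ∈ translations G ↔ IsometryEquiv.addRight v ∈ G := Iff.rfl

theorem sub_mem_translations {g h : ℂ ≃ᵢ ℂ} (hg : g ∈ G) (hh : h ∈ G) (e : linPart g = linPart h) :
    g 0 - h 0 ∈ translations G := by
  have : IsometryEquiv.addRight (g 0 - h 0) = g * h⁻¹ := by
    rw [eq_mul_inv_iff_mul_eq]
    ext z
    rw [IsometryEquiv.mul_apply, isometry_apply g z, isometry_apply h z, e,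
      IsometryEquiv.addRight_apply]
    ring
  rw [mem_translations, this]
  exact G.mul_mem hg (G.inv_mem hh)

theorem linPart_mem_translations {g : ℂ ≃ᵢ ℂ} (hg : g ∈ G) {v : ℂ} (hv : v ∈ translations G) :
    linPart g v ∈ translations G := by
  have : IsometryEquiv.addRight (linPart g v) = g * IsometryEquiv.addRight v * g⁻¹ := by
    rw [eq_mul_inv_iff_mul_eq]
    ext z
    have := isometry_sub g (z + v) z
    rw [add_sub_cancel_left] at this
    rw [IsometryEquiv.mul_apply, IsometryEquiv.mul_apply, IsometryEquiv.addRight_apply,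
      IsometryEquiv.addRight_apply, ← this]
    ring
  rw [mem_translations, this]
  exact G.mul_mem (G.mul_mem hg hv) (G.inv_mem hg)

theorem pointGroup_mem_translations {p : ℂ ≃ₗᵢ[ℝ] ℂ} (hp : p ∈ pointGroup G) {v : ℂ}
    (hv : v ∈ translations G) : p v ∈ translations G := by
  obtain ⟨g, hg, rfl⟩ := hp
  exact linPart_mem_translations hg hv

/-- The basis of the plane given by two independent vectors. -/
noncomputable def planeBasis {v w : ℂ} (h : LinearIndependent ℝ ![v, w]) :
    Module.Basis (Fin 2) ℝ ℂ :=
  basisOfLinearIndependentOfCardEqFinrank h (by simp [Complex.finrank_real_complex])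

theorem planeBasis_zero {v w : ℂ} (h : LinearIndependent ℝ ![v, w]) : planeBasis h 0 = v := by
  simp [planeBasis]

theorem planeBasis_one {v w : ℂ} (h : LinearIndependent ℝ ![v, w]) : planeBasis h 1 = w := by
  simp [planeBasis]

theorem exists_coords {v w : ℂ} (h : LinearIndependent ℝ ![v, w]) (z : ℂ) :
    ∃ α β : ℝ, z = α • v + β • w := by
  refine ⟨(planeBasis h).repr z 0, (planeBasis h).repr z 1, ?_⟩
  have := (planeBasis h).sum_repr z
  rw [Fin.sum_univ_two, planeBasis_zero, planeBasis_one] at this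
  exact this.symm

/-- A translation moves all points by the same distance, so the `ε` of discreteness bounds the
length of nonzero translations from below, whatever the compact set is. -/
theorem IsWallpaperGroup.finite_translations (hG : IsWallpaperGroup G) (R : ℝ) :
    {x | x ∈ translations G ∧ ‖x‖ ≤ R}.Finite := by
  obtain ⟨⟨K, -, ε, hε, hK⟩, -⟩ := hG
  have h0 : ∀ x ∈ translations G, x ≠ 0 → ε ≤ ‖x‖ := by
    intro x hx hne
    by_contra! h
    have := hK _ hx (fun z _ => by simpa [dist_eq_norm] using h)
    have := congrArg (fun g : ℂ ≃ᵢ ℂ => g 0) this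
    simp at this
    exact hne this
  have hd : DiscreteTopology (translations G) := by
    refine DiscreteTopology.of_forall_le_dist hε fun x y hxy => ?_
    change ε ≤ dist (x : ℂ) y
    rw [dist_eq_norm]
    exact h0 _ ((translations G).sub_mem x.2 y.2) (sub_ne_zero.2 fun h => hxy (Subtype.ext h))
  have hcl : IsClosed (translations G : Set ℂ) := AddSubgroup.isClosed_of_discrete
  have := Metric.finite_isBounded_inter_isClosed (isDiscrete_iff_discreteTopology.2 hd)
    (Metric.isBounded_closedBall (x := (0 : ℂ)) (r := R)) hcl
  refine this.subset ?_
  rintro x ⟨hx, hR⟩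
  exact ⟨by simpa using hR, hx⟩

/-- A linear isometry is determined by the images of two independent translations, and these are
translations of the same lengths, so there are finitely many choices. -/
theorem IsWallpaperGroup.finite_pointGroup (hG : IsWallpaperGroup G) : Finite (pointGroup G) := by
  obtain ⟨v, w, hvw, hv, hw⟩ := hG.2
  have hf := hG.finite_translations (‖v‖ + ‖w‖)
  have : Finite {x | x ∈ translations G ∧ ‖x‖ ≤ ‖v‖ + ‖w‖} := hf
  let f : pointGroup G → {x | x ∈ translations G ∧ ‖x‖ ≤ ‖v‖ + ‖w‖} ×
      {x | x ∈ translations G ∧ ‖x‖ ≤ ‖v‖ + ‖w‖} := fun p =>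
    (⟨p.1 v, pointGroup_mem_translations p.2 hv, by
        rw [LinearIsometryEquiv.norm_map]; linarith [norm_nonneg w]⟩,
      ⟨p.1 w, pointGroup_mem_translations p.2 hw, by
        rw [LinearIsometryEquiv.norm_map]; linarith [norm_nonneg v]⟩)
  refine Finite.of_injective f fun p q hpq => ?_
  simp only [f, Prod.mk.injEq, Subtype.mk.injEq] at hpq
  refine Subtype.ext (LinearIsometryEquiv.ext fun z => ?_)
  obtain ⟨α, β, rfl⟩ := exists_coords hvw z
  simp only [map_add, _root_.map_smul, hpq.1, hpq.2]

/-- A group with finite point group has a point which each element of the group moves by a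
fraction of a translation in the group, with bounded denominator. -/
theorem exists_origin [Finite (pointGroup G)] : ∃ (n : ℕ) (c : ℂ), n ≠ 0 ∧
    ∀ g ∈ G, (n : ℂ) * (g c - c) ∈ translations G := by
  classical
  have := Fintype.ofFinite (pointGroup G)
  choose s hs hs' using fun p : pointGroup G => p.2
  change ∀ p, s p ∈ G at hs
  change ∀ p, linPart (s p) = p at hs'
  set n := Fintype.card (pointGroup G)
  have hn : n ≠ 0 := Fintype.card_ne_zero
  have hn' : (n : ℂ) ≠ 0 := Nat.cast_ne_zero.2 hn
  -- The origin is the mean of the images of `0` under representatives of the point group. An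
  -- element `g` permutes the summands up to translations of the group, so `n` times its
  -- displacement is a sum of such translations.
  refine ⟨n, (n : ℂ)⁻¹ * ∑ p, s p 0, hn, fun g hg => ?_⟩
  let q : pointGroup G := ⟨linPart g, g, hg, rfl⟩
  have e1 : ∑ p, s p 0 = ∑ p, s (q * p) 0 := (Equiv.sum_comp (Equiv.mulLeft q) fun p => s p 0).symm
  have e2 : linPart g ((n : ℂ)⁻¹ * ∑ p, s p 0) = (n : ℂ)⁻¹ * ∑ p, linPart g (s p 0) := by
    have h : ((n : ℂ)⁻¹ * ∑ p, s p 0) = (n : ℝ)⁻¹ • ∑ p, s p 0 := by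
      rw [Complex.real_smul]; push_cast; rfl
    rw [h, _root_.map_smul, map_sum, Complex.real_smul]; push_cast; rfl
  have e3 : (n : ℂ) * (g ((n : ℂ)⁻¹ * ∑ p, s p 0) - (n : ℂ)⁻¹ * ∑ p, s p 0) =
      ∑ p, ((g * s p) 0 - s (q * p) 0) := by
    rw [isometry_apply, e2, Finset.sum_sub_distrib, ← e1, mul_sub, mul_add, ← mul_assoc, ← mul_assoc,
      mul_inv_cancel₀ hn', one_mul, one_mul]
    congr 1
    simp only [IsometryEquiv.mul_apply]
    rw [Finset.sum_congr rfl fun p _ => isometry_apply g (s p 0), Finset.sum_add_distrib]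
    simp [n]
  rw [e3]
  refine (translations G).sum_mem fun p _ => sub_mem_translations (G.mul_mem hg (hs p)) (hs _) ?_
  rw [hs']
  exact (map_mul linHom g (s p)).trans (by
    change linPart g * linPart (s p) = _
    rw [hs']; rfl)

/-- The lattice generated by `1` and `ξ`. -/
def lat (ξ : ℂ) : AddSubgroup ℂ where
  carrier := {z | ∃ m n : ℤ, z = m + n * ξ}
  zero_mem' := ⟨0, 0, by simp⟩
  add_mem' := by
    rintro _ _ ⟨m, n, rfl⟩ ⟨m', n', rfl⟩
    exact ⟨m + m', n + n', by push_cast; ring⟩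
  neg_mem' := by
    rintro _ ⟨m, n, rfl⟩
    exact ⟨-m, -n, by push_cast; ring⟩

/-- In the affine coordinate `φ`, the elements of the group `G` are isometries which preserve the
lattice generated by `s` and `s * ξ`. -/
def IsLatticeChart (G : Subgroup (ℂ ≃ᵢ ℂ)) (ξ : ℂ) (s : ℝ) (φ : ℂ ≃ᵃ[ℝ] ℂ) : Prop :=
  ∀ g ∈ G, ∃ k : ℂ ≃ᵢ ℂ, (∀ z, φ (g z) = k (φ z)) ∧ ∀ z ∈ lat ξ, ∃ y ∈ lat ξ, k (s * z) = s * y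

/-- The chart is `s * n * N * M (z - c)` with the origin `c` and the denominator `n` of
`exists_origin`. Multiplication by `n` and `N` clears all denominators, so the translational part of
each conjugate lies in the lattice scaled by `s`, while its linear part is `ρ`. The translations of
the group may form a proper sublattice. -/
theorem exists_chart [Finite (pointGroup G)] {ξ : ℂ} {s : ℝ} (hs : s ≠ 0) (M : ℂ ≃ₗ[ℝ] ℂ) {N : ℕ}
    (hN : N ≠ 0) (h1 : ∀ x ∈ translations G, (N : ℂ) * M x ∈ lat ξ)
    (h2 : ∀ p ∈ pointGroup G, ∃ ρ : ℂ ≃ₗᵢ[ℝ] ℂ, (∀ z, ρ (M z) = M (p z)) ∧ ∀ z ∈ lat ξ, ρ z ∈ lat ξ) :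
    ∃ φ, IsLatticeChart G ξ s φ := by
  obtain ⟨n, c, hn, hc⟩ := exists_origin (G := G)
  have hr : s * n * N ≠ 0 := mul_ne_zero (mul_ne_zero hs (Nat.cast_ne_zero.2 hn))
    (Nat.cast_ne_zero.2 hN)
  let φ : ℂ ≃ᵃ[ℝ] ℂ := (AffineEquiv.constVAdd ℝ ℂ (-c)).trans
    (M.trans (LinearEquiv.smulOfNeZero ℝ ℂ (s * n * N) hr)).toAffineEquiv
  have hφ : ∀ z, φ z = (s * n * N : ℝ) • M (z - c) := by
    intro z
    simp [φ, sub_eq_neg_add]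
  refine ⟨φ, fun g hg => ?_⟩
  obtain ⟨ρ, hρ, hρ'⟩ := h2 (linPart g) ⟨g, hg, rfl⟩
  have hnc : (n : ℂ) * (g c - c) = (n : ℝ) • (g c - c) := by simp
  have e := h1 _ (hc g hg)
  rw [hnc, _root_.map_smul] at e
  refine ⟨ρ.toIsometryEquiv.trans
    (IsometryEquiv.addRight ((s * n * N : ℝ) • M (g c - c))), fun z => ?_, fun z hz => ?_⟩
  · rw [hφ, hφ, IsometryEquiv.trans_apply, IsometryEquiv.addRight_apply,
      LinearIsometryEquiv.coe_toIsometryEquiv, _root_.map_smul, hρ, ← isometry_sub, ← smul_add,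
      ← map_add, sub_add_sub_cancel]
  · refine ⟨ρ z + (N : ℂ) * ((n : ℝ) • M (g c - c)), (lat ξ).add_mem (hρ' z hz) e, ?_⟩
    rw [IsometryEquiv.trans_apply, IsometryEquiv.addRight_apply,
      LinearIsometryEquiv.coe_toIsometryEquiv, ← Complex.real_smul, _root_.map_smul]
    simp only [Complex.real_smul]
    push_cast
    ring

/-- A sublattice of rank two has finite exponent. -/
theorem IsWallpaperGroup.exists_mul_mem (hG : IsWallpaperGroup G) {a b : ℂ}
    (h : LinearIndependent ℝ ![a, b]) (ha : a ∈ translations G) (hb : b ∈ translations G) :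
    ∃ N : ℕ, N ≠ 0 ∧ ∀ x ∈ translations G, ∃ m n : ℤ, (N : ℂ) * x = m * a + n * b := by
  let S : AddSubgroup (translations G) :=
    AddSubgroup.closure {⟨a, ha⟩, ⟨b, hb⟩}
  have hfin : Finite {x | x ∈ translations G ∧ ‖x‖ ≤ ‖a‖ + ‖b‖} :=
    hG.finite_translations (‖a‖ + ‖b‖)
  -- Each coset has a representative in the fundamental parallelogram of `a` and `b`, which contains
  -- finitely many translations.
  have hq : Finite (translations G ⧸ S) := by
    refine Finite.of_surjective
      (fun x : {x | x ∈ translations G ∧ ‖x‖ ≤ ‖a‖ + ‖b‖} =>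
        ((⟨x.1, x.2.1⟩ : translations G) : translations G ⧸ S)) ?_
    intro y
    obtain ⟨⟨x, hx⟩, rfl⟩ := QuotientAddGroup.mk_surjective y
    obtain ⟨α, β, hαβ⟩ := exists_coords h x
    have hz : ⌊α⌋ • a + ⌊β⌋ • b ∈ translations G :=
      add_mem (zsmul_mem ha _) (zsmul_mem hb _)
    have hle : ‖x - (⌊α⌋ • a + ⌊β⌋ • b)‖ ≤ ‖a‖ + ‖b‖ := by
      have : x - (⌊α⌋ • a + ⌊β⌋ • b) = (Int.fract α) • a + (Int.fract β) • b := by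
        rw [hαβ, ← Int.self_sub_floor, ← Int.self_sub_floor]
        simp only [zsmul_eq_mul, Complex.real_smul]
        push_cast; ring
      rw [this]
      refine (norm_add_le _ _).trans (add_le_add ?_ ?_) <;> rw [norm_smul, Real.norm_of_nonneg
        (Int.fract_nonneg _)] <;> exact mul_le_of_le_one_left (norm_nonneg _) (Int.fract_lt_one _).le
    refine ⟨⟨_, sub_mem hx hz, hle⟩, ?_⟩
    rw [QuotientAddGroup.eq]
    have h1 : (⟨a, ha⟩ : translations G) ∈ S := AddSubgroup.subset_closure (by simp)
    have h2 : (⟨b, hb⟩ : translations G) ∈ S := AddSubgroup.subset_closure (by simp)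
    have h3 := add_mem (zsmul_mem h1 ⌊α⌋) (zsmul_mem h2 ⌊β⌋)
    convert h3 using 1
    refine Subtype.ext ?_
    simp
  refine ⟨S.index, AddSubgroup.index_ne_zero_of_finite, fun x hx => ?_⟩
  have h1 := AddSubgroup.nsmul_index_mem S (⟨x, hx⟩ : translations G)
  obtain ⟨m, n, h2⟩ := AddSubgroup.mem_closure_pair.1 h1
  refine ⟨m, n, ?_⟩
  have := congrArg Subtype.val h2
  simpa using this.symm

/-- The case in which two independent translations are preserved up to sign. -/
theorem IsWallpaperGroup.exists_chart_of_axes (hG : IsWallpaperGroup G) {a b : ℂ}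
    (h : LinearIndependent ℝ ![a, b]) (ha : a ∈ translations G) (hb : b ∈ translations G)
    (hp : ∀ p ∈ pointGroup G, (p a = a ∨ p a = -a) ∧ (p b = b ∨ p b = -b)) {s : ℝ} (hs : s ≠ 0) :
    ∃ φ, IsLatticeChart G Complex.I s φ := by
  have := hG.finite_pointGroup
  obtain ⟨N, hN, hN'⟩ := hG.exists_mul_mem h ha hb
  -- Sending the axes to `1` and `I` need not be a similarity. It turns sign changes of the axes
  -- into isometries of the square lattice, and it is the reason for working up to affine
  -- equivalence.
  let M : ℂ ≃ₗ[ℝ] ℂ := (planeBasis h).equiv Complex.basisOneI (Equiv.refl _)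
  have ma : M a = 1 := by
    have := (planeBasis h).equiv_apply 0 Complex.basisOneI (Equiv.refl _)
    rw [planeBasis_zero] at this
    simpa [M] using this
  have mb : M b = Complex.I := by
    have := (planeBasis h).equiv_apply 1 Complex.basisOneI (Equiv.refl _)
    rw [planeBasis_one] at this
    simpa [M] using this
  refine exists_chart hs M hN (fun x hx => ?_) fun p hpG => ?_
  · obtain ⟨m, n, hmn⟩ := hN' x hx
    refine ⟨m, n, ?_⟩
    have e := congrArg M hmn
    have e1 : (N : ℂ) * x = (N : ℝ) • x := by simp
    have e2 : (m : ℂ) * a = (m : ℝ) • a := by simp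
    have e3 : (n : ℂ) * b = (n : ℝ) • b := by simp
    rw [e1, e2, e3, map_add, _root_.map_smul, _root_.map_smul, _root_.map_smul, ma, mb] at e
    simpa using e
  · have key : ∀ ρ : ℂ ≃ₗᵢ[ℝ] ℂ, ρ 1 = M (p a) → ρ Complex.I = M (p b) → ∀ z, ρ (M z) = M (p z) := by
      intro ρ h1 h2 z
      obtain ⟨α, β, rfl⟩ := exists_coords h z
      simp only [map_add, _root_.map_smul, ma, mb, h1, h2]
    obtain ⟨h1 | h1, h2 | h2⟩ := hp p hpG
    · refine ⟨LinearIsometryEquiv.refl ℝ ℂ, key _ (by simp [h1, ma]) (by simp [h2, mb]), ?_⟩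
      exact fun z hz => hz
    · refine ⟨Complex.conjLIE, key _ (by simp [h1, ma]) (by simp [h2, mb]), ?_⟩
      rintro _ ⟨m, n, rfl⟩
      exact ⟨m, -n, by simp⟩
    · refine ⟨Complex.conjLIE.trans (LinearIsometryEquiv.neg ℝ), key _ (by simp [h1, ma])
        (by simp [h2, mb]), ?_⟩
      rintro _ ⟨m, n, rfl⟩
      exact ⟨-m, n, by simp; ring⟩
    · refine ⟨LinearIsometryEquiv.neg ℝ, key _ (by simp [h1, ma]) (by simp [h2, mb]), ?_⟩
      exact fun z hz => (lat _).neg_mem hz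

/-! ### The crystallographic restriction -/

variable {G : Subgroup (ℂ ≃ᵢ ℂ)}

theorem IsWallpaperGroup.exists_shortest (hG : IsWallpaperGroup G) :
    ∃ v ∈ translations G, v ≠ 0 ∧ ∀ x ∈ translations G, ‖x‖ < ‖v‖ → x = 0 := by
  obtain ⟨v, w, hvw, hv, hw⟩ := hG.2
  have h0 : v ≠ 0 := hvw.ne_zero 0
  obtain ⟨a, ⟨⟨ha, hav⟩, ha0⟩, hmin⟩ :=
    exists_min_image _ (fun x : ℂ => ‖x‖) ((hG.finite_translations ‖v‖).sdiff (t := {0}))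
      ⟨v, ⟨hv, le_rfl⟩, h0⟩
  refine ⟨a, ha, ha0, fun x hx hxa => ?_⟩
  by_contra hx0
  exact absurd (hmin x ⟨⟨hx, hxa.le.trans hav⟩, hx0⟩) (not_le.2 hxa)

/-- The generator of the triangular lattice. -/
noncomputable def hexUnit : ℂ := (1 + Complex.I * (√3 : ℂ)) / 2

theorem hexUnit_re : hexUnit.re = 1 / 2 := by simp [hexUnit]

theorem hexUnit_im : hexUnit.im = √3 / 2 := by simp [hexUnit]

theorem lat_change {u ξ : ℂ} {a b : ℤ} (hb : b = 1 ∨ b = -1) (h : u = a + b * ξ) :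
    lat u = lat ξ := by
  have hb' : (b : ℂ) * b = 1 := by rcases hb with rfl | rfl <;> simp
  ext z
  constructor
  · rintro ⟨m, n, rfl⟩
    exact ⟨m + n * a, n * b, by rw [h]; push_cast; ring⟩
  · rintro ⟨m, n, rfl⟩
    refine ⟨m - n * b * a, n * b, ?_⟩
    rw [h]; push_cast
    linear_combination (-(n : ℂ) * ξ) * hb'

/-- As `u` is not real, twice its real part is `-1`, `0` or `1`. Then `u` is a root of unity of
order three, four or six, and it generates with `1` one of the two lattices. -/
theorem lat_circle {u : Circle} (hu : (u : ℂ).im ≠ 0) {m : ℤ} (hm : 2 * (u : ℂ).re = m) :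
    lat u = lat Complex.I ∨ lat u = lat hexUnit := by
  have h1 : (u : ℂ).re * (u : ℂ).re + (u : ℂ).im * (u : ℂ).im = 1 := by
    rw [← Complex.normSq_apply, Circle.normSq_coe]
  have h2 : 0 < (u : ℂ).im * (u : ℂ).im := mul_self_pos.2 hu
  have h3 : -2 < m ∧ m < 2 := by
    have : (m : ℝ) ^ 2 < 4 := by rw [← hm]; nlinarith
    constructor
    · have : (-2 : ℝ) < m := by nlinarith
      exact_mod_cast this
    · have : (m : ℝ) < 2 := by nlinarith
      exact_mod_cast this
  have key : ∀ {ξ : ℂ} {a b : ℤ}, (b = 1 ∨ b = -1) → (u : ℂ).re = a + b * ξ.re →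
      (u : ℂ).im = b * ξ.im → lat u = lat ξ := by
    intro ξ a b hb e1 e2
    exact lat_change (a := a) hb (Complex.ext (by simpa using e1) (by simpa using e2))
  have h4 := OrientedCircle.sqrt_three_sq
  obtain ⟨h5, h6⟩ := h3
  have hs : ∀ r : ℝ, (u : ℂ).im * (u : ℂ).im = r * r → (u : ℂ).im = r ∨ (u : ℂ).im = -r := fun r h =>
    mul_self_eq_mul_self_iff.1 h
  interval_cases m
  · right
    have hre : (u : ℂ).re = -1 / 2 := by push_cast at hm; linarith
    rcases hs (√3 / 2) (by rw [hre] at h1; nlinarith) with h | h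
    · exact key (a := -1) (b := 1) (Or.inl rfl) (by rw [hexUnit_re, hre]; norm_num)
        (by rw [hexUnit_im, h]; norm_num)
    · exact key (a := 0) (b := -1) (Or.inr rfl) (by rw [hexUnit_re, hre]; norm_num)
        (by rw [hexUnit_im, h]; norm_num)
  · left
    have hre : (u : ℂ).re = 0 := by push_cast at hm; linarith
    rcases hs 1 (by rw [hre] at h1; linarith) with h | h
    · exact key (a := 0) (b := 1) (Or.inl rfl) (by rw [hre]; simp) (by rw [h]; simp)
    · exact key (a := 0) (b := -1) (Or.inr rfl) (by rw [hre]; simp) (by rw [h]; simp)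
  · right
    have hre : (u : ℂ).re = 1 / 2 := by push_cast at hm; linarith
    rcases hs (√3 / 2) (by rw [hre] at h1; nlinarith) with h | h
    · exact key (a := 0) (b := 1) (Or.inl rfl) (by rw [hexUnit_re, hre]; norm_num)
        (by rw [hexUnit_im, h]; norm_num)
    · exact key (a := 1) (b := -1) (Or.inr rfl) (by rw [hexUnit_re, hre]; norm_num)
        (by rw [hexUnit_im, h]; norm_num)

/-- A lattice with a rotation of order at least three. -/
theorem IsWallpaperGroup.lattice_of_rotation (hG : IsWallpaperGroup G) {u : Circle}
    (hu : (u : ℂ).im ≠ 0) (hr : rotation u ∈ pointGroup G) :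
    ∃ v ≠ 0, (lat u = lat Complex.I ∨ lat u = lat hexUnit) ∧
      ∀ z, v * z ∈ translations G ↔ z ∈ lat u := by
  obtain ⟨v, hv, hv0, hmin⟩ := hG.exists_shortest
  have hnv : 0 < ‖v‖ := norm_pos_iff.2 hv0
  have hmin' : ∀ z : ℂ, v * z ∈ translations G → ‖z‖ < 1 → z = 0 := by
    intro z hz h
    have := hmin _ hz (by rw [norm_mul]; exact mul_lt_of_lt_one_right hnv h)
    exact (mul_eq_zero.1 this).resolve_left hv0
  have hadd : ∀ {z w : ℂ}, v * z ∈ translations G → v * w ∈ translations G →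
      v * (z - w) ∈ translations G := fun h h' => by rw [mul_sub]; exact sub_mem h h'
  have huv : v * u ∈ translations G := by
    have := pointGroup_mem_translations hr hv
    rwa [rotation_apply, mul_comm] at this
  have hlat : ∀ z ∈ lat u, v * z ∈ translations G := by
    rintro _ ⟨m, n, rfl⟩
    have : v * (m + n * u) = m • v + n • (v * u) := by
      simp only [zsmul_eq_mul]; ring
    rw [this]
    exact add_mem (zsmul_mem hv m) (zsmul_mem huv n)
  have h1 : (u : ℂ).re * (u : ℂ).re + (u : ℂ).im * (u : ℂ).im = 1 := by
    rw [← Complex.normSq_apply, Circle.normSq_coe]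
  -- twice the real part of `u` is an integer
  have htr : v * (2 * (u : ℂ).re : ℝ) ∈ translations G := by
    have h2 := pointGroup_mem_translations ((pointGroup G).inv_mem hr) hv
    have h3 : (rotation u)⁻¹ v = v * (starRingEnd ℂ) u := by
      have : (rotation u)⁻¹ = rotation u⁻¹ := (map_inv rotation u).symm
      rw [this, rotation_apply, Circle.coe_inv_eq_conj, mul_comm]
    rw [h3] at h2
    have h4 : ((2 * (u : ℂ).re : ℝ) : ℂ) = u + (starRingEnd ℂ) u := by
      rw [Complex.add_conj]
    rw [h4, mul_add]
    exact add_mem huv h2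
  -- The difference to the nearest integer is at most `1 / 2`, and `v` is a shortest translation, so
  -- the difference vanishes.
  have hm : 2 * (u : ℂ).re = (round (2 * (u : ℂ).re) : ℤ) := by
    have h2 : v * ((round (2 * (u : ℂ).re) : ℤ) : ℂ) ∈ translations G :=
      hlat _ ⟨round (2 * (u : ℂ).re), 0, by simp⟩
    have h3 := hmin' _ (hadd htr h2) (by
      rw [← Complex.ofReal_intCast, ← Complex.ofReal_sub, Complex.norm_real, Real.norm_eq_abs]
      exact (abs_sub_round _).trans_lt (by norm_num))
    rw [sub_eq_zero] at h3
    exact_mod_cast h3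
  have h3 : -2 < 2 * (u : ℂ).re ∧ 2 * (u : ℂ).re < 2 := by
    have h2 : 0 < (u : ℂ).im * (u : ℂ).im := mul_self_pos.2 hu
    constructor <;> nlinarith
  have h3' : |2 * (u : ℂ).re| ≤ 1 := by
    rw [hm] at h3 ⊢
    obtain ⟨h4, h5⟩ := h3
    rw [← Int.cast_abs]
    have h6 : -2 < round (2 * (u : ℂ).re) := by exact_mod_cast h4
    have h7 : round (2 * (u : ℂ).re) < 2 := by exact_mod_cast h5
    exact_mod_cast abs_le.2 ⟨by omega, by omega⟩
  refine ⟨v, hv0, lat_circle hu hm, fun z => ⟨fun hz => ?_, hlat z⟩⟩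
  obtain ⟨β, hβ⟩ : ∃ β : ℝ, β = z.im / (u : ℂ).im := ⟨_, rfl⟩
  obtain ⟨α, hα⟩ : ∃ α : ℝ, α = z.re - β * (u : ℂ).re := ⟨_, rfl⟩
  have hz' : z = α + β * u := by
    refine Complex.ext ?_ ?_
    · simp [hα]
    · simp [hβ, div_mul_cancel₀ _ hu]
  refine ⟨round α, round β, ?_⟩
  -- Rounding both coordinates leaves a remainder of squared norm at most `3 / 4`, which is zero
  -- since `v` is shortest.
  have hd := hadd hz (hlat (round α + round β * u) ⟨_, _, rfl⟩)
  rw [← sub_eq_zero]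
  refine hmin' _ hd ?_
  obtain ⟨x, hx⟩ : ∃ x, x = α - round α := ⟨_, rfl⟩
  obtain ⟨y, hy⟩ : ∃ y, y = β - round β := ⟨_, rfl⟩
  have e : z - (round α + round β * u) = x + y * u := by
    rw [hz', hx, hy]; push_cast; ring
  have hx' : |x| ≤ 1 / 2 := hx ▸ abs_sub_round α
  have hy' : |y| ≤ 1 / 2 := hy ▸ abs_sub_round β
  rw [e]
  have hn : ‖(x : ℂ) + y * u‖ ^ 2 = x ^ 2 + y ^ 2 + x * y * (2 * (u : ℂ).re) := by
    rw [← Complex.normSq_eq_norm_sq, Complex.normSq_apply]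
    simp
    linear_combination y ^ 2 * h1
  have hx2 : x ^ 2 ≤ (1 / 2) ^ 2 := sq_le_sq' (abs_le.1 hx').1 (abs_le.1 hx').2
  have hy2 : y ^ 2 ≤ (1 / 2) ^ 2 := sq_le_sq' (abs_le.1 hy').1 (abs_le.1 hy').2
  have hxy : x * y * (2 * (u : ℂ).re) ≤ 1 / 2 * (1 / 2) * 1 := by
    refine (le_abs_self _).trans ?_
    rw [abs_mul, abs_mul]
    gcongr
  have : ‖(x : ℂ) + y * u‖ ^ 2 < 1 ^ 2 := by rw [hn]; linarith
  exact lt_of_pow_lt_pow_left₀ 2 one_pos.le this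

/-- Division by the shortest translation is a similarity that carries the translations exactly onto
the lattice of `1` and `u`; it conjugates linear isometries to linear isometries, so no further
denominator is needed. -/
theorem IsWallpaperGroup.exists_chart_of_rotation (hG : IsWallpaperGroup G) {u : Circle}
    (hu : (u : ℂ).im ≠ 0) (hr : rotation u ∈ pointGroup G) {s : ℝ} (hs : s ≠ 0) :
    (lat u = lat Complex.I ∨ lat u = lat hexUnit) ∧ ∃ φ, IsLatticeChart G u s φ := by
  have := hG.finite_pointGroup
  obtain ⟨v, hv0, hlat, hv⟩ := hG.lattice_of_rotation hu hr
  refine ⟨hlat, exists_chart hs (LinearEquiv.smulOfNeZero ℂ ℂ v⁻¹ (inv_ne_zero hv0)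
    |>.restrictScalars ℝ) one_ne_zero (fun x hx => ?_) fun p hp => ?_⟩
  · rw [← hv]
    simpa [mul_inv_cancel_left₀ hv0] using hx
  · have hn : ‖v‖ ≠ 0 := norm_ne_zero_iff.2 hv0
    obtain ⟨w, hw⟩ := linear_isometry_complex p
    have hw' : ∃ ρ : ℂ ≃ₗᵢ[ℝ] ℂ, ∀ z, v * ρ z = p (v * z) := by
      rcases hw with rfl | rfl
      · exact ⟨rotation w, fun z => by simp only [rotation_apply]; ring⟩
      -- Conjugation does not commute with multiplication by `v`; the unit factor `conj v / v`
      -- compensates for this.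
      · have hq : (starRingEnd ℂ) v / v ∈ Metric.sphere (0 : ℂ) 1 := by
          rw [mem_sphere_zero_iff_norm, norm_div, RCLike.norm_conj, div_self hn]
        refine ⟨Complex.conjLIE.trans (rotation (w * ⟨_, hq⟩)), fun z => ?_⟩
        simp only [LinearIsometryEquiv.trans_apply, rotation_apply, Complex.conjLIE_apply, map_mul]
        change v * (w * ((starRingEnd ℂ) v / v) * _) = _
        field_simp
    obtain ⟨ρ, hρ⟩ := hw'
    refine ⟨ρ, fun z => ?_, fun z hz => ?_⟩
    · change ρ (v⁻¹ * z) = v⁻¹ * p z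
      rw [eq_inv_mul_iff_mul_eq₀ hv0, hρ, mul_inv_cancel_left₀ hv0]
    · rw [← hv, hρ]
      exact pointGroup_mem_translations hp ((hv z).2 hz)

theorem rotation_eq_neg_or {u : Circle} (hu : (u : ℂ).im = 0) :
    (∀ z, rotation u z = z) ∨ ∀ z, rotation u z = -z := by
  have h1 : (u : ℂ).re * (u : ℂ).re + (u : ℂ).im * (u : ℂ).im = 1 := by
    rw [← Complex.normSq_apply, Circle.normSq_coe]
  rw [hu, mul_zero, add_zero, mul_self_eq_one_iff] at h1
  rcases h1 with h | h
  · left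
    intro z
    rw [rotation_apply, Complex.ext (z := (u : ℂ)) (w := 1) (by simpa using h) (by simpa using hu),
      one_mul]
  · right
    intro z
    rw [rotation_apply, Complex.ext (z := (u : ℂ)) (w := -1) (by simpa using h) (by simpa using hu),
      neg_one_mul]

/-- Without rotations of order at least three, two independent translations are preserved up to
sign. -/
theorem IsWallpaperGroup.exists_axes (hG : IsWallpaperGroup G)
    (h : ∀ u : Circle, rotation u ∈ pointGroup G → (u : ℂ).im = 0) :
    ∃ a b : ℂ, LinearIndependent ℝ ![a, b] ∧ a ∈ translations G ∧ b ∈ translations G ∧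
      ∀ p ∈ pointGroup G, (p a = a ∨ p a = -a) ∧ (p b = b ∨ p b = -b) := by
  obtain ⟨v, w, hvw, hv, hw⟩ := hG.2
  by_cases href : ∃ u : Circle, Complex.conjLIE.trans (rotation u) ∈ pointGroup G
  · obtain ⟨u, hu⟩ := href
    set r := Complex.conjLIE.trans (rotation u) with hr
    have hrz : ∀ z, r z = u * (starRingEnd ℂ) z := fun z => by
      simp [hr, rotation_apply]
    have hrr : ∀ z, r (r z) = z := by
      intro z
      rw [hrz, hrz, map_mul, Complex.conj_conj, ← mul_assoc, Complex.mul_conj, Circle.normSq_coe,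
        Complex.ofReal_one, one_mul]
    -- The translations span the plane and no multiple of a reflection is minus the identity. For `ε
    -- = 1` and `ε = -1` this yields translations in the two eigenlines of `r`.
    have hne : ∀ ε : ℝ, ∃ x ∈ translations G, x + ε • r x ≠ 0 := by
      intro ε
      by_contra! h0
      have hz : ∀ z, z + ε • r z = 0 := by
        intro z
        obtain ⟨α, β, rfl⟩ := exists_coords hvw z
        have e1 := h0 v hv
        have e2 := h0 w hw
        simp only [map_add, _root_.map_smul]
        simp only [Complex.real_smul] at e1 e2 ⊢
        linear_combination α * e1 + β * e2
      have e1 := hz 1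
      have e2 := hz Complex.I
      rw [hrz, map_one, mul_one, Complex.real_smul] at e1
      rw [hrz, Complex.conj_I, Complex.real_smul] at e2
      have : (2 : ℂ) * Complex.I = 0 := by linear_combination e2 + Complex.I * e1
      simp at this
    obtain ⟨x, hx, hx0⟩ := hne 1
    obtain ⟨y, hy, hy0⟩ := hne (-1)
    rw [one_smul] at hx0
    rw [neg_one_smul, ← sub_eq_add_neg] at hy0
    have ra : r (x + r x) = x + r x := by rw [map_add, hrr, add_comm]
    have rb : r (y - r y) = -(y - r y) := by rw [map_sub, hrr, neg_sub]
    refine ⟨x + r x, y - r y, ?_, add_mem hx (pointGroup_mem_translations hu hx),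
      sub_mem hy (pointGroup_mem_translations hu hy), ?_⟩
    · rw [LinearIndependent.pair_iff]
      intro α β h0
      have h1 := congrArg r h0
      rw [map_add, _root_.map_smul, _root_.map_smul, ra, rb, map_zero, smul_neg] at h1
      have e1 : α • (x + r x) = 0 := by
        have : (2 : ℝ) • (α • (x + r x)) = 0 := by
          rw [two_smul]
          linear_combination (exp := 1) h0 + h1
        exact (smul_eq_zero.1 this).resolve_left two_ne_zero
      rw [e1, zero_add] at h0
      exact ⟨(smul_eq_zero.1 e1).resolve_right hx0, (smul_eq_zero.1 h0).resolve_right hy0⟩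
    · intro p hp
      obtain ⟨t, rfl | rfl⟩ := linear_isometry_complex p
      · rcases rotation_eq_neg_or (h t hp) with h | h
        · exact ⟨Or.inl (h _), Or.inl (h _)⟩
        · exact ⟨Or.inr (h _), Or.inr (h _)⟩
      -- A product of two reflections is a rotation in the point group, hence plus or minus the
      -- identity. So every reflection in the point group is `r` or `-r`.
      · have e : rotation (t * u⁻¹) = Complex.conjLIE.trans (rotation t) * r⁻¹ := by
          rw [eq_mul_inv_iff_mul_eq]
          ext z
          change rotation (t * u⁻¹) (r z) = _
          rw [hrz, LinearIsometryEquiv.trans_apply, rotation_apply, rotation_apply,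
            Circle.coe_mul, Circle.coe_inv, Complex.conjLIE_apply, mul_assoc,
            inv_mul_cancel_left₀ u.coe_ne_zero]
        have hmem : rotation (t * u⁻¹) ∈ pointGroup G := by
          rw [e]; exact mul_mem hp (inv_mem hu)
        have ep : ∀ z, Complex.conjLIE.trans (rotation t) z = rotation (t * u⁻¹) (r z) := by
          intro z
          rw [eq_mul_inv_iff_mul_eq] at e
          rw [← e]; rfl
        rw [ep, ep, ra, rb]
        rcases rotation_eq_neg_or (h _ hmem) with h | h
        · exact ⟨Or.inl (h _), Or.inr (h _)⟩
        · refine ⟨Or.inr (h _), Or.inl ?_⟩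
          rw [h, neg_neg]
  · push Not at href
    refine ⟨v, w, hvw, hv, hw, fun p hp => ?_⟩
    obtain ⟨t, rfl | rfl⟩ := linear_isometry_complex p
    · rcases rotation_eq_neg_or (h t hp) with h | h
      · exact ⟨Or.inl (h _), Or.inl (h _)⟩
      · exact ⟨Or.inr (h _), Or.inr (h _)⟩
    · exact absurd hp (href t)

/-- Each wallpaper group is, in a suitable affine coordinate, a group of isometries that preserve
the triangular or the square lattice. -/
theorem IsWallpaperGroup.exists_latticeChart (hG : IsWallpaperGroup G) :
    (∃ φ, IsLatticeChart G hexUnit 1 φ) ∨ ∃ φ, IsLatticeChart G Complex.I 2 φ := by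
  by_cases h : ∃ u : Circle, rotation u ∈ pointGroup G ∧ (u : ℂ).im ≠ 0
  · obtain ⟨u, hu, hu'⟩ := h
    -- The scale is the spacing of the centres: one in the triangular and two in the square
    -- configuration.
    obtain ⟨hlat, φ, hφ⟩ := hG.exists_chart_of_rotation hu' hu (s := 1) one_ne_zero
    obtain ⟨-, ψ, hψ⟩ := hG.exists_chart_of_rotation hu' hu (s := 2) two_ne_zero
    rcases hlat with h | h
    · exact Or.inr ⟨ψ, by rwa [IsLatticeChart, h] at hψ⟩
    · exact Or.inl ⟨φ, by rwa [IsLatticeChart, h] at hφ⟩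
  · push Not at h
    obtain ⟨a, b, hab, ha, hb, hp⟩ := hG.exists_axes h
    exact Or.inr (hG.exists_chart_of_axes hab ha hb hp two_ne_zero)

/-! ### Assembling the packing -/

open OrientedCircle

theorem IsLatticeChart.smul_triangular {G : Subgroup (ℂ ≃ᵢ ℂ)} {φ : ℂ ≃ᵃ[ℝ] ℂ}
    (h : IsLatticeChart G hexUnit 1 φ) : ∀ g ∈ G, ∃ k : ℂ ≃ᵢ ℂ, (∀ z, φ (g z) = k (φ z)) ∧
      ∀ c ∈ triangularBase, k • c ∈ triangularBase := by
  intro g hg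
  obtain ⟨k, hk, hk'⟩ := h g hg
  refine ⟨k, hk, tri_smul_mem fun m n => ?_⟩
  obtain ⟨_, ⟨m', n', rfl⟩, h'⟩ := hk' (m + n * hexUnit) ⟨m, n, rfl⟩
  refine ⟨m', n', ?_⟩
  simpa [eis, hexUnit] using h'

theorem IsLatticeChart.smul_square {G : Subgroup (ℂ ≃ᵢ ℂ)} {φ : ℂ ≃ᵃ[ℝ] ℂ}
    (h : IsLatticeChart G Complex.I 2 φ) : ∀ g ∈ G, ∃ k : ℂ ≃ᵢ ℂ, (∀ z, φ (g z) = k (φ z)) ∧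
      ∀ c ∈ squareBase, k • c ∈ squareBase := by
  intro g hg
  obtain ⟨k, hk, hk'⟩ := h g hg
  refine ⟨k, hk, square_smul_mem fun m n => ?_⟩
  obtain ⟨_, ⟨m', n', rfl⟩, h'⟩ := hk' (m + n * Complex.I) ⟨m, n, rfl⟩
  refine ⟨m', n', ?_⟩
  push_cast at h'
  rw [mul_assoc, mul_assoc, ← mul_add, ← mul_add]
  exact h'

/-- The group of isometries which are affinely conjugate to elements of `G`. -/
def conjugateGroup (G : Subgroup (ℂ ≃ᵢ ℂ)) (φ : ℂ ≃ᵃ[ℝ] ℂ) : Subgroup (ℂ ≃ᵢ ℂ) where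
  carrier := {k | ∃ g ∈ G, ∀ z, φ (g z) = k (φ z)}
  one_mem' := ⟨1, G.one_mem, fun _ => rfl⟩
  mul_mem' := by
    rintro k k' ⟨g, hg, h⟩ ⟨g', hg', h'⟩
    exact ⟨g * g', G.mul_mem hg hg', fun z => by
      rw [IsometryEquiv.mul_apply, IsometryEquiv.mul_apply, h, h']⟩
  inv_mem' := by
    rintro k ⟨g, hg, h⟩
    refine ⟨g⁻¹, G.inv_mem hg, fun z => k.injective ?_⟩
    rw [← h, IsometryEquiv.apply_inv_self, IsometryEquiv.apply_inv_self]

theorem Config.exists_packing {B B' : Set OrientedCircle} {γ : ℝ} (H : Config B B')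
    (hP : ∀ d ∈ B', PolyFace B γ d) (hγ : Admissible γ) (hne : B'.Nonempty)
    (hface : ∀ d ∈ B', (face B d).Nonempty)
    (hcov : TriangleCover (stackBase B γ B') (stackDual B B' γ B'))
    (hBB' : MulAction.stabilizer (ℂ ≃ᵢ ℂ) B ≤ MulAction.stabilizer (ℂ ≃ᵢ ℂ) B')
    {κ : ℝ} (hκ : ∀ c ∈ B, c.curv = κ) {G : Subgroup (ℂ ≃ᵢ ℂ)} {φ : ℂ ≃ᵃ[ℝ] ℂ}
    (hG : ∀ g ∈ G, ∃ k : ℂ ≃ᵢ ℂ, (∀ z, φ (g z) = k (φ z)) ∧ ∀ c ∈ B, k • c ∈ B) :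
    ∃ P C C' : Set OrientedCircle, IsPackingOf P C C' ∧
      IsAffinelyEquivalent (symmetryGroup C C') G ∧ IsRefinementOf C B := by
  -- Since `φ` is surjective, an isometry is determined by the element of `G` to which it is
  -- conjugate.
  have hunique : ∀ {g : ℂ ≃ᵢ ℂ} {k k' : ℂ ≃ᵢ ℂ}, (∀ z, φ (g z) = k (φ z)) →
      (∀ z, φ (g z) = k' (φ z)) → k = k' := by
    intro g k k' h h'
    ext z
    have e1 := h (φ.symm z)
    rw [h', AffineEquiv.apply_symm_apply] at e1
    exact e1.symm
  have hK : conjugateGroup G φ ≤ MulAction.stabilizer (ℂ ≃ᵢ ℂ) B := by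
    refine mem_stabilizer_of_subgroup ?_
    rintro k ⟨g, hg, h⟩
    obtain ⟨k', h', hB⟩ := hG g hg
    exact hunique h h' ▸ hB
  obtain ⟨C, C', T, hBC, hCκ, hKC, hCK⟩ := H.exists_refinement hP hγ hne hface hcov hBB' hκ hK
  refine ⟨_, C, C', ⟨T.isBaseDualPair, rfl⟩, ⟨φ, fun f => ?_⟩, hBC, fun c hc hcB c₀ hc₀ => ?_⟩
  · rw [T.symmetryGroup_eq hBC H.infinite.nonempty hκ hCκ]
    constructor
    · rintro ⟨k, hkB, hkC, -, hf, hfk⟩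
      obtain ⟨g, hg, h⟩ := hCK k hkB hkC
      exact ⟨g, hg, hf, fun z => by rw [h, AffineEquiv.apply_symm_apply, hfk]⟩
    · rintro ⟨g, hg, hf, hfg⟩
      obtain ⟨k, h, -⟩ := hG g hg
      have hk : k ∈ conjugateGroup G φ := ⟨g, hg, h⟩
      exact ⟨k, hK hk, (hKC k hk).1, (hKC k hk).2, hf, fun z => by
        rw [hfg, h, AffineEquiv.apply_symm_apply]⟩
  · rw [hκ c₀ hc₀]
    exact hCκ c hc hcB

theorem mainTheorem4 (G : Subgroup (ℂ ≃ᵢ ℂ)) (hG : IsWallpaperGroup G) :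
    ∃ P B B' : Set OrientedCircle,
      IsPackingOf P B B' ∧
      IsAffinelyEquivalent (symmetryGroup B B') G ∧
      (IsRefinementOf B triangularBase ∨ IsRefinementOf B squareBase) := by
  rcases hG.exists_latticeChart with ⟨φ, hφ⟩ | ⟨φ, hφ⟩
  · obtain ⟨P, C, C', h1, h2, h3⟩ := tri_config.exists_packing tri_polyFace Config.admissible_one
      ⟨_, triDualCircle_mem (Or.inl rfl) 0 0⟩ tri_face_nonempty
      (tri_config.stack_triangleCover Subset.rfl tri_polyFace tri_cover) tri_stabilizer_le
      (κ := 2) (fun c hc => by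
        obtain ⟨m, n, rfl⟩ := mem_triangularBase.1 hc
        exact curv_triCircle m n) hφ.smul_triangular
    exact ⟨P, C, C', h1, h2, Or.inl h3⟩
  · obtain ⟨hγ, hγ'⟩ := admissible_sqrt
    obtain ⟨P, C, C', h1, h2, h3⟩ := square_config.exists_packing (square_polyFace hγ') hγ
      ⟨_, squareDualCircle_mem 0 0⟩ square_face_nonempty square_stack_cover square_stabilizer_le
      (κ := 1) (fun c hc => by
        obtain ⟨m, n, rfl⟩ := mem_squareBase.1 hc
        exact curv_squareCircle m n) hφ.smul_square
    exact ⟨P, C, C', h1, h2, Or.inr h3⟩
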